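/- Consider the incompressible Navier–Stokes equations with unit viscosity, \[ \Delta v-(v\cdot\nabla)v-\nabla p-\partial_t v=0,\qquad \operatorname{div} v=0 . \] For $x=(x_1,x_2,x_3)\in\mathbb R^3$ let $r=\sqrt{x_1^2+x_2^2}$ be the distance to the $z$-axis and, for $r>0$, let $e_r=(x_1/r,x_2/r,0)$, $e_\theta=(-x_2/r,x_1/r,0)$, $e_z=(0,0,1)$; write $u=u_re_r+u_\theta e_\theta+u_ze_z$ for a vector field $u$, and call $u$ axially symmetric if, off the axis, $u_r,u_\theta,u_z$ depend only on $(r,x_3)$. Let $v_0\in L^2(\mathbb R^3;\mathbb R^3)$ be such that $r\,v_{0,\theta}\in L^\infty(\mathbb R^3)$. Then there is a constant $C$, depending only on $v_0$, such that the following holds. Let $T>0$, let $v$ (with some smooth pressure $p$) be a smooth solution of the Navier–Stokes equations on $\mathbb R^3\times(-T,0)$, with $v(\cdot,t)$ axially symmetric for every $t\in(-T,0)$, that is a Leray–Hopf solution with initial data $v_0$ at time $-T$, i.e. $v(\cdot,t)\to v_0$ in $L^2(\mathbb R^3)$ as $t\downarrow -T$ and \[ \|v(\cdot,t)\|_{L^2(\mathbb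 R^3)}^2+2\int_{-T}^t\int_{\mathbb R^3}|\nabla v|^2\,dx\,ds\le\|v_0\|_{L^2(\mathbb R^3)}^2\qquad\text{for all } t\in(-T,0). \] Put $R=\min\{1,\sqrt{T/2}\}$. Then for all $t\in(-R^2,0)$ and all $x\in\mathbb R^3$ with $0<r\le\min\{1/2,R\}$, \[ |v_r(x,t)|+|v_z(x,t)|\le\frac{C\,\sqrt{|\ln r|}}{r^2}. \] -/

import Mathlib

open MeasureTheory Set Filter Topology
open scoped ContDiff ENNReal

noncomputable section

namespace AxiNS

/-- Three-dimensional Euclidean space; the coordinates `x 0, x 1, x 2` are `x₁, x₂, x₃`. -/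
abbrev E3 : Type := EuclideanSpace ℝ (Fin 3)

/-- Distance from `x` to the `z`-axis. -/
def rad (x : E3) : ℝ := Real.sqrt (x 0 ^ 2 + x 1 ^ 2)

/-- The cylindrical frame `e_r, e_θ, e_z` (meaningful for `0 < rad x`). -/
def eR (x : E3) : E3 := !₂[x 0 / rad x, x 1 / rad x, 0]

def eTheta (x : E3) : E3 := !₂[-(x 1) / rad x, x 0 / rad x, 0]

def eZ : E3 := !₂[0, 0, 1]

/-- Cylindrical components of a vector field. -/
def compR (u : E3 → E3) (x : E3) : ℝ := inner ℝ (u x) (eR x)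

def compTheta (u : E3 → E3) (x : E3) : ℝ := inner ℝ (u x) (eTheta x)

def compZ (u : E3 → E3) (x : E3) : ℝ := inner ℝ (u x) eZ

/-- Away from the axis, `u = u_r e_r + u_θ e_θ + u_z e_z` with components depending only
on `(r, z)`. -/
def IsAxiallySymmetric (u : E3 → E3) : Prop :=
  ∃ f g h : ℝ → ℝ → ℝ, ∀ x : E3, 0 < rad x →
    u x = f (rad x) (x 2) • eR x + g (rad x) (x 2) • eTheta x + h (rad x) (x 2) • eZ

/-- The partial derivative `∂ᵢ u`. -/
def partialD (i : Fin 3) (u : E3 → E3) (x : E3) : E3 :=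
  fderiv ℝ u x (EuclideanSpace.single i 1)

def divergence (u : E3 → E3) (x : E3) : ℝ := ∑ i, (partialD i u x) i

/-- `|∇u|² = ∑ᵢⱼ (∂ᵢ uⱼ)²`, as an extended nonnegative real. -/
def gradSq (u : E3 → E3) (x : E3) : ℝ≥0∞ := ∑ i, ‖partialD i u x‖ₑ ^ 2

/-- `(v, p)` is a smooth solution of the incompressible Navier–Stokes equations
`Δv - (v·∇)v - ∇p - ∂ₜv = 0`, `div v = 0` on `ℝ³ × (-T, 0)`; time is the first argument. -/
structure IsSmoothSolution (T : ℝ) (v : ℝ → E3 → E3) (p : ℝ → E3 → ℝ) : Prop where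
  smooth_v : ContDiffOn ℝ ∞ (fun q : ℝ × E3 => v q.1 q.2) (Ioo (-T) 0 ×ˢ univ)
  smooth_p : ContDiffOn ℝ ∞ (fun q : ℝ × E3 => p q.1 q.2) (Ioo (-T) 0 ×ˢ univ)
  momentum : ∀ t ∈ Ioo (-T) 0, ∀ x : E3,
    (Laplacian.laplacian (v t) : E3 → E3) x - fderiv ℝ (v t) x (v t x) - gradient (p t) x
      - deriv (fun s => v s x) t = 0
  incompressible : ∀ t ∈ Ioo (-T) 0, ∀ x : E3, divergence (v t) x = 0

/-- The Leray–Hopf conditions linking a (smooth) solution on `(-T, 0)` to its initial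
data `v₀` at time `-T`: the data are attained in `L²`, and the energy inequality holds. -/
structure IsLerayHopf (T : ℝ) (v₀ : E3 → E3) (v : ℝ → E3 → E3) : Prop where
  initial : Tendsto (fun t => eLpNorm (v t - v₀) 2 volume) (𝓝[>] (-T)) (𝓝 0)
  energy : ∀ t ∈ Ioo (-T) 0,
    eLpNorm (v t) 2 volume ^ 2 + 2 * ∫⁻ s in Ioo (-T) t, ∫⁻ x, gradSq (v s) x
      ≤ eLpNorm v₀ 2 volume ^ 2

end AxiNS

end

open MeasureTheory Set Filter Topology
open scoped ContDiff ENNReal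

noncomputable section

namespace AxiNS

/-! The bound is a scaling argument around a local estimate at unit distance from the axis. Near a
point at distance `l` from the axis, the flow is rescaled parabolically by `l`. It then lives on a
box around `(r, z) = (1, 0)` where `1/2 ≤ r ≤ 3/2`, so an axially symmetric flow is a planar one
with harmless lower-order terms. The global energy `E` becomes a planar energy of order `A = E / l`:
the speed contributes `l² · l⁻³` and the dissipation `l⁴ · l⁻³ · l⁻²`. It therefore suffices to show
`|f| + |h| ≤ C A √(log A)` for the radial and vertical velocities at unit scale
(`exists_unit_velocity_bound`). Undoing the scaling costs one more factor `l⁻¹`, and `log (6 E / l)`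
is comparable to `|log l|` for `l ≤ 1/2`.

At unit scale the analysis is two-dimensional and rests on Ladyzhenskaya's inequality. It puts `f`,
`h` and the swirl `Γ` in space-time `L⁴` with `∫ u⁴ ≲ A²`. The local energy estimate
`exists_local_energy` treats drift-diffusion inequalities whose drift is divergence free for `r dr
dz`. Integrating by parts moves the drift onto the cutoff, Ladyzhenskaya's inequality and Young's
inequality absorb it, and the cost is a factor `1 + β ≲ A`, where `β²` bounds `∫ |b|⁴`.

This estimate is used three times, in `exists_vorticity_bounds`, on shrinking boxes. For the
relative vorticity `Ω`, forced by `∂_z (Γ² / r⁴)`, it gives `∫ Ω² ≲ A²` at each time and `∫ Ω⁴ ≲ A⁴`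
in space-time. For `Γ²`, a subsolution, it raises the swirl from `L⁴` to `L⁸`. For `Ω²`, a
subsolution up to flux and source terms, it gives `∫ Ω⁴ ≲ A⁶` at the final time. The power in the
`L²` bound is decisive. The `L⁴` bound only has to be polynomial in `A`.

Finally the velocity is recovered from its divergence and curl. By a Cauchy–Pompeiu formula the
localized velocity at the centre is bounded by `∫ H(x) / |x - x₀| dx`, with `H` of size `|f| + |h| +
|Ω|` (`abs_le_integral_divCurl`). The planar kernel `1 / |x|` just fails to be in `L²`. Splitting at
radius `A⁻⁴` (`integral_polar_log_bound`), the `L⁴` bound makes the inner part negligible, and on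
the annulus outside it Cauchy–Schwarz gives `‖H‖₂ √(log A) ≲ A √(log A)`. This is the source of the
square root of the logarithm.

The remaining work is the reduction of the Cartesian equations to this setting. Rotational symmetry
is encoded through the angular derivative `ang`. The symmetry of the pressure is not assumed: it
follows from the equation and the periodicity of the pressure around circles
(`IsSmoothSolution.ang_press`). -/

/-! ### Directional derivatives -/

section Directional

variable {E : Type*} [NormedAddCommGroup E] [NormedSpace ℝ E]

/-- The derivative of `u` in the direction `e`. -/
def dirD (e : E) (u : E → ℝ) : E → ℝ := fun q => fderiv ℝ u q e

theorem dirD_mul {e q : E} {u v : E → ℝ} (hu : DifferentiableAt ℝ u q)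
    (hv : DifferentiableAt ℝ v q) :
    dirD e (fun x => u x * v x) q = dirD e u q * v q + u q * dirD e v q := by
  simp only [dirD, fderiv_fun_mul hu hv, FunLike.coe_add, FunLike.coe_smul, Pi.add_apply,
    Pi.smul_apply, smul_eq_mul]
  ring

theorem dirD_add {e q : E} {u v : E → ℝ} (hu : DifferentiableAt ℝ u q)
    (hv : DifferentiableAt ℝ v q) :
    dirD e (fun x => u x + v x) q = dirD e u q + dirD e v q := by
  simp [dirD, fderiv_fun_add hu hv]

theorem dirD_sub {e q : E} {u v : E → ℝ} (hu : DifferentiableAt ℝ u q)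
    (hv : DifferentiableAt ℝ v q) :
    dirD e (fun x => u x - v x) q = dirD e u q - dirD e v q := by
  simp [dirD, fderiv_fun_sub hu hv]

theorem dirD_const_mul {e q : E} {u : E → ℝ} (c : ℝ) (hu : DifferentiableAt ℝ u q) :
    dirD e (fun x => c * u x) q = c * dirD e u q := by
  simp [dirD, fderiv_const_mul hu]

theorem dirD_sq {e q : E} {u : E → ℝ} (hu : DifferentiableAt ℝ u q) :
    dirD e (fun x => u x ^ 2) q = 2 * u q * dirD e u q := by
  have : (fun x => u x ^ 2) = fun x => u x * u x := by ext; ring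
  rw [this, dirD_mul hu hu]; ring

theorem dirD_congr {e q : E} {u v : E → ℝ} (h : u =ᶠ[𝓝 q] v) : dirD e u q = dirD e v q := by
  simp [dirD, h.fderiv_eq]

theorem dirD_eventuallyEq {e q : E} {u v : E → ℝ} (h : u =ᶠ[𝓝 q] v) :
    dirD e u =ᶠ[𝓝 q] dirD e v := by
  filter_upwards [h.eventuallyEq_nhds] with x hx using dirD_congr hx

theorem contDiff_dirD {e : E} {u : E → ℝ} (hu : ContDiff ℝ ∞ u) : ContDiff ℝ ∞ (dirD e u) :=
  (hu.fderiv_right (m := ∞) (by simp)).clm_apply contDiff_const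

theorem contDiffOn_dirD {e : E} {u : E → ℝ} {O : Set E} (hO : IsOpen O)
    (hu : ContDiffOn ℝ ∞ u O) : ContDiffOn ℝ ∞ (dirD e u) O :=
  (hu.fderiv_of_isOpen (m := ∞) hO (by simp)).clm_apply contDiffOn_const

theorem differentiable_of_smooth {u : E → ℝ} (hu : ContDiff ℝ ∞ u) : Differentiable ℝ u :=
  hu.differentiable (by simp)

theorem tsupport_dirD_subset {e : E} (u : E → ℝ) : tsupport (dirD e u) ⊆ tsupport u :=
  tsupport_fderiv_apply_subset ℝ e

theorem hasCompactSupport_dirD {e : E} {u : E → ℝ} (hu : HasCompactSupport u) :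
    HasCompactSupport (dirD e u) :=
  hu.fderiv_apply ℝ e

theorem dirD_comm {e e' q : E} {u : E → ℝ} (hu : ContDiffAt ℝ ∞ u q) :
    dirD e (dirD e' u) q = dirD e' (dirD e u) q := by
  have hd : DifferentiableAt ℝ (fderiv ℝ u) q :=
    (hu.fderiv_right (m := 1) (by norm_cast)).differentiableAt (by simp)
  have key : ∀ a b : E, dirD a (dirD b u) q = fderiv ℝ (fderiv ℝ u) q a b := by
    intro a b
    unfold dirD
    rw [fderiv_clm_apply hd (by fun_prop)]
    simp
  rw [key, key]
  exact (hu.isSymmSndFDerivAt (by simp; norm_cast)) e e'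

/-- Smooth cutoff functions. -/
theorem exists_cutoff [FiniteDimensional ℝ E] {K O : Set E} (hK : IsCompact K) (hO : IsOpen O)
    (hKO : K ⊆ O) :
    ∃ φ : E → ℝ, ContDiff ℝ ∞ φ ∧ HasCompactSupport φ ∧ tsupport φ ⊆ O ∧
      (∀ᶠ x in 𝓝ˢ K, φ x = 1) ∧ ∀ x, φ x ∈ Icc (0 : ℝ) 1 := by
  obtain ⟨L, hL, hKL, hLO⟩ := exists_compact_between hK hO hKO
  obtain ⟨f, h1, h0, h01⟩ := exists_contMDiffMap_one_nhds_of_subset_interior (n := ⊤)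
    (modelWithCornersSelf ℝ E) hK.isClosed hKL
  have hs : tsupport f ⊆ L := by
    apply closure_minimal _ hL.isClosed
    intro x hx
    by_contra hxL
    exact hx (h0 x hxL)
  exact ⟨f, f.contMDiff.contDiff, HasCompactSupport.intro' hL hL.isClosed (fun x hx => h0 x hx),
    hs.trans hLO, h1, h01⟩

/-- A function that is smooth near a compact set agrees near it with a globally smooth one. -/
theorem exists_smooth_extension [FiniteDimensional ℝ E] {K O : Set E} (hK : IsCompact K)
    (hO : IsOpen O) (hKO : K ⊆ O) {u : E → ℝ} (hu : ContDiffOn ℝ ∞ u O) :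
    ∃ w : E → ℝ, ContDiff ℝ ∞ w ∧ ∀ᶠ x in 𝓝ˢ K, w x = u x := by
  obtain ⟨φ, hφ, -, hφO, hφ1, -⟩ := exists_cutoff hK hO hKO
  refine ⟨fun x => φ x * u x, ?_, ?_⟩
  · rw [contDiff_iff_contDiffAt]
    intro x
    by_cases hx : x ∈ tsupport φ
    · exact hφ.contDiffAt.mul (hu.contDiffAt (hO.mem_nhds (hφO hx)))
    · refine (contDiffAt_const (c := (0 : ℝ))).congr_of_eventuallyEq ?_
      have := notMem_tsupport_iff_eventuallyEq.1 hx
      filter_upwards [this] with y hy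
      simp [hy]
  · filter_upwards [hφ1] with x hx
    simp [hx]

end Directional

/-! ### Integrals of compactly supported functions -/

section Planar

/-- Space-time in the variables `(s, r, z)`. -/
abbrev Z : Type := ℝ × ℝ × ℝ

abbrev dS (u : Z → ℝ) : Z → ℝ := dirD ((1, 0, 0) : Z) u
abbrev dR (u : Z → ℝ) : Z → ℝ := dirD ((0, 1, 0) : Z) u
abbrev dZ (u : Z → ℝ) : Z → ℝ := dirD ((0, 0, 1) : Z) u

/-- Integration by parts against the constant function 1. -/
theorem integral_dirD_eq_zero {E : Type*} [NormedAddCommGroup E] [NormedSpace ℝ E]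
    [FiniteDimensional ℝ E] [MeasurableSpace E] [BorelSpace E] {μ : Measure E}
    [μ.IsAddHaarMeasure] {u : E → ℝ} (hu : ContDiff ℝ 1 u)
    (hc : HasCompactSupport u) (e : E) : ∫ x, dirD e u x ∂μ = 0 := by
  have hcont : Continuous (dirD e u) := (hu.continuous_fderiv (by simp)).clm_apply continuous_const
  have h := integral_mul_fderiv_eq_neg_fderiv_mul_of_integrable (μ := μ) (f := fun _ : E => (1 : ℝ))
    (g := u) (v := e) (by simp) (by
      simp only [one_mul]
      exact hcont.integrable_of_hasCompactSupport (hasCompactSupport_dirD hc))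
    (by simpa using hu.continuous.integrable_of_hasCompactSupport hc)
    (by intro x _; fun_prop) (by intro x _; exact hu.differentiable (by simp) x)
  simpa [dirD] using h

theorem hasCompactSupport_slice {u : Z → ℝ} (hc : HasCompactSupport u) (s : ℝ) :
    HasCompactSupport (fun x : ℝ × ℝ => u (s, x)) := by
  refine HasCompactSupport.of_support_subset_isCompact (hc.isCompact.image continuous_snd) ?_
  intro x hx
  exact ⟨(s, x), subset_tsupport _ hx, rfl⟩

theorem hasCompactSupport_fiber {u : Z → ℝ} (hc : HasCompactSupport u) (x : ℝ × ℝ) :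
    HasCompactSupport (fun s : ℝ => u (s, x)) := by
  refine HasCompactSupport.of_support_subset_isCompact (hc.isCompact.image continuous_fst) ?_
  intro s hs
  exact ⟨(s, x), subset_tsupport _ hs, rfl⟩

theorem dirD_slice {u : Z → ℝ} (hu : Differentiable ℝ u) (s : ℝ) (e x : ℝ × ℝ) :
    dirD e (fun y => u (s, y)) x = dirD ((0, e) : Z) u (s, x) := by
  have h1 : HasFDerivAt (fun y : ℝ × ℝ => ((s, y) : Z))
      (ContinuousLinearMap.inr ℝ ℝ (ℝ × ℝ)) x := by
    exact hasFDerivAt_prodMk_right s x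
  have := (hu (s, x)).hasFDerivAt.comp x h1
  simp only [dirD]
  erw [this.fderiv]
  simp

/-- The region `s ≤ t`. -/
def past (t : ℝ) : Set Z := Iic t ×ˢ univ

theorem measurableSet_past (t : ℝ) : MeasurableSet (past t) := measurableSet_Iic.prod .univ

theorem integral_past {u : Z → ℝ} (hu : Continuous u) (hc : HasCompactSupport u) (t : ℝ) :
    ∫ q in past t, u q = ∫ s in Iic t, ∫ x : ℝ × ℝ, u (s, x) := by
  have hi : Integrable u (volume : Measure Z) := hu.integrable_of_hasCompactSupport hc
  rw [past, Measure.volume_eq_prod, setIntegral_prod]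
  · simp
  · rw [← Measure.volume_eq_prod]; exact hi.integrableOn

/-- Spatial directions are tangent to the face `s = t`, so fluxes leave no boundary term there. -/
theorem integral_past_space_dirD {u : Z → ℝ} (hu : ContDiff ℝ 1 u) (hc : HasCompactSupport u)
    (t : ℝ) (e : ℝ × ℝ) : ∫ q in past t, dirD ((0, e) : Z) u q = 0 := by
  have hcont : Continuous (dirD ((0, e) : Z) u) :=
    (hu.continuous_fderiv (by simp)).clm_apply continuous_const
  rw [integral_past hcont (hasCompactSupport_dirD hc)]
  have : ∀ s, ∫ x : ℝ × ℝ, dirD ((0, e) : Z) u (s, x) = 0 := by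
    intro s
    simp_rw [← dirD_slice (hu.differentiable (by simp)) s e]
    exact integral_dirD_eq_zero (hu.comp (contDiff_prodMk_right s)) (hasCompactSupport_slice hc s) e
  simp [this]

/-- The time derivative is transverse to the face `s = t`; its boundary term is the energy at time
`t` in the estimates below. -/
theorem integral_past_dS {u : Z → ℝ} (hu : ContDiff ℝ 1 u) (hc : HasCompactSupport u)
    (t : ℝ) : ∫ q in past t, dS u q = ∫ x : ℝ × ℝ, u (t, x) := by
  have hcont : Continuous (dS u) :=
    (hu.continuous_fderiv (by simp)).clm_apply continuous_const
  have hi : Integrable (dS u) (volume : Measure Z) :=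
    hcont.integrable_of_hasCompactSupport (hasCompactSupport_dirD hc)
  have h1 : ∫ q in past t, dS u q = ∫ x : ℝ × ℝ, ∫ s in Iic t, dS u (s, x) := by
    rw [past, Measure.volume_eq_prod, ← Measure.prod_restrict, integral_prod_symm]
    · simp
    · rw [Measure.prod_restrict, ← Measure.volume_eq_prod]; exact hi.integrableOn
  rw [h1]
  congr 1; ext x
  have h2 : ∀ s, dS u (s, x) = deriv (fun s => u (s, x)) s := by
    intro s
    have h3 : HasDerivAt (fun s : ℝ => ((s, x) : Z)) (1, 0) s :=
      (hasDerivAt_id s).prodMk (hasDerivAt_const s x)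
    have := (hu.differentiable (by simp) (s, x)).hasFDerivAt.comp_hasDerivAt s h3
    rw [show (fun s => u (s, x)) = u ∘ fun s => (s, x) from rfl, this.deriv]
    rfl
  simp_rw [h2]
  exact HasCompactSupport.integral_Iic_deriv_eq (hu.comp (contDiff_prodMk_left x))
    (hasCompactSupport_fiber hc x) t

end Planar

/-! ### Ladyzhenskaya's inequality -/

/-- The quadratic `c ↦ ∫ (f - c g)²` is nonnegative, so its discriminant is nonpositive. -/
theorem sq_integral_mul_le {α : Type*} [MeasurableSpace α] {μ : Measure α} {f g : α → ℝ}
    (hf : Integrable (fun x => f x ^ 2) μ) (hg : Integrable (fun x => g x ^ 2) μ)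
    (hfg : Integrable (fun x => f x * g x) μ) :
    (∫ x, f x * g x ∂μ) ^ 2 ≤ (∫ x, f x ^ 2 ∂μ) * ∫ x, g x ^ 2 ∂μ := by
  have h : ∀ c : ℝ, 0 ≤ (∫ x, g x ^ 2 ∂μ) * (c * c) + (-2 * ∫ x, f x * g x ∂μ) * c
      + ∫ x, f x ^ 2 ∂μ := by
    intro c
    have h1 : 0 ≤ ∫ x, (f x - c * g x) ^ 2 ∂μ := integral_nonneg fun x => sq_nonneg _
    have h2 : ∫ x, (f x - c * g x) ^ 2 ∂μ
        = ∫ x, (f x ^ 2 + (-2 * c) * (f x * g x)) + (c * c) * g x ^ 2 ∂μ := by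
      congr 1; ext x; ring
    have h3 : Integrable (fun x => f x ^ 2 + (-2 * c) * (f x * g x)) μ :=
      hf.add (hfg.const_mul _)
    rw [h2, integral_add h3 (hg.const_mul _),
      integral_add hf (hfg.const_mul _), integral_const_mul, integral_const_mul] at h1
    linarith
  have := discrim_le_zero h
  unfold discrim at this
  nlinarith

/-- The planar Sobolev embedding of `W^{1,1}` in `L²`, applied to `u²`, gives `‖u²‖₂ ≤ 2 c ∫ |u|
|∇u|`; Cauchy–Schwarz finishes. -/
theorem exists_ladyzhenskaya : ∃ C : ℝ, 1 ≤ C ∧ ∀ u : ℝ × ℝ → ℝ, ContDiff ℝ 1 u →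
    HasCompactSupport u →
    ∫ x, u x ^ 4 ≤ C * (∫ x, u x ^ 2) * ∫ x, (dirD (1, 0) u x ^ 2 + dirD (0, 1) u x ^ 2) := by
  set c := eLpNormLESNormFDerivOneConst (volume : Measure (ℝ × ℝ)) 2 with hc
  -- The constant is `(2 c)²` from the derivative of `u²`, times 2 from comparing norms of the
  -- gradient; the added 1 only ensures `1 ≤ C`.
  refine ⟨8 * (c : ℝ) ^ 2 + 1, by nlinarith [sq_nonneg (c : ℝ)], fun u hu hs => ?_⟩
  have hdu : Differentiable ℝ u := hu.differentiable (by simp)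
  have h1 : ContDiff ℝ 1 (fun x => u x ^ 2) := hu.pow 2
  have hs1 : HasCompactSupport (fun x => u x ^ 2) := by
    simp_rw [pow_two]; exact hs.mul_left
  have hcf : Continuous (fderiv ℝ u) := hu.continuous_fderiv (by simp)
  have hsf : HasCompactSupport (fderiv ℝ u) := hs.fderiv ℝ
  have key := eLpNorm_le_eLpNorm_fderiv_one (volume : Measure (ℝ × ℝ)) h1 hs1 (p := 2) (by
    simp; constructor <;> norm_num)
  have hfd : ∀ x, ‖fderiv ℝ (fun x => u x ^ 2) x‖ = 2 * (|u x| * ‖fderiv ℝ u x‖) := by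
    intro x
    have : fderiv ℝ (fun x => u x ^ 2) x = (2 * u x) • fderiv ℝ u x := by
      have := ((hdu x).hasFDerivAt.pow 2).fderiv
      simpa using this
    rw [this, norm_smul]; simp; ring
  have hc1 : Continuous fun x => |u x| * ‖fderiv ℝ u x‖ := hu.continuous.abs.mul hcf.norm
  have hi1 : Integrable fun x => |u x| * ‖fderiv ℝ u x‖ :=
    hc1.integrable_of_hasCompactSupport (HasCompactSupport.mul_left hsf.norm)
  have hR : eLpNorm (fderiv ℝ (fun x => u x ^ 2)) 1 volume
      = ENNReal.ofReal (2 * ∫ x, |u x| * ‖fderiv ℝ u x‖) := by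
    rw [eLpNorm_one_eq_lintegral_enorm, ← integral_const_mul,
      ofReal_integral_eq_lintegral_ofReal (hi1.const_mul 2)
        (Eventually.of_forall fun x => by positivity)]
    congr 1; ext x
    rw [← hfd, ofReal_norm]
  have hL : eLpNorm (fun x => u x ^ 2) 2 volume = ENNReal.ofReal ((∫ x, u x ^ 4) ^ (1 / 2 : ℝ)) := by
    have hm : MemLp (fun x => u x ^ 2) 2 (volume : Measure (ℝ × ℝ)) :=
      h1.continuous.memLp_of_hasCompactSupport hs1
    rw [hm.eLpNorm_eq_integral_rpow_norm (by simp) (by simp)]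
    congr 2
    · simp [← pow_mul]
    · simp
  rw [hR] at key
  erw [hL] at key
  have hI0 : 0 ≤ ∫ x, |u x| * ‖fderiv ℝ u x‖ := integral_nonneg fun x => by positivity
  have hI4 : 0 ≤ ∫ x, u x ^ 4 := integral_nonneg fun x => by positivity
  rw [← ENNReal.ofReal_coe_nnreal, ← ENNReal.ofReal_mul (by positivity),
    ENNReal.ofReal_le_ofReal_iff (by positivity), ← Real.sqrt_eq_rpow] at key
  have h4 : ∫ x, u x ^ 4 ≤ (c * (2 * ∫ x, |u x| * ‖fderiv ℝ u x‖)) ^ 2 := by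
    rw [← Real.sqrt_le_left (by positivity)]
    exact key
  have hiu : Integrable fun x => |u x| ^ 2 := by
    have : (fun x => |u x| ^ 2) = fun x => u x ^ 2 := by ext; simp
    rw [this]; exact h1.continuous.integrable_of_hasCompactSupport hs1
  have hif : Integrable fun x => ‖fderiv ℝ u x‖ ^ 2 := by
    refine (hcf.norm.pow 2).integrable_of_hasCompactSupport ?_
    simp_rw [pow_two]; exact HasCompactSupport.mul_left hsf.norm
  have hcs := sq_integral_mul_le hiu hif hi1
  have hcd : ∀ e : ℝ × ℝ, Continuous (dirD e u) := fun e => hcf.clm_apply continuous_const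
  have hid : ∀ e : ℝ × ℝ, Integrable fun x => dirD e u x ^ 2 := by
    intro e
    refine ((hcd e).pow 2).integrable_of_hasCompactSupport ?_
    simp_rw [pow_two]; exact HasCompactSupport.mul_left (hasCompactSupport_dirD hs)
  have hle : ∫ x, ‖fderiv ℝ u x‖ ^ 2
      ≤ 2 * ∫ x, (dirD (1, 0) u x ^ 2 + dirD (0, 1) u x ^ 2) := by
    rw [← integral_const_mul]
    refine integral_mono hif (((hid _).add (hid _)).const_mul 2) fun x => ?_
    -- `ℝ × ℝ` carries the sup norm, so the dual norm is the sum of the absolute values of the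
    -- partial derivatives. Hence the factor 2 against the Euclidean square.
    have hn : ‖fderiv ℝ u x‖ ≤ |dirD (1, 0) u x| + |dirD (0, 1) u x| := by
      refine ContinuousLinearMap.opNorm_le_bound _ (by positivity) fun y => ?_
      have : fderiv ℝ u x y = y.1 * dirD (1, 0) u x + y.2 * dirD (0, 1) u x := by
        conv_lhs => rw [show y = y.1 • ((1 : ℝ), (0 : ℝ)) + y.2 • ((0 : ℝ), (1 : ℝ)) by
          ext <;> simp]
        rw [map_add, map_smul, map_smul]; rfl
      rw [this]
      have a1 : |y.1| ≤ ‖y‖ := norm_fst_le y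
      have a2 : |y.2| ≤ ‖y‖ := norm_snd_le y
      calc ‖y.1 * dirD (1, 0) u x + y.2 * dirD (0, 1) u x‖
          ≤ |y.1| * |dirD (1, 0) u x| + |y.2| * |dirD (0, 1) u x| := by
            rw [Real.norm_eq_abs, ← abs_mul, ← abs_mul]; exact abs_add_le _ _
        _ ≤ (|dirD (1, 0) u x| + |dirD (0, 1) u x|) * ‖y‖ := by
            nlinarith [mul_le_mul_of_nonneg_right a1 (abs_nonneg (dirD (1, 0) u x)),
              mul_le_mul_of_nonneg_right a2 (abs_nonneg (dirD (0, 1) u x))]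
    have hn0 := norm_nonneg (fderiv ℝ u x)
    have := pow_le_pow_left₀ hn0 hn 2
    simp only
    nlinarith [sq_abs (dirD (1, 0) u x), sq_abs (dirD (0, 1) u x),
      sq_nonneg (|dirD (1, 0) u x| - |dirD (0, 1) u x|)]
  simp_rw [sq_abs] at hcs
  have hu0 : 0 ≤ ∫ x, u x ^ 2 := integral_nonneg fun x => by positivity
  have hd0 : 0 ≤ ∫ x, (dirD (1, 0) u x ^ 2 + dirD (0, 1) u x ^ 2) :=
    integral_nonneg fun x => by positivity
  have h5 : (∫ x, |u x| * ‖fderiv ℝ u x‖) ^ 2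
      ≤ 2 * ((∫ x, u x ^ 2) * ∫ x, (dirD (1, 0) u x ^ 2 + dirD (0, 1) u x ^ 2)) := by
    nlinarith [mul_le_mul_of_nonneg_left hle hu0]
  have h6 := mul_le_mul_of_nonneg_left h5 (show 0 ≤ 4 * (c : ℝ) ^ 2 by positivity)
  nlinarith [mul_nonneg hu0 hd0]

/-! ### Local energy estimate for drift-diffusion inequalities -/

theorem integrable_past {u : Z → ℝ} (hu : Continuous u) (hc : HasCompactSupport u) (t : ℝ) :
    IntegrableOn u (past t) :=
  (hu.integrable_of_hasCompactSupport hc).integrableOn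

/-- Ladyzhenskaya's inequality is applied on each time slice; the slice `L²` norm is bounded by its
supremum `S` and the gradient is integrated in time. -/
theorem exists_ladyzhenskaya_past : ∃ C : ℝ, 1 ≤ C ∧ ∀ u : Z → ℝ, ContDiff ℝ ∞ u →
    HasCompactSupport u → ∀ S : ℝ, (∀ t ≤ 0, ∫ x : ℝ × ℝ, u (t, x) ^ 2 ≤ S) →
    ∫ q in past 0, u q ^ 4 ≤ C * S * ∫ q in past 0, (dR u q ^ 2 + dZ u q ^ 2) := by
  obtain ⟨C, hC, hlad⟩ := exists_ladyzhenskaya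
  refine ⟨C, hC, fun u hu hc S hS => ?_⟩
  have hd := differentiable_of_smooth hu
  have c4 : Continuous fun q => u q ^ 4 := hu.continuous.pow 4
  have s4 : HasCompactSupport fun q => u q ^ 4 := hc.comp_left (g := fun y : ℝ => y ^ 4) (by simp)
  have cd : Continuous fun q => dR u q ^ 2 + dZ u q ^ 2 :=
    ((contDiff_dirD hu).continuous.pow 2).add ((contDiff_dirD hu).continuous.pow 2)
  have sd : HasCompactSupport fun q => dR u q ^ 2 + dZ u q ^ 2 :=
    ((hasCompactSupport_dirD hc).comp_left (g := fun y : ℝ => y ^ 2) (by simp)).add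
      ((hasCompactSupport_dirD hc).comp_left (g := fun y : ℝ => y ^ 2) (by simp))
  rw [integral_past c4 s4, integral_past cd sd, ← integral_const_mul]
  have iu : ∀ {v : Z → ℝ}, Continuous v → HasCompactSupport v →
      Integrable (fun s => ∫ x : ℝ × ℝ, v (s, x)) (volume.restrict (Iic 0)) := by
    intro v hv hcv
    have := hv.integrable_of_hasCompactSupport (μ := (volume : Measure Z)) hcv
    rw [Measure.volume_eq_prod] at this
    exact this.integral_prod_left.restrict
  refine setIntegral_mono_on (iu c4 s4) ((iu cd sd).const_mul _) measurableSet_Iic fun t ht => ?_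
  have := hlad (fun x => u (t, x)) ((hu.comp (contDiff_prodMk_right t)).of_le (by simp))
    (hasCompactSupport_slice hc t)
  simp_rw [dirD_slice hd] at this
  refine this.trans ?_
  have h0 : 0 ≤ ∫ x : ℝ × ℝ, (dR u (t, x) ^ 2 + dZ u (t, x) ^ 2) :=
    integral_nonneg fun x => by positivity
  exact mul_le_mul_of_nonneg_right (mul_le_mul_of_nonneg_left (hS t ht) (by linarith)) h0

theorem dirD_radius (e q : Z) : dirD e (fun x : Z => x.2.1) q = e.2.1 := by
  have : HasFDerivAt (fun x : Z => x.2.1)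
      ((ContinuousLinearMap.fst ℝ ℝ ℝ).comp (ContinuousLinearMap.snd ℝ ℝ (ℝ × ℝ))) q :=
    ((ContinuousLinearMap.fst ℝ ℝ ℝ).comp (ContinuousLinearMap.snd ℝ ℝ (ℝ × ℝ))).hasFDerivAt
  simp [dirD, this.fderiv]

theorem contDiff_radius : ContDiff ℝ ∞ (fun x : Z => x.2.1) :=
  contDiff_fst.comp contDiff_snd

/-- Divergence form of the energy density of a drift-diffusion operator. -/
theorem energy_identity (κ : ℝ) {Φ P w b₁ b₂ F : Z → ℝ} (hΦ : ContDiff ℝ ∞ Φ)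
    (hP : ContDiff ℝ ∞ P) (hw : ContDiff ℝ ∞ w) (hb₁ : ContDiff ℝ ∞ b₁) (hb₂ : ContDiff ℝ ∞ b₂)
    (hF : ContDiff ℝ ∞ F) (q : Z) :
    dS (fun x => 1 / 2 * (Φ x * w x ^ 2)) q
      + dR (fun x => 1 / 2 * (Φ x * (b₁ x * w x ^ 2)) - Φ x * (w x * dR w x)
          + 1 / 2 * (w x ^ 2 * dR Φ x) - κ / 2 * (P x * w x ^ 2)) q
      + dZ (fun x => 1 / 2 * (Φ x * (b₂ x * w x ^ 2)) - Φ x * (w x * dZ w x)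
          + 1 / 2 * (w x ^ 2 * dZ Φ x) - Φ x * (w x * F x)) q
    = Φ q * w q * (dS w q + b₁ q * dR w q + b₂ q * dZ w q - dR (dR w) q - dZ (dZ w) q - dZ F q)
      - κ * P q * w q * dR w q - Φ q * (dR w q ^ 2 + dZ w q ^ 2)
      + 1 / 2 * w q ^ 2 * (dS Φ q + dR (dR Φ) q + dZ (dZ Φ) q - κ * dR P q)
      + 1 / 2 * w q ^ 2 * (b₁ q * dR Φ q + b₂ q * dZ Φ q + Φ q * (dR b₁ q + dZ b₂ q))
      - F q * (Φ q * dZ w q + dZ Φ q * w q) := by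
  have d1 := differentiable_of_smooth hΦ
  have d2 := differentiable_of_smooth hP
  have d3 := differentiable_of_smooth hw
  have d4 := differentiable_of_smooth hb₁
  have d5 := differentiable_of_smooth hb₂
  have d6 := differentiable_of_smooth hF
  have d7 := fun e => differentiable_of_smooth (contDiff_dirD (e := e) hw)
  have d8 := fun e => differentiable_of_smooth (contDiff_dirD (e := e) hΦ)
  simp (disch := fun_prop) only [dS, dR, dZ, dirD_add, dirD_sub, dirD_const_mul, dirD_mul, dirD_sq]
  ring

/-- Young's inequality, with half of the weighted gradient spent on the flux term `F`. The drift
term keeps one factor `φ w`, since it is the localized function whose `L⁴` norm Ladyzhenskaya's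
inequality controls. -/
theorem energy_density_bound {C r φ w wr wz F G b₁ b₂ pr pz c z : ℝ} (hC : 0 ≤ C)
    (hr : 1 / 2 ≤ r ∧ r ≤ 2) (hφ : |φ| ≤ C) (hpr : |pr| ≤ C) (hpz : |pz| ≤ C) (hc : |c| ≤ C)
    (hz : |z| ≤ C) :
    -(r * φ ^ 2) * (wr ^ 2 + wz ^ 2) + 1 / 2 * w ^ 2 * c
      + w ^ 2 * (r * φ * (b₁ * pr + b₂ * pz)) - F * (r * φ ^ 2 * wz + z * w) + r * φ ^ 2 * (w * G)
    ≤ -(1 / 2) * (r * φ ^ 2 * (wr ^ 2 + wz ^ 2)) + 4 * (1 + C) ^ 2 * (w ^ 2 + F ^ 2 + G ^ 2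
      + (|b₁| + |b₂|) * |φ * w| * |w|) := by
  have hφ2 : φ ^ 2 ≤ C ^ 2 := by rw [← sq_abs]; exact pow_le_pow_left₀ (abs_nonneg _) hφ 2
  have h0 : 0 ≤ r * φ ^ 2 := mul_nonneg (by linarith) (sq_nonneg _)
  have h1 : r * φ ^ 2 ≤ 2 * C ^ 2 := by nlinarith [sq_nonneg φ]
  have t1 : 1 / 2 * w ^ 2 * c ≤ C * w ^ 2 := by
    nlinarith [le_abs_self c, sq_nonneg w]
  have t2 : w ^ 2 * (r * φ * (b₁ * pr + b₂ * pz)) ≤ 2 * C * ((|b₁| + |b₂|) * |φ * w| * |w|) := by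
    have e1 : |b₁ * pr + b₂ * pz| ≤ C * (|b₁| + |b₂|) := by
      refine (abs_add_le _ _).trans ?_
      rw [abs_mul, abs_mul]
      nlinarith [mul_le_mul_of_nonneg_left hpr (abs_nonneg b₁),
        mul_le_mul_of_nonneg_left hpz (abs_nonneg b₂)]
    calc w ^ 2 * (r * φ * (b₁ * pr + b₂ * pz)) ≤ |w ^ 2 * (r * φ * (b₁ * pr + b₂ * pz))| :=
          le_abs_self _
      _ = r * (|φ * w| * |w|) * |b₁ * pr + b₂ * pz| := by
          rw [abs_mul, abs_mul, abs_mul, abs_pow, abs_mul, abs_of_nonneg (show 0 ≤ r by linarith)]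
          ring
      _ ≤ 2 * (|φ * w| * |w|) * (C * (|b₁| + |b₂|)) := by
          gcongr; exact hr.2
      _ = _ := by ring
  have t3 : -(F * (r * φ ^ 2 * wz)) ≤ 1 / 2 * (r * φ ^ 2) * wz ^ 2 + C ^ 2 * F ^ 2 := by
    nlinarith [mul_nonneg h0 (sq_nonneg (F + wz)), mul_le_mul_of_nonneg_right h1 (sq_nonneg F)]
  have t4 : -(F * (z * w)) ≤ C * (F ^ 2 + w ^ 2) := by
    have := mul_le_mul_of_nonneg_right hz (mul_nonneg (abs_nonneg F) (abs_nonneg w))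
    have e : -(F * (z * w)) ≤ |z| * (|F| * |w|) := by
      rw [← abs_mul, ← abs_mul]
      calc -(F * (z * w)) ≤ |F * (z * w)| := neg_le_abs _
        _ = _ := by congr 1; ring
    nlinarith [sq_nonneg (|F| - |w|), sq_abs F, sq_abs w, sq_nonneg F, sq_nonneg w]
  have t5 : r * φ ^ 2 * (w * G) ≤ C ^ 2 * (w ^ 2 + G ^ 2) := by
    nlinarith [mul_nonneg h0 (sq_nonneg (w - G)), mul_le_mul_of_nonneg_right h1 (sq_nonneg w),
      mul_le_mul_of_nonneg_right h1 (sq_nonneg G)]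
  have hJ : 0 ≤ (|b₁| + |b₂|) * |φ * w| * |w| := by positivity
  have hwr := mul_nonneg h0 (sq_nonneg wr)
  nlinarith [mul_nonneg hC hJ, mul_nonneg (sq_nonneg C) hJ, mul_nonneg hC (sq_nonneg w),
    mul_nonneg hC (sq_nonneg F), mul_nonneg hC (sq_nonneg G), mul_nonneg (sq_nonneg C) (sq_nonneg w),
    mul_nonneg (sq_nonneg C) (sq_nonneg F), mul_nonneg (sq_nonneg C) (sq_nonneg G),
    sq_nonneg w, sq_nonneg F, sq_nonneg G]

/-- `w` satisfies `w (∂ₛw + b·∇w - Δw - κ w_r / r - ∂_z F - G) ≤ 0` on `Q`, where the drift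
`b = (b₁, b₂)` is divergence free with respect to `r dr dz`. -/
structure IsSubsolution (κ : ℝ) (Q : Set Z) (b₁ b₂ F G w : Z → ℝ) : Prop where
  smooth_drift_fst : ContDiff ℝ ∞ b₁
  smooth_drift_snd : ContDiff ℝ ∞ b₂
  smooth_flux : ContDiff ℝ ∞ F
  continuous_source : Continuous G
  smooth : ContDiff ℝ ∞ w
  div_free : ∀ q ∈ Q, dR b₁ q + b₁ q / q.2.1 + dZ b₂ q = 0
  ineq : ∀ q ∈ Q, w q * (dS w q + b₁ q * dR w q + b₂ q * dZ w q - dR (dR w) q - dZ (dZ w) q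
    - κ * dR w q / q.2.1 - dZ F q - G q) ≤ 0

/-- The weight `r φ²`. -/
def weight (φ : Z → ℝ) : Z → ℝ := fun q => q.2.1 * φ q ^ 2

theorem contDiff_weight {φ : Z → ℝ} (hφ : ContDiff ℝ ∞ φ) : ContDiff ℝ ∞ (weight φ) :=
  contDiff_radius.mul (hφ.pow 2)

/-- The factor `r` in the weight serves twice: `r b` is divergence free in the plane, so the drift
falls on `φ` alone, and `κ w_r / r` loses its denominator and becomes an exact `r`-derivative up to
a term in `∂_r (φ²)`. -/
theorem weighted_energy_bound {κ C : ℝ} {φ b₁ b₂ F G w : Z → ℝ} {Q : Set Z}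
    (hφ : ContDiff ℝ ∞ φ) (hr : ∀ q ∈ Q, 1 / 2 ≤ q.2.1 ∧ q.2.1 ≤ 2) (hC0 : 0 ≤ C)
    (hw : IsSubsolution κ Q b₁ b₂ F G w) {q : Z} (hqQ : q ∈ Q)
    (h₁ : |φ q| ≤ C) (h₂ : |dR φ q| ≤ C) (h₃ : |dZ φ q| ≤ C) (h₄ : |dZ (weight φ) q| ≤ C)
    (h₅ : |dS (weight φ) q + dR (dR (weight φ)) q + dZ (dZ (weight φ)) q
      - κ * dR (fun x => φ x ^ 2) q| ≤ C) :
    dS (fun x => 1 / 2 * (weight φ x * w x ^ 2)) q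
      + dR (fun x => 1 / 2 * (weight φ x * (b₁ x * w x ^ 2)) - weight φ x * (w x * dR w x)
          + 1 / 2 * (w x ^ 2 * dR (weight φ) x) - κ / 2 * (φ x ^ 2 * w x ^ 2)) q
      + dZ (fun x => 1 / 2 * (weight φ x * (b₂ x * w x ^ 2)) - weight φ x * (w x * dZ w x)
          + 1 / 2 * (w x ^ 2 * dZ (weight φ) x) - weight φ x * (w x * F x)) q
      + 1 / 4 * (φ q ^ 2 * (dR w q ^ 2 + dZ w q ^ 2))
    ≤ 4 * (1 + C) ^ 2 * (w q ^ 2 + F q ^ 2 + G q ^ 2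
      + (|b₁ q| + |b₂ q|) * |φ q * w q| * |w q|) := by
  have hb₁ := hw.smooth_drift_fst
  have hb₂ := hw.smooth_drift_snd
  have hF := hw.smooth_flux
  have sw := hw.smooth
  have dφ := differentiable_of_smooth hφ
  have dr := differentiable_of_smooth contDiff_radius
  have hΦ := contDiff_weight hφ
  obtain ⟨hr1, hr2⟩ := hr q hqQ
  have hr0 : q.2.1 ≠ 0 := by linarith
  have hid := energy_identity κ hΦ (hφ.pow 2) sw hb₁ hb₂ hF q
  have e1 : dR (weight φ) q = φ q ^ 2 + q.2.1 * (2 * φ q * dR φ q) := by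
    unfold weight
    simp (disch := fun_prop) only [dR, dirD_mul, dirD_sq, dirD_radius]; ring
  have e2 : dZ (weight φ) q = q.2.1 * (2 * φ q * dZ φ q) := by
    unfold weight
    simp (disch := fun_prop) only [dZ, dirD_mul, dirD_sq, dirD_radius]; ring
  have hdiv := hw.div_free q hqQ
  have hineq := hw.ineq q hqQ
  have hb := energy_density_bound (C := C) (r := q.2.1) (φ := φ q) (w := w q) (wr := dR w q)
    (wz := dZ w q) (F := F q) (G := G q) (b₁ := b₁ q) (b₂ := b₂ q) (pr := dR φ q)
    (pz := dZ φ q) (z := dZ (weight φ) q) hC0 ⟨hr1, hr2⟩ h₁ h₂ h₃ h₅ h₄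
  have hq : weight φ q = q.2.1 * φ q ^ 2 := rfl
  -- The term from differentiating the factor `r` of the weight cancels against the divergence of
  -- the drift.
  have hdr : b₁ q * dR (weight φ) q + b₂ q * dZ (weight φ) q + weight φ q * (dR b₁ q + dZ b₂ q)
      = 2 * (q.2.1 * φ q * (b₁ q * dR φ q + b₂ q * dZ φ q)) := by
    have : q.2.1 * (dR b₁ q + dZ b₂ q) = - b₁ q := by
      field_simp at hdiv; linarith
    rw [e1, e2, hq]
    linear_combination φ q ^ 2 * this
  rw [hdr, hq] at hid
  have hD : φ q ^ 2 * (dR w q ^ 2 + dZ w q ^ 2)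
      ≤ 2 * (q.2.1 * φ q ^ 2 * (dR w q ^ 2 + dZ w q ^ 2)) := by
    have : 0 ≤ φ q ^ 2 * (dR w q ^ 2 + dZ w q ^ 2) := by positivity
    nlinarith
  generalize dS (weight φ) q + dR (dR (weight φ)) q + dZ (dZ (weight φ)) q
      - κ * dR (fun x => φ x ^ 2) q = c at *
  generalize dZ (weight φ) q = zΦ at *
  rw [hid]
  generalize hA : dS w q + b₁ q * dR w q + b₂ q * dZ w q - dR (dR w) q - dZ (dZ w) q = A at *
  have hmul : q.2.1 * φ q ^ 2 * w q * (A - dZ F q) - κ * φ q ^ 2 * w q * dR w q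
      - q.2.1 * φ q ^ 2 * (w q * G q) ≤ 0 := by
    have h := mul_nonpos_of_nonneg_of_nonpos
      (mul_nonneg (show 0 ≤ q.2.1 by linarith) (sq_nonneg (φ q))) hineq
    have hex : q.2.1 * φ q ^ 2 * (w q * (A - κ * dR w q / q.2.1 - dZ F q - G q))
        = q.2.1 * φ q ^ 2 * w q * (A - dZ F q) - κ * φ q ^ 2 * w q * dR w q
          - q.2.1 * φ q ^ 2 * (w q * G q) := by
      field_simp; ring
    linarith
  linarith

/-- The pointwise inequality is integrated over the past of `t`. The spatial fluxes disappear and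
the time flux leaves the slice energy. -/
theorem exists_energy_inequality (κ : ℝ) {φ : Z → ℝ} (hφ : ContDiff ℝ ∞ φ)
    (hc : HasCompactSupport φ) {Q : Set Z} (hQ : IsCompact Q)
    (hr : ∀ q ∈ Q, 1 / 2 ≤ q.2.1 ∧ q.2.1 ≤ 2) (hsub : tsupport φ ∩ past 0 ⊆ Q) :
    ∃ C : ℝ, 1 ≤ C ∧ ∀ b₁ b₂ F G w : Z → ℝ, IsSubsolution κ Q b₁ b₂ F G w → ∀ t ≤ 0,
      (∫ x : ℝ × ℝ, (φ (t, x) * w (t, x)) ^ 2)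
        + ∫ q in past t, φ q ^ 2 * (dR w q ^ 2 + dZ w q ^ 2)
      ≤ C * ((∫ q in Q, w q ^ 2) + (∫ q in Q, F q ^ 2) + (∫ q in Q, G q ^ 2)
        + ∫ q in Q, (|b₁ q| + |b₂ q|) * |φ q * w q| * |w q|) := by
  set P : Z → ℝ := fun q => φ q ^ 2 with hPdef
  set Φ : Z → ℝ := weight φ with hΦdef
  have hP : ContDiff ℝ ∞ P := hφ.pow 2
  have hΦ : ContDiff ℝ ∞ Φ := contDiff_weight hφ
  have hcP : HasCompactSupport P := hc.comp_left (g := fun y : ℝ => y ^ 2) (by simp)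
  have hcΦ : HasCompactSupport Φ := hcP.mul_left
  have bd : ∀ u : Z → ℝ, Continuous u → HasCompactSupport u → ∃ C, ∀ x, |u x| ≤ C :=
    fun u hu hcu => hcu.exists_bound_of_continuous hu
  obtain ⟨C₁, hC₁⟩ := bd φ hφ.continuous hc
  obtain ⟨C₂, hC₂⟩ := bd (dR φ) (contDiff_dirD hφ).continuous (hasCompactSupport_dirD hc)
  obtain ⟨C₃, hC₃⟩ := bd (dZ φ) (contDiff_dirD hφ).continuous (hasCompactSupport_dirD hc)
  obtain ⟨C₄, hC₄⟩ := bd (dZ Φ) (contDiff_dirD hΦ).continuous (hasCompactSupport_dirD hcΦ)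
  obtain ⟨C₅, hC₅⟩ := bd (dS Φ) (contDiff_dirD hΦ).continuous (hasCompactSupport_dirD hcΦ)
  obtain ⟨C₆, hC₆⟩ := bd (dR (dR Φ)) (contDiff_dirD (contDiff_dirD hΦ)).continuous
    (hasCompactSupport_dirD (hasCompactSupport_dirD hcΦ))
  obtain ⟨C₇, hC₇⟩ := bd (dZ (dZ Φ)) (contDiff_dirD (contDiff_dirD hΦ)).continuous
    (hasCompactSupport_dirD (hasCompactSupport_dirD hcΦ))
  obtain ⟨C₈, hC₈⟩ := bd (dR P) (contDiff_dirD hP).continuous (hasCompactSupport_dirD hcP)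
  have pos : ∀ {u : Z → ℝ} {C : ℝ}, (∀ x, |u x| ≤ C) → 0 ≤ C := fun h => (abs_nonneg _).trans (h 0)
  have p1 := pos hC₁
  have p2 := pos hC₂
  have p3 := pos hC₃
  have p4 := pos hC₄
  have p5 := pos hC₅
  have p6 := pos hC₆
  have p7 := pos hC₇
  have p8 := mul_nonneg (abs_nonneg κ) (pos hC₈)
  set C := C₁ + C₂ + C₃ + C₄ + C₅ + C₆ + C₇ + |κ| * C₈ with hCdef
  have hC0 : 0 ≤ C := by positivity
  -- The pointwise constant `4 (1 + C)²`, divided by the coefficient `1/4` that both terms carry on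
  -- the left.
  refine ⟨16 * (1 + C) ^ 2, by nlinarith, fun b₁ b₂ F G w hw t ht => ?_⟩
  have hb₁ := hw.smooth_drift_fst
  have hb₂ := hw.smooth_drift_snd
  have hF := hw.smooth_flux
  have hG := hw.continuous_source
  have sw := hw.smooth
  set u₀ : Z → ℝ := fun x => 1 / 2 * (Φ x * w x ^ 2) with hu₀
  set u₁ : Z → ℝ := fun x => 1 / 2 * (Φ x * (b₁ x * w x ^ 2)) - Φ x * (w x * dR w x)
          + 1 / 2 * (w x ^ 2 * dR Φ x) - κ / 2 * (P x * w x ^ 2) with hu₁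
  set u₂ : Z → ℝ := fun x => 1 / 2 * (Φ x * (b₂ x * w x ^ 2)) - Φ x * (w x * dZ w x)
          + 1 / 2 * (w x ^ 2 * dZ Φ x) - Φ x * (w x * F x) with hu₂
  have sRw : ContDiff ℝ ∞ (dR w) := contDiff_dirD sw
  have sZw : ContDiff ℝ ∞ (dZ w) := contDiff_dirD sw
  have sRΦ : ContDiff ℝ ∞ (dR Φ) := contDiff_dirD hΦ
  have sZΦ : ContDiff ℝ ∞ (dZ Φ) := contDiff_dirD hΦ
  have s0 : ContDiff ℝ ∞ u₀ := by fun_prop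
  have s1 : ContDiff ℝ ∞ u₁ := by fun_prop
  have s2 : ContDiff ℝ ∞ u₂ := by fun_prop
  have out : ∀ q, q ∉ tsupport φ → φ =ᶠ[𝓝 q] 0 := fun q hq =>
    notMem_tsupport_iff_eventuallyEq.1 hq
  have outΦ : ∀ q, q ∉ tsupport φ → Φ =ᶠ[𝓝 q] fun _ => 0 := fun q hq => by
    filter_upwards [out q hq] with x hx; simp [hΦdef, weight, hx]
  have outd : ∀ e q, q ∉ tsupport φ → dirD e Φ =ᶠ[𝓝 q] fun _ => 0 := fun e q hq => by
    have : dirD e (fun _ : Z => (0 : ℝ)) = fun _ => 0 := by ext; simp [dirD]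
    exact this ▸ dirD_eventuallyEq (outΦ q hq)
  have z0 : ∀ q, q ∉ tsupport φ → u₀ =ᶠ[𝓝 q] fun _ => 0 := fun q hq => by
    filter_upwards [outΦ q hq] with x hx; simp [hu₀, hx]
  have z1 : ∀ q, q ∉ tsupport φ → u₁ =ᶠ[𝓝 q] fun _ => 0 := fun q hq => by
    filter_upwards [outΦ q hq, outd (0, 1, 0) q hq, out q hq] with x hx h1 h2
    simp [hu₁, hx, h1, hPdef, h2]
  have z2 : ∀ q, q ∉ tsupport φ → u₂ =ᶠ[𝓝 q] fun _ => 0 := fun q hq => by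
    filter_upwards [outΦ q hq, outd (0, 0, 1) q hq] with x hx h1
    simp [hu₂, hx, h1]
  have cpt : ∀ {u : Z → ℝ}, (∀ q, q ∉ tsupport φ → u =ᶠ[𝓝 q] fun _ => 0) → HasCompactSupport u :=
    fun h => HasCompactSupport.intro hc fun q hq => (h q hq).eq_of_nhds
  have k0 := cpt z0
  have k1 := cpt z1
  have k2 := cpt z2
  set R : Z → ℝ := fun q => 4 * (1 + C) ^ 2 * (w q ^ 2 + F q ^ 2 + G q ^ 2
      + (|b₁ q| + |b₂ q|) * |φ q * w q| * |w q|) with hR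
  have hR0 : ∀ q, 0 ≤ R q := fun q => by positivity
  have cR : Continuous R := by
    have := hφ.continuous
    have := sw.continuous
    have := hF.continuous
    have := hb₁.continuous
    have := hb₂.continuous
    fun_prop
  set D : Z → ℝ := fun q => φ q ^ 2 * (dR w q ^ 2 + dZ w q ^ 2) with hD
  have cD : Continuous D := (hφ.continuous.pow 2).mul ((sRw.continuous.pow 2).add
    (sZw.continuous.pow 2))
  have kD : HasCompactSupport D := hcP.mul_right
  -- the pointwise inequality
  have pw : ∀ q ∈ past 0, dS u₀ q + dR u₁ q + dZ u₂ q + 1 / 4 * D q ≤ Q.indicator R q := by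
    intro q hq
    by_cases hqs : q ∈ tsupport φ
    · have hqQ := hsub ⟨hqs, hq⟩
      rw [indicator_of_mem hqQ]
      exact weighted_energy_bound hφ hr hC0 hw hqQ ((hC₁ q).trans (by linarith))
        ((hC₂ q).trans (by linarith)) ((hC₃ q).trans (by linarith)) ((hC₄ q).trans (by linarith)) (by
          have a1 := hC₅ q
          have a2 := hC₆ q
          have a3 := hC₇ q
          have a4 : |κ * dR P q| ≤ |κ| * C₈ := by
            rw [abs_mul]; exact mul_le_mul_of_nonneg_left (hC₈ q) (abs_nonneg _)
          rw [abs_le] at *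
          constructor <;> linarith)
    · have hz : ∀ e (u : Z → ℝ), u =ᶠ[𝓝 q] (fun _ => 0) → dirD e u q = 0 := by
        intro e u h
        rw [dirD_congr h]; simp [dirD]
      have hφ0 : φ q = 0 := image_eq_zero_of_notMem_tsupport hqs
      rw [dS, dR, dZ, hz _ _ (z0 q hqs), hz _ _ (z1 q hqs), hz _ _ (z2 q hqs)]
      simp only [hD, hφ0]
      have := indicator_nonneg (s := Q) (fun q _ => hR0 q) q
      simpa using this
  have hpt : past t ⊆ past 0 := fun q hq => ⟨le_trans hq.1 ht, trivial⟩
  have i0 := integrable_past (contDiff_dirD (e := (1, 0, 0)) s0).continuous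
    (hasCompactSupport_dirD k0) t
  have i1 := integrable_past (contDiff_dirD (e := (0, 1, 0)) s1).continuous
    (hasCompactSupport_dirD k1) t
  have i2 := integrable_past (contDiff_dirD (e := (0, 0, 1)) s2).continuous
    (hasCompactSupport_dirD k2) t
  have iD := integrable_past cD kD t
  have iR : IntegrableOn R Q := cR.continuousOn.integrableOn_compact hQ
  have iRi : Integrable (Q.indicator R) := (integrable_indicator_iff hQ.measurableSet).2 iR
  have hineq : ∫ q in past t, (dS u₀ q + dR u₁ q + dZ u₂ q + 1 / 4 * D q) ≤ ∫ q in Q, R q := by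
    calc _ ≤ ∫ q in past t, Q.indicator R q :=
          setIntegral_mono_on (((i0.add i1).add i2).add (iD.const_mul _)) iRi.integrableOn
            (measurableSet_past t) fun q hq => pw q (hpt hq)
      _ ≤ ∫ q, Q.indicator R q :=
          setIntegral_le_integral iRi (Eventually.of_forall (indicator_nonneg fun q _ => hR0 q))
      _ = _ := integral_indicator hQ.measurableSet
  have hsplit : ∫ q in past t, (dS u₀ q + dR u₁ q + dZ u₂ q + 1 / 4 * D q)
      = (∫ x : ℝ × ℝ, u₀ (t, x)) + 1 / 4 * ∫ q in past t, D q := by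
    have j1 : IntegrableOn (fun q => dS u₀ q + dR u₁ q) (past t) := i0.add i1
    have j2 : IntegrableOn (fun q => dS u₀ q + dR u₁ q + dZ u₂ q) (past t) := j1.add i2
    rw [integral_add j2 (iD.const_mul _), integral_const_mul (1 / 4) D, integral_add j1 i2, integral_add i0 i1,
      integral_past_dS (s0.of_le (by simp)) k0,
      integral_past_space_dirD (s1.of_le (by simp)) k1 t (1, 0),
      integral_past_space_dirD (s2.of_le (by simp)) k2 t (0, 1)]
    ring
  -- The density is half of `r (φ w)²`, and `r ≥ 1/2` on the support of the cutoff.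
  have hu0 : 1 / 4 * ∫ x : ℝ × ℝ, (φ (t, x) * w (t, x)) ^ 2 ≤ ∫ x : ℝ × ℝ, u₀ (t, x) := by
    rw [← integral_const_mul]
    refine integral_mono ?_ ?_ fun x => ?_
    · refine Integrable.const_mul ?_ _
      refine Continuous.integrable_of_hasCompactSupport ?_ ?_
      · exact ((hφ.continuous.mul sw.continuous).pow 2).comp (Continuous.prodMk_right t)
      · exact hasCompactSupport_slice (u := fun q => (φ q * w q) ^ 2)
          (hc.mul_right.comp_left (g := fun y : ℝ => y ^ 2) (by simp)) t
    · exact (s0.continuous.comp (Continuous.prodMk_right t)).integrable_of_hasCompactSupport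
        (hasCompactSupport_slice k0 t)
    · simp only [hu₀, hΦdef, weight]
      by_cases hx : ((t, x) : Z) ∈ tsupport φ
      · have := (hr _ (hsub ⟨hx, ⟨ht, trivial⟩⟩)).1
        simp only at this
        nlinarith [sq_nonneg (φ (t, x) * w (t, x))]
      · simp [image_eq_zero_of_notMem_tsupport hx]
  have hRint : ∫ q in Q, R q = 4 * (1 + C) ^ 2 * ((∫ q in Q, w q ^ 2) + (∫ q in Q, F q ^ 2)
      + (∫ q in Q, G q ^ 2) + ∫ q in Q, (|b₁ q| + |b₂ q|) * |φ q * w q| * |w q|) := by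
    have c1 : IntegrableOn (fun q => w q ^ 2) Q :=
      (sw.continuous.pow 2).continuousOn.integrableOn_compact hQ
    have c2 : IntegrableOn (fun q => F q ^ 2) Q :=
      (hF.continuous.pow 2).continuousOn.integrableOn_compact hQ
    have c3 : IntegrableOn (fun q => G q ^ 2) Q :=
      (hG.pow 2).continuousOn.integrableOn_compact hQ
    have c4 : IntegrableOn (fun q => (|b₁ q| + |b₂ q|) * |φ q * w q| * |w q|) Q :=
      (((hb₁.continuous.abs.add hb₂.continuous.abs).mul
        (hφ.continuous.mul sw.continuous).abs).mul sw.continuous.abs).continuousOn.integrableOn_compact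
        hQ
    have c12 : IntegrableOn (fun q => w q ^ 2 + F q ^ 2) Q := c1.add c2
    have c123 : IntegrableOn (fun q => w q ^ 2 + F q ^ 2 + G q ^ 2) Q := c12.add c3
    simp only [hR]
    rw [integral_const_mul, integral_add c123 c4, integral_add c12 c3, integral_add c1 c2]
  rw [hsplit, hRint] at hineq
  simp only [hD] at hineq
  linarith

/-- The drift integral `J` is of order `√M`, so Young's inequality returns half of `M` to the left
and leaves a multiple of `β N`. -/
theorem absorb_drift {M S J c β N k : ℝ} (hM : M = c * (S + J))
    (hk : 0 ≤ k) (hβ : 0 ≤ β) (hN : 0 ≤ N) (hM0 : 0 ≤ M)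
    (hJ : J ^ 2 ≤ 2 * β * k * M * N) : M ≤ 2 * c * S + 2 * (c ^ 2 * k * β * N) := by
  have h1 : c * J ≤ 1 / 2 * M + c ^ 2 * k * β * N := by
    have h0 : 0 ≤ c ^ 2 * k * β * N := by positivity
    refine abs_le_of_sq_le_sq' ?_ (by positivity) |>.2
    have := mul_le_mul_of_nonneg_left hJ (sq_nonneg c)
    nlinarith [sq_nonneg (1 / 2 * M - c ^ 2 * k * β * N)]
  nlinarith

theorem hasCompactSupport_pow {E : Type*} [TopologicalSpace E] {u : E → ℝ}
    (hu : HasCompactSupport u) {n : ℕ} (hn : n ≠ 0) : HasCompactSupport fun x => u x ^ n :=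
  hu.comp_left (g := fun y : ℝ => y ^ n) (by simp [hn])

/-- The gradient of a localized function. -/
theorem integral_grad_cutoff_le {φ w : Z → ℝ} (hφ : ContDiff ℝ ∞ φ) (hc : HasCompactSupport φ)
    (sw : ContDiff ℝ ∞ w) {Q : Set Z} (hQ : IsCompact Q) (hsub : tsupport φ ∩ past 0 ⊆ Q)
    {A : ℝ} (hA₁ : ∀ q, |dR φ q| ≤ A) (hA₂ : ∀ q, |dZ φ q| ≤ A) :
    ∫ q in past 0, (dR (fun q => φ q * w q) q ^ 2 + dZ (fun q => φ q * w q) q ^ 2)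
      ≤ 2 * (∫ q in past 0, φ q ^ 2 * (dR w q ^ 2 + dZ w q ^ 2))
        + 4 * A ^ 2 * ∫ q in Q, w q ^ 2 := by
  have dw := differentiable_of_smooth sw
  have dφ := differentiable_of_smooth hφ
  have su : ContDiff ℝ ∞ (fun q => φ q * w q) := hφ.mul sw
  have ku : HasCompactSupport (fun q => φ q * w q) := hc.mul_right
  have cφ := hφ.continuous
  have cRw := (contDiff_dirD (e := ((0, 1, 0) : Z)) sw).continuous
  have cZw := (contDiff_dirD (e := ((0, 0, 1) : Z)) sw).continuous
  have i1 : IntegrableOn (fun q => φ q ^ 2 * (dR w q ^ 2 + dZ w q ^ 2)) (past 0) :=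
    integrable_past (by fun_prop) (hasCompactSupport_pow hc two_ne_zero).mul_right 0
  have i2 : IntegrableOn (fun q => w q ^ 2) Q :=
    (sw.continuous.pow 2).continuousOn.integrableOn_compact hQ
  have i2' : Integrable (Q.indicator fun q => w q ^ 2) :=
    (integrable_indicator_iff hQ.measurableSet).2 i2
  have i3 : IntegrableOn (fun q => dR (fun q => φ q * w q) q ^ 2 + dZ (fun q => φ q * w q) q ^ 2)
      (past 0) := by
    have kk := fun e => hasCompactSupport_pow (hasCompactSupport_dirD (e := e) ku) two_ne_zero
    exact integrable_past (((contDiff_dirD su).continuous.pow 2).add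
      ((contDiff_dirD su).continuous.pow 2)) ((kk _).add (kk _)) 0
  have pw : ∀ q ∈ past 0, dR (fun q => φ q * w q) q ^ 2 + dZ (fun q => φ q * w q) q ^ 2
      ≤ 2 * (φ q ^ 2 * (dR w q ^ 2 + dZ w q ^ 2))
          + 4 * A ^ 2 * Q.indicator (fun q => w q ^ 2) q := by
    intro q hq
    rw [dR, dZ, dirD_mul (dφ q) (dw q), dirD_mul (dφ q) (dw q)]
    by_cases hqs : q ∈ tsupport φ
    · rw [indicator_of_mem (hsub ⟨hqs, hq⟩)]
      have a1 : dirD ((0, 1, 0) : Z) φ q ^ 2 ≤ A ^ 2 := sq_le_sq' (abs_le.1 (hA₁ q)).1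
        (abs_le.1 (hA₁ q)).2
      have a2 : dirD ((0, 0, 1) : Z) φ q ^ 2 ≤ A ^ 2 := sq_le_sq' (abs_le.1 (hA₂ q)).1
        (abs_le.1 (hA₂ q)).2
      have b1 := mul_le_mul_of_nonneg_right a1 (sq_nonneg (w q))
      have b2 := mul_le_mul_of_nonneg_right a2 (sq_nonneg (w q))
      nlinarith [sq_nonneg (dirD ((0, 1, 0) : Z) φ q * w q - φ q * dirD ((0, 1, 0) : Z) w q),
        sq_nonneg (dirD ((0, 0, 1) : Z) φ q * w q - φ q * dirD ((0, 0, 1) : Z) w q)]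
    · have hd : ∀ e, dirD e φ q = 0 := fun e =>
        image_eq_zero_of_notMem_tsupport fun h => hqs (tsupport_dirD_subset φ h)
      rw [hd, hd, image_eq_zero_of_notMem_tsupport hqs]
      have := indicator_nonneg (s := Q) (f := fun q => w q ^ 2) (fun q _ => sq_nonneg _) q
      have h := mul_nonneg (show 0 ≤ 4 * A ^ 2 by positivity) this
      simp only [zero_mul, add_zero]
      linarith
  have h1 := setIntegral_mono_on i3 ((i1.const_mul 2).add (i2'.integrableOn.const_mul (4 * A ^ 2)))
    (measurableSet_past 0) pw
  have h2 : ∫ q in past 0, Q.indicator (fun q => w q ^ 2) q ≤ ∫ q in Q, w q ^ 2 := by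
    rw [← integral_indicator hQ.measurableSet]
    exact setIntegral_le_integral i2' (Eventually.of_forall (indicator_nonneg
      fun q _ => sq_nonneg _))
  have h3 := mul_le_mul_of_nonneg_left h2 (show 0 ≤ 4 * A ^ 2 by positivity)
  simp only [Pi.add_apply] at h1
  rw [integral_add (i1.const_mul 2) (i2'.integrableOn.const_mul _), integral_const_mul,
    integral_const_mul] at h1
  linarith

/-- The drift term is controlled by the `L⁴` norms of the drift and of the localized function. -/
theorem sq_integral_drift_le {φ w b₁ b₂ : Z → ℝ} (cφ : Continuous φ) (cw : Continuous w)
    (cb₁ : Continuous b₁) (cb₂ : Continuous b₂) {Q : Set Z} (hQ : IsCompact Q) {β L : ℝ}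
    (hβ : 0 ≤ β) (hL : 0 ≤ L) (hb : ∫ q in Q, (b₁ q ^ 2 + b₂ q ^ 2) ^ 2 ≤ β ^ 2)
    (hw : ∫ q in Q, (φ q * w q) ^ 4 ≤ L ^ 2) :
    (∫ q in Q, (|b₁ q| + |b₂ q|) * |φ q * w q| * |w q|) ^ 2
      ≤ 2 * β * L * ∫ q in Q, w q ^ 2 := by
  have iQ : ∀ {u : Z → ℝ}, Continuous u → IntegrableOn u Q := fun hu =>
    hu.continuousOn.integrableOn_compact hQ
  have hN0 : 0 ≤ ∫ q in Q, w q ^ 2 := integral_nonneg fun q => sq_nonneg _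
  have hJ2 := sq_integral_mul_le (μ := volume.restrict Q)
    (f := fun q => (|b₁ q| + |b₂ q|) * |φ q * w q|)
    (g := fun q => |w q|) (iQ (by fun_prop)) (iQ (by fun_prop)) (iQ (by fun_prop))
  simp only [mul_pow, sq_abs] at hJ2
  have h1 := sq_integral_mul_le (μ := volume.restrict Q) (f := fun q => (|b₁ q| + |b₂ q|) ^ 2)
    (g := fun q => φ q ^ 2 * w q ^ 2) (iQ (by fun_prop)) (iQ (by fun_prop)) (iQ (by fun_prop))
  have h3 : ∫ q in Q, ((|b₁ q| + |b₂ q|) ^ 2) ^ 2 ≤ 4 * β ^ 2 := by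
    refine le_trans ?_ (mul_le_mul_of_nonneg_left hb (by norm_num : (0 : ℝ) ≤ 4))
    rw [← integral_const_mul]
    refine setIntegral_mono_on (iQ (by fun_prop)) (iQ (by fun_prop)) hQ.measurableSet fun q _ => ?_
    have : (|b₁ q| + |b₂ q|) ^ 2 ≤ 2 * (b₁ q ^ 2 + b₂ q ^ 2) := by
      nlinarith [sq_nonneg (|b₁ q| - |b₂ q|), sq_abs (b₁ q), sq_abs (b₂ q)]
    calc ((|b₁ q| + |b₂ q|) ^ 2) ^ 2 ≤ (2 * (b₁ q ^ 2 + b₂ q ^ 2)) ^ 2 :=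
          pow_le_pow_left₀ (sq_nonneg _) this 2
      _ = _ := by ring
  have h4 : ∫ q in Q, (φ q ^ 2 * w q ^ 2) ^ 2 ≤ L ^ 2 := by
    refine le_of_eq_of_le ?_ hw
    congr 1; ext q; ring
  have h5 : 0 ≤ ∫ q in Q, (φ q ^ 2 * w q ^ 2) ^ 2 := integral_nonneg fun q => by positivity
  have hK2 : (∫ q in Q, (|b₁ q| + |b₂ q|) ^ 2 * (φ q ^ 2 * w q ^ 2)) ^ 2 ≤ (2 * β * L) ^ 2 := by
    refine h1.trans ?_
    calc _ ≤ (4 * β ^ 2) * L ^ 2 := mul_le_mul h3 h4 h5 (by positivity)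
      _ = _ := by ring
  have hK := abs_le_of_sq_le_sq' hK2 (by positivity) |>.2
  exact hJ2.trans (mul_le_mul_of_nonneg_right hK hN0)

/-- Local energy estimate: the energy and the `L⁴` norm of `φ w` are controlled by the `L²` norms
of `w`, `F`, `G` and the `L⁴` norm of the drift on `Q`. -/
theorem exists_local_energy (κ : ℝ) {φ : Z → ℝ} (hφ : ContDiff ℝ ∞ φ)
    (hc : HasCompactSupport φ) {Q : Set Z} (hQ : IsCompact Q) (hQ0 : Q ⊆ past 0)
    (hr : ∀ q ∈ Q, 1 / 2 ≤ q.2.1 ∧ q.2.1 ≤ 2) (hsub : tsupport φ ∩ past 0 ⊆ Q) :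
    ∃ C : ℝ, 1 ≤ C ∧ ∀ b₁ b₂ F G w : Z → ℝ, IsSubsolution κ Q b₁ b₂ F G w → ∀ β : ℝ, 0 ≤ β →
      ∫ q in Q, (b₁ q ^ 2 + b₂ q ^ 2) ^ 2 ≤ β ^ 2 →
      (∀ t ≤ 0, ∫ x : ℝ × ℝ, (φ (t, x) * w (t, x)) ^ 2
        ≤ C * ((1 + β) * (∫ q in Q, w q ^ 2) + (∫ q in Q, F q ^ 2) + ∫ q in Q, G q ^ 2)) ∧
      ∫ q in past 0, (φ q * w q) ^ 4
        ≤ (C * ((1 + β) * (∫ q in Q, w q ^ 2) + (∫ q in Q, F q ^ 2) + ∫ q in Q, G q ^ 2)) ^ 2 := by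
  obtain ⟨C₁, hC₁, hen⟩ := exists_energy_inequality κ hφ hc hQ hr hsub
  obtain ⟨C₂, hC₂, hlad⟩ := exists_ladyzhenskaya_past
  obtain ⟨A₁, hA₁⟩ := (hasCompactSupport_dirD (e := ((0, 1, 0) : Z)) hc).exists_bound_of_continuous
    (contDiff_dirD hφ).continuous
  obtain ⟨A₂, hA₂⟩ := (hasCompactSupport_dirD (e := ((0, 0, 1) : Z)) hc).exists_bound_of_continuous
    (contDiff_dirD hφ).continuous
  obtain ⟨A, hA⟩ : ∃ A, A = max A₁ A₂ := ⟨_, rfl⟩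
  obtain ⟨k, hk⟩ : ∃ k, k = C₂ * (2 + 4 * A ^ 2) := ⟨_, rfl⟩
  have hk1 : 1 ≤ k := by
    have : 1 ≤ 2 + 4 * A ^ 2 := by nlinarith [sq_nonneg A]
    rw [hk]
    exact one_le_mul_of_one_le_of_one_le hC₂ this
  have hkk : k ≤ k ^ 2 := by nlinarith
  refine ⟨2 * C₁ ^ 2 * k * k, ?_, fun b₁ b₂ F G w hw β hβ hb => ?_⟩
  · have : 1 ≤ C₁ ^ 2 := one_le_pow₀ hC₁
    have := one_le_mul_of_one_le_of_one_le this (one_le_mul_of_one_le_of_one_le hk1 hk1)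
    nlinarith
  have sw := hw.smooth
  have su : ContDiff ℝ ∞ (fun q => φ q * w q) := hφ.mul sw
  have ku : HasCompactSupport (fun q => φ q * w q) := hc.mul_right
  have en := hen b₁ b₂ F G w hw
  have grad := integral_grad_cutoff_le hφ hc sw hQ hsub (A := A)
    (fun q => (hA₁ q).trans (hA ▸ le_max_left _ _)) (fun q => (hA₂ q).trans (hA ▸ le_max_right _ _))
  have hJ0 : 0 ≤ ∫ q in Q, (|b₁ q| + |b₂ q|) * |φ q * w q| * |w q| :=
    integral_nonneg fun q => by positivity
  have dr := fun L hL h => sq_integral_drift_le hφ.continuous sw.continuous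
    hw.smooth_drift_fst.continuous hw.smooth_drift_snd.continuous hQ (β := β) (L := L) hβ hL hb h
  have hN0 : 0 ≤ ∫ q in Q, w q ^ 2 := integral_nonneg fun q => sq_nonneg _
  have hF0 : 0 ≤ ∫ q in Q, F q ^ 2 := integral_nonneg fun q => sq_nonneg _
  have hG0 : 0 ≤ ∫ q in Q, G q ^ 2 := integral_nonneg fun q => sq_nonneg _
  have hi4 : IntegrableOn (fun q => (φ q * w q) ^ 4) (past 0) :=
    integrable_past (su.continuous.pow 4) (hasCompactSupport_pow ku four_ne_zero) 0
  have L4Q : ∫ q in Q, (φ q * w q) ^ 4 ≤ ∫ q in past 0, (φ q * w q) ^ 4 :=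
    setIntegral_mono_set hi4 (Eventually.of_forall fun q => by positivity) hQ0.eventuallyLE
  have nn1 : 0 ≤ ∫ x : ℝ × ℝ, (φ (0, x) * w (0, x)) ^ 2 := integral_nonneg fun x => sq_nonneg _
  have nn2 : ∀ t, 0 ≤ ∫ q in past t, φ q ^ 2 * (dR w q ^ 2 + dZ w q ^ 2) :=
    fun t => integral_nonneg fun x => by positivity
  have en0 := en 0 le_rfl
  have hl := hlad _ su ku
  generalize (∫ q in Q, w q ^ 2) = N at *
  generalize (∫ q in Q, F q ^ 2) = F2 at *
  generalize (∫ q in Q, G q ^ 2) = G2 at *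
  generalize (∫ q in Q, (|b₁ q| + |b₂ q|) * |φ q * w q| * |w q|) = J at *
  -- `M` is the whole right side of the energy inequality, drift integral included. It bounds the
  -- slice energy and the gradient; the drift integral is then bounded back through `M`, and
  -- `absorb_drift` closes the loop.
  obtain ⟨M, hM⟩ : ∃ M, M = C₁ * (N + F2 + G2 + J) := ⟨_, rfl⟩
  have hM0 : 0 ≤ M := by rw [hM]; positivity
  have hNM : N ≤ M := by rw [hM]; nlinarith
  rw [← hM] at en0
  have slice : ∀ t ≤ 0, ∫ x : ℝ × ℝ, (φ (t, x) * w (t, x)) ^ 2 ≤ M := fun t ht => by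
    linarith [en t ht, nn2 t]
  have L4 : ∫ q in past 0, (φ q * w q) ^ 4 ≤ k * M ^ 2 := by
    refine (hl M slice).trans ?_
    have h1 := mul_le_mul_of_nonneg_left hNM (show 0 ≤ 4 * A ^ 2 by positivity)
    have h2 : ∫ q in past 0, (dR (fun q => φ q * w q) q ^ 2 + dZ (fun q => φ q * w q) q ^ 2)
      ≤ (2 + 4 * A ^ 2) * M := by linarith
    have := mul_le_mul_of_nonneg_left h2 (show 0 ≤ C₂ * M by positivity)
    calc _ ≤ _ := this
      _ = _ := by rw [hk]; ring
  have L4' : ∫ q in past 0, (φ q * w q) ^ 4 ≤ (k * M) ^ 2 := by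
    refine L4.trans ?_
    rw [mul_pow]
    gcongr
  have hJ := dr (k * M) (by positivity) (L4Q.trans L4')
  have hMle := absorb_drift (c := C₁) (S := N + F2 + G2) (J := J) (k := k) (β := β) (N := N) hM
    (by linarith) hβ hN0 hM0 (by linarith)
  have hkM : k * M ≤ 2 * C₁ ^ 2 * k * k * ((1 + β) * N + F2 + G2) := by
    have h1 : M ≤ 2 * C₁ ^ 2 * k * ((1 + β) * N + F2 + G2) := by
      have h2 : C₁ ≤ C₁ ^ 2 * k := by
        calc C₁ ≤ C₁ * (C₁ * k) :=
              le_mul_of_one_le_right (by linarith) (one_le_mul_of_one_le_of_one_le hC₁ hk1)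
          _ = _ := by ring
      have h3 := mul_le_mul_of_nonneg_right h2 (show 0 ≤ N + F2 + G2 by positivity)
      linarith
    calc k * M ≤ k * (2 * C₁ ^ 2 * k * ((1 + β) * N + F2 + G2)) := by gcongr
      _ = _ := by ring
  refine ⟨fun t ht => (slice t ht).trans (le_trans ?_ hkM), L4'.trans ?_⟩
  · exact le_mul_of_one_le_left hM0 hk1
  · exact pow_le_pow_left₀ (by positivity) hkM 2

/-! ### Nested boxes -/

/-- The spatial square of half-width `a` around `(1, 0)`. -/
def square (a : ℝ) : Set (ℝ × ℝ) := Icc (1 - a) (1 + a) ×ˢ Icc (-a) a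

/-- The parabolic box of size `a` below the point `(0, 1, 0)`. -/
def box (a : ℝ) : Set Z := Icc (-a) 0 ×ˢ square a

theorem isCompact_square (a : ℝ) : IsCompact (square a) := isCompact_Icc.prod isCompact_Icc

theorem isCompact_box (a : ℝ) : IsCompact (box a) := isCompact_Icc.prod (isCompact_square a)

theorem box_subset_past (a : ℝ) : box a ⊆ past 0 := fun _ hq => ⟨hq.1.2, trivial⟩

theorem square_mono {a b : ℝ} (h : a ≤ b) : square a ⊆ square b := by
  rintro ⟨r, z⟩ ⟨⟨h1, h2⟩, h3, h4⟩
  simp only at h1 h2 h3 h4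
  refine ⟨⟨?_, ?_⟩, ?_, ?_⟩ <;> simp only <;> linarith

theorem box_mono {a b : ℝ} (h : a ≤ b) : box a ⊆ box b := by
  rintro ⟨s, x⟩ ⟨⟨h1, h2⟩, h3⟩
  simp only at h1 h2
  exact ⟨⟨by simp only; linarith, h2⟩, square_mono h h3⟩

theorem radius_mem_of_box {a : ℝ} (ha : a ≤ 1 / 2) {q : Z} (hq : q ∈ box a) :
    1 / 2 ≤ q.2.1 ∧ q.2.1 ≤ 2 := by
  obtain ⟨-, ⟨h1, h2⟩, -⟩ := hq
  constructor <;> linarith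

theorem integrableOn_box {u : Z → ℝ} (hu : Continuous u) (a : ℝ) : IntegrableOn u (box a) :=
  hu.continuousOn.integrableOn_compact (isCompact_box a)

theorem setIntegral_box_mono {u v : Z → ℝ} (hu : Continuous u) (hv : Continuous v) {a : ℝ}
    (h : ∀ q ∈ box a, u q ≤ v q) : ∫ q in box a, u q ≤ ∫ q in box a, v q :=
  setIntegral_mono_on (integrableOn_box hu a) (integrableOn_box hv a)
    (isCompact_box a).measurableSet h

theorem setIntegral_box_le {u : Z → ℝ} (hu : Continuous u) (h0 : ∀ q, 0 ≤ u q) {a b : ℝ}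
    (h : a ≤ b) : ∫ q in box a, u q ≤ ∫ q in box b, u q :=
  setIntegral_mono_set (integrableOn_box hu b) (Eventually.of_forall h0)
    (box_mono h).eventuallyLE

/-- The support is allowed to cross `s = 0` so that the cutoff is still equal to 1 at the final
time; only its part in the past must stay inside the larger box. -/
theorem exists_box_cutoff {a b : ℝ} (hab : a < b) :
    ∃ φ : Z → ℝ, ContDiff ℝ ∞ φ ∧ HasCompactSupport φ ∧ tsupport φ ∩ past 0 ⊆ box b ∧
      (∀ q ∈ box a, φ q = 1) ∧ ∀ q, φ q ∈ Icc (0 : ℝ) 1 := by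
  have hO : IsOpen (Ioo (-b) 1 ×ˢ Ioo (1 - b) (1 + b) ×ˢ Ioo (-b) b : Set Z) :=
    isOpen_Ioo.prod (isOpen_Ioo.prod isOpen_Ioo)
  obtain ⟨φ, h1, h2, h3, h4, h5⟩ := exists_cutoff (isCompact_box a) hO (by
    rintro ⟨s, r, z⟩ ⟨⟨a1, a2⟩, ⟨a3, a4⟩, a5, a6⟩
    simp only at a1 a2 a3 a4 a5 a6
    refine ⟨⟨?_, ?_⟩, ⟨?_, ?_⟩, ?_, ?_⟩ <;> simp only <;> linarith)
  refine ⟨φ, h1, h2, ?_, fun q hq => h4.self_of_nhdsSet q hq, h5⟩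
  rintro q ⟨hq, hq0⟩
  obtain ⟨⟨a1, a2⟩, ⟨a3, a4⟩, a5, a6⟩ := h3 hq
  exact ⟨⟨a1.le, hq0.1⟩, ⟨a3.le, a4.le⟩, a5.le, a6.le⟩

theorem integral_square_le_of_cutoff {φ w : Z → ℝ} (hφ : Continuous φ) (hc : HasCompactSupport φ)
    (hw : Continuous w) {a t : ℝ} (h1 : ∀ q ∈ box a, φ q = 1) (ht : t ∈ Icc (-a) 0) :
    ∫ x in square a, w (t, x) ^ 2 ≤ ∫ x : ℝ × ℝ, (φ (t, x) * w (t, x)) ^ 2 := by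
  have e : ∫ x in square a, w (t, x) ^ 2 = ∫ x in square a, (φ (t, x) * w (t, x)) ^ 2 := by
    refine setIntegral_congr_fun (isCompact_square a).measurableSet fun x hx => ?_
    simp only [h1 (t, x) ⟨ht, hx⟩, one_mul]
  rw [e]
  refine setIntegral_le_integral ?_ (Eventually.of_forall fun x => sq_nonneg _)
  refine Continuous.integrable_of_hasCompactSupport ?_ ?_
  · exact ((hφ.mul hw).pow 2).comp (Continuous.prodMk_right t)
  · exact hasCompactSupport_slice (u := fun q => (φ q * w q) ^ 2)
      (hasCompactSupport_pow hc.mul_right two_ne_zero) t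

theorem integral_box_le_of_cutoff {φ w : Z → ℝ} (hφ : Continuous φ) (hc : HasCompactSupport φ)
    (hw : Continuous w) {a : ℝ} (h1 : ∀ q ∈ box a, φ q = 1) :
    ∫ q in box a, w q ^ 4 ≤ ∫ q in past 0, (φ q * w q) ^ 4 := by
  have e : ∫ q in box a, w q ^ 4 = ∫ q in box a, (φ q * w q) ^ 4 := by
    refine setIntegral_congr_fun (isCompact_box a).measurableSet fun x hx => ?_
    simp only [h1 x hx, one_mul]
  rw [e]
  exact setIntegral_mono_set (integrable_past ((hφ.mul hw).pow 4)
    (hasCompactSupport_pow hc.mul_right four_ne_zero) 0)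
    (Eventually.of_forall fun q => by positivity) (box_subset_past a).eventuallyLE

/-- Local energy estimate between two boxes. -/
theorem exists_box_energy (κ : ℝ) {a b : ℝ} (hab : a < b) (hb : b ≤ 1 / 2) :
    ∃ C : ℝ, 1 ≤ C ∧ ∀ b₁ b₂ F G w : Z → ℝ, IsSubsolution κ (box b) b₁ b₂ F G w →
      ∀ β X : ℝ, 0 ≤ β → ∫ q in box b, (b₁ q ^ 2 + b₂ q ^ 2) ^ 2 ≤ β ^ 2 →
      (1 + β) * (∫ q in box b, w q ^ 2) + (∫ q in box b, F q ^ 2) + (∫ q in box b, G q ^ 2) ≤ X →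
      (∀ t ∈ Icc (-a) 0, ∫ x in square a, w (t, x) ^ 2 ≤ C * X) ∧
      ∫ q in box a, w q ^ 4 ≤ (C * X) ^ 2 := by
  obtain ⟨φ, hφ, hc, hs, h1, -⟩ := exists_box_cutoff hab
  obtain ⟨C, hC, H⟩ := exists_local_energy κ hφ hc (isCompact_box b) (box_subset_past b)
    (fun q hq => radius_mem_of_box hb hq) hs
  refine ⟨C, hC, fun b₁ b₂ F G w hw β X hβ hbβ hX => ?_⟩
  obtain ⟨e1, e2⟩ := H b₁ b₂ F G w hw β hβ hbβ
  have hm := mul_le_mul_of_nonneg_left hX (show 0 ≤ C by linarith)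
  refine ⟨fun t ht => (integral_square_le_of_cutoff hφ.continuous hc hw.smooth.continuous h1
    ht).trans ((e1 t ht.2).trans hm), (integral_box_le_of_cutoff hφ.continuous hc
    hw.smooth.continuous h1).trans (e2.trans (pow_le_pow_left₀ ?_ hm 2))⟩
  have i1 : 0 ≤ ∫ q in box b, w q ^ 2 := integral_nonneg fun q => sq_nonneg _
  have i2 : 0 ≤ ∫ q in box b, F q ^ 2 := integral_nonneg fun q => sq_nonneg _
  have i3 : 0 ≤ ∫ q in box b, G q ^ 2 := integral_nonneg fun q => sq_nonneg _
  positivity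

/-- Interior `L⁴` bound from the energy. -/
theorem exists_box_L4 {a b : ℝ} (hab : a < b) (hb : 0 ≤ b) :
    ∃ C : ℝ, 1 ≤ C ∧ ∀ u : Z → ℝ, ContDiff ℝ ∞ u → ∀ A : ℝ,
      (∀ t ∈ Icc (-b) 0, ∫ x in square b, u (t, x) ^ 2 ≤ A) →
      ∫ q in box b, (dR u q ^ 2 + dZ u q ^ 2) ≤ A →
      ∫ q in box a, u q ^ 4 ≤ C * A ^ 2 := by
  obtain ⟨φ, hφ, hc, hs, h1, h01⟩ := exists_box_cutoff hab
  obtain ⟨C, hC, hlad⟩ := exists_ladyzhenskaya_past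
  obtain ⟨A₁, hA₁⟩ := (hasCompactSupport_dirD (e := ((0, 1, 0) : Z)) hc).exists_bound_of_continuous
    (contDiff_dirD hφ).continuous
  obtain ⟨A₂, hA₂⟩ := (hasCompactSupport_dirD (e := ((0, 0, 1) : Z)) hc).exists_bound_of_continuous
    (contDiff_dirD hφ).continuous
  have hK : 1 ≤ 2 + 4 * (max A₁ A₂) ^ 2 * b := by
    have : 0 ≤ 4 * (max A₁ A₂) ^ 2 * b := by positivity
    linarith
  refine ⟨C * (2 + 4 * (max A₁ A₂) ^ 2 * b), one_le_mul_of_one_le_of_one_le hC hK,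
    fun u hu A hA hg => ?_⟩
  have cu := hu.continuous
  have cφ := hφ.continuous
  have cRu := (contDiff_dirD (e := ((0, 1, 0) : Z)) hu).continuous
  have cZu := (contDiff_dirD (e := ((0, 0, 1) : Z)) hu).continuous
  have hA0 : 0 ≤ A := le_trans (integral_nonneg fun q => by positivity) hg
  have hsq : ∀ q, φ q ^ 2 ≤ 1 := fun q => pow_le_one₀ (h01 q).1 (h01 q).2
  have slice : ∀ t ≤ 0, ∫ x : ℝ × ℝ, (φ (t, x) * u (t, x)) ^ 2 ≤ A := by
    intro t ht
    have vanish : ∀ x, ((t, x) : Z) ∉ box b → φ (t, x) = 0 := fun x hx =>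
      image_eq_zero_of_notMem_tsupport fun h => hx (hs ⟨h, ⟨ht, trivial⟩⟩)
    by_cases htb : -b ≤ t
    · have e : ∫ x : ℝ × ℝ, (φ (t, x) * u (t, x)) ^ 2
          = ∫ x in square b, (φ (t, x) * u (t, x)) ^ 2 := by
        refine (setIntegral_eq_integral_of_forall_compl_eq_zero fun x hx => ?_).symm
        rw [vanish x fun h => hx h.2]; simp
      rw [e]
      refine le_trans (setIntegral_mono_on ?_ ?_ (isCompact_square b).measurableSet
        fun x _ => ?_) (hA t ⟨htb, ht⟩)
      · exact (Continuous.continuousOn (by fun_prop)).integrableOn_compact (isCompact_square b)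
      · exact (Continuous.continuousOn (by fun_prop)).integrableOn_compact (isCompact_square b)
      · rw [mul_pow]
        exact mul_le_of_le_one_left (sq_nonneg _) (hsq _)
    · have : ∀ x : ℝ × ℝ, (φ (t, x) * u (t, x)) ^ 2 = 0 := fun x => by
        rw [vanish x fun h => htb h.1.1]; simp
      simp [this, hA0]
  have hu2 : ∫ q in box b, u q ^ 2 ≤ b * A := by
    have hi : IntegrableOn (fun q => u q ^ 2) (box b) := integrableOn_box (by fun_prop) b
    rw [box, Measure.volume_eq_prod] at hi ⊢
    rw [setIntegral_prod _ hi]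
    have : ∫ s in Icc (-b) 0, ∫ x in square b, u (s, x) ^ 2 ≤ ∫ s in Icc (-b) 0, A := by
      refine setIntegral_mono_on ?_ (integrableOn_const (by simp)) measurableSet_Icc hA
      rw [IntegrableOn, ← Measure.prod_restrict] at hi
      exact hi.integral_prod_left
    refine this.trans ?_
    simp [hb]
  have g2 : ∫ q in past 0, φ q ^ 2 * (dR u q ^ 2 + dZ u q ^ 2) ≤ A := by
    refine le_trans ?_ hg
    have e : ∫ q in past 0, φ q ^ 2 * (dR u q ^ 2 + dZ u q ^ 2)
        = ∫ q in box b, φ q ^ 2 * (dR u q ^ 2 + dZ u q ^ 2) := by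
      refine (setIntegral_eq_of_subset_of_forall_sdiff_eq_zero (measurableSet_past 0)
        (box_subset_past b) fun q hq => ?_)
      rw [image_eq_zero_of_notMem_tsupport fun h => hq.2 (hs ⟨h, hq.1⟩)]; simp
    rw [e]
    exact setIntegral_box_mono (by fun_prop) (by fun_prop) fun q _ =>
      mul_le_of_le_one_left (by positivity) (hsq q)
  have grad := integral_grad_cutoff_le hφ hc hu (isCompact_box b) hs (A := max A₁ A₂)
    (fun q => (hA₁ q).trans (le_max_left _ _)) (fun q => (hA₂ q).trans (le_max_right _ _))
  have hl := hlad _ (hφ.mul hu) hc.mul_right A slice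
  refine (integral_box_le_of_cutoff cφ hc cu h1).trans (hl.trans ?_)
  have h3 := mul_le_mul_of_nonneg_left hu2 (show 0 ≤ 4 * (max A₁ A₂) ^ 2 by positivity)
  have h4 : ∫ q in past 0, (dR (fun q => φ q * u q) q ^ 2 + dZ (fun q => φ q * u q) q ^ 2)
      ≤ (2 + 4 * (max A₁ A₂) ^ 2 * b) * A := by linarith
  calc _ ≤ C * A * ((2 + 4 * (max A₁ A₂) ^ 2 * b) * A) :=
        mul_le_mul_of_nonneg_left h4 (by positivity)
    _ = _ := by ring

/-! ### Axially symmetric flow at unit distance from the axis -/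

/-- Local description of an axially symmetric flow in the box of size `1/2`: `f, h` are the radial
and vertical velocities, `Γ` is `r` times the swirl, `Ω` is the angular vorticity divided by `r`,
and `F = Γ² / r⁴`. The energy of the flow is bounded by `A`. -/
structure UnitFlow (f h Γ Ω F : Z → ℝ) (A : ℝ) : Prop where
  smooth_f : ContDiff ℝ ∞ f
  smooth_h : ContDiff ℝ ∞ h
  smooth_Γ : ContDiff ℝ ∞ Γ
  smooth_Ω : ContDiff ℝ ∞ Ω
  smooth_F : ContDiff ℝ ∞ F
  div_free : ∀ q ∈ box (1 / 2), dR f q + f q / q.2.1 + dZ h q = 0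
  vorticity : ∀ q ∈ box (1 / 2), q.2.1 * Ω q = dZ f q - dR h q
  flux : ∀ q ∈ box (1 / 2), F q = Γ q ^ 2 / q.2.1 ^ 4
  eq_Γ : ∀ q ∈ box (1 / 2), dS Γ q + f q * dR Γ q + h q * dZ Γ q - dR (dR Γ) q - dZ (dZ Γ) q
    + dR Γ q / q.2.1 = 0
  eq_Ω : ∀ q ∈ box (1 / 2), dS Ω q + f q * dR Ω q + h q * dZ Ω q - dR (dR Ω) q - dZ (dZ Ω) q
    - 3 * dR Ω q / q.2.1 - dZ F q = 0
  one_le : 1 ≤ A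
  energy_f : ∀ t ∈ Icc (-(1 / 2)) 0, ∫ x in square (1 / 2), f (t, x) ^ 2 ≤ A
  energy_h : ∀ t ∈ Icc (-(1 / 2)) 0, ∫ x in square (1 / 2), h (t, x) ^ 2 ≤ A
  energy_Γ : ∀ t ∈ Icc (-(1 / 2)) 0, ∫ x in square (1 / 2), Γ (t, x) ^ 2 ≤ A
  grad_f : ∫ q in box (1 / 2), (dR f q ^ 2 + dZ f q ^ 2) ≤ A
  grad_h : ∫ q in box (1 / 2), (dR h q ^ 2 + dZ h q ^ 2) ≤ A
  grad_Γ : ∫ q in box (1 / 2), (dR Γ q ^ 2 + dZ Γ q ^ 2) ≤ A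

namespace UnitFlow

variable {f h Γ Ω F : Z → ℝ} {A : ℝ}

theorem sq_Ω_le (H : UnitFlow f h Γ Ω F A) {q : Z} (hq : q ∈ box (1 / 2)) :
    Ω q ^ 2 ≤ 8 * (dZ f q ^ 2 + dR h q ^ 2) := by
  have h1 := H.vorticity q hq
  have h2 := (radius_mem_of_box le_rfl hq).1
  have h3 : (q.2.1 * Ω q) ^ 2 ≤ 2 * (dZ f q ^ 2 + dR h q ^ 2) := by
    rw [h1]; nlinarith [sq_nonneg (dZ f q + dR h q)]
  have h4 : 1 / 4 ≤ q.2.1 ^ 2 := by nlinarith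
  nlinarith [mul_le_mul_of_nonneg_right h4 (sq_nonneg (Ω q))]

theorem abs_F_le (H : UnitFlow f h Γ Ω F A) {q : Z} (hq : q ∈ box (1 / 2)) :
    |F q| ≤ 16 * Γ q ^ 2 := by
  have h2 := (radius_mem_of_box le_rfl hq).1
  have h4 : (1 / 2) ^ 4 ≤ q.2.1 ^ 4 := pow_le_pow_left₀ (by norm_num) h2 4
  rw [H.flux q hq, abs_of_nonneg (by positivity), div_le_iff₀ (by positivity)]
  nlinarith [mul_le_mul_of_nonneg_right h4 (sq_nonneg (Γ q))]

/-- Dividing the angular vorticity by `r` removes the stretching and zeroth-order terms: what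
remains is the five-dimensional radial Laplacian, hence `κ = 3`, and a forcing that is an exact
`z`-derivative. -/
theorem sub_Ω (H : UnitFlow f h Γ Ω F A) {a : ℝ} (ha : a ≤ 1 / 2) :
    IsSubsolution 3 (box a) f h F (fun _ => 0) Ω where
  smooth_drift_fst := H.smooth_f
  smooth_drift_snd := H.smooth_h
  smooth_flux := H.smooth_F
  continuous_source := continuous_const
  smooth := H.smooth_Ω
  div_free := fun q hq => H.div_free q (box_mono ha hq)
  ineq := fun q hq => by
    have := H.eq_Ω q (box_mono ha hq)
    rw [sub_zero, this, mul_zero]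

/-- Squaring turns the equation into an inequality, with defect `-2 |∇Γ|²`. An `L⁴` estimate for
`Γ²` is an `L⁸` estimate for the swirl, and so an `L⁴` estimate for `F`. -/
theorem sub_sq_Γ (H : UnitFlow f h Γ Ω F A) {a : ℝ} (ha : a ≤ 1 / 2) :
    IsSubsolution (-1) (box a) f h (fun _ => 0) (fun _ => 0) (fun q => Γ q ^ 2) where
  smooth_drift_fst := H.smooth_f
  smooth_drift_snd := H.smooth_h
  smooth_flux := contDiff_const
  continuous_source := continuous_const
  smooth := H.smooth_Γ.pow 2
  div_free := fun q hq => H.div_free q (box_mono ha hq)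
  ineq := fun q hq => by
    have e := H.eq_Γ q (box_mono ha hq)
    have hr := (radius_mem_of_box ha hq).1
    have d1 := differentiable_of_smooth H.smooth_Γ
    have d2 := fun e => differentiable_of_smooth (contDiff_dirD (e := e) H.smooth_Γ)
    have hd : ∀ e : Z, dirD e (fun q => Γ q ^ 2) = fun q => 2 * (Γ q * dirD e Γ q) := fun e => by
      ext x; rw [dirD_sq (d1 x)]; ring
    have h0 : dZ (fun _ : Z => (0 : ℝ)) q = 0 := by simp [dirD]
    rw [h0]
    simp only [dS, dR, dZ, hd] at e ⊢
    simp (disch := fun_prop) only [dirD_const_mul, dirD_mul]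
    refine mul_nonpos_of_nonneg_of_nonpos (sq_nonneg _) ?_
    have key := congrArg (fun y => 2 * Γ q * y) e
    simp only [mul_zero] at key
    have e2 : -1 * (2 * (Γ q * dirD ((0, 1, 0) : Z) Γ q)) / q.2.1
        = -(2 * Γ q * (dirD ((0, 1, 0) : Z) Γ q / q.2.1)) := by ring
    rw [e2]
    nlinarith [sq_nonneg (dirD ((0, 1, 0) : Z) Γ q), sq_nonneg (dirD ((0, 0, 1) : Z) Γ q)]

/-- The forcing of `Ω²` is `2 Ω ∂_z F = ∂_z (2 Ω F) - 2 F ∂_z Ω`. With the good term `-2 (∂_z Ω)²`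
the last summand completes the square `-2 (∂_z Ω + F / 2)²` and leaves the source `F² / 2`. -/
theorem sub_sq_Ω (H : UnitFlow f h Γ Ω F A) {a : ℝ} (ha : a ≤ 1 / 2) :
    IsSubsolution 3 (box a) f h (fun q => 2 * (Ω q * F q)) (fun q => F q ^ 2 / 2)
      (fun q => Ω q ^ 2) where
  smooth_drift_fst := H.smooth_f
  smooth_drift_snd := H.smooth_h
  smooth_flux := contDiff_const.mul (H.smooth_Ω.mul H.smooth_F)
  continuous_source := (H.smooth_F.continuous.pow 2).div_const 2
  smooth := H.smooth_Ω.pow 2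
  div_free := fun q hq => H.div_free q (box_mono ha hq)
  ineq := fun q hq => by
    have e := H.eq_Ω q (box_mono ha hq)
    have hr := (radius_mem_of_box ha hq).1
    have d1 := differentiable_of_smooth H.smooth_Ω
    have d3 := differentiable_of_smooth H.smooth_F
    have d2 := fun e => differentiable_of_smooth (contDiff_dirD (e := e) H.smooth_Ω)
    have hd : ∀ e : Z, dirD e (fun q => Ω q ^ 2) = fun q => 2 * (Ω q * dirD e Ω q) := fun e => by
      ext x; rw [dirD_sq (d1 x)]; ring
    simp only [dS, dR, dZ, hd] at e ⊢
    simp (disch := fun_prop) only [dirD_const_mul, dirD_mul]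
    refine mul_nonpos_of_nonneg_of_nonpos (sq_nonneg _) ?_
    have key := congrArg (fun y => 2 * Ω q * y) e
    simp only [mul_zero] at key
    have e2 : 3 * (2 * (Ω q * dirD ((0, 1, 0) : Z) Ω q)) / q.2.1
        = 2 * Ω q * (3 * dirD ((0, 1, 0) : Z) Ω q / q.2.1) := by ring
    rw [e2]
    nlinarith [sq_nonneg (dirD ((0, 1, 0) : Z) Ω q),
      sq_nonneg (dirD ((0, 0, 1) : Z) Ω q + F q / 2)]

end UnitFlow

theorem le_of_pow_le {A : ℝ} (hA : 1 ≤ A) {m n : ℕ} (h : m ≤ n) : A ^ m ≤ A ^ n :=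
  pow_le_pow_right₀ hA h

set_option maxHeartbeats 800000 in
/-- Interior bounds for the vorticity in `L²` and `L⁴` at time `0`. -/
theorem exists_vorticity_bounds : ∃ C : ℝ, 1 ≤ C ∧ ∀ (f h Γ Ω F : Z → ℝ) (A : ℝ),
    UnitFlow f h Γ Ω F A →
    ∫ x in square (1 / 5), Ω (0, x) ^ 2 ≤ C * A ^ 2 ∧
    ∫ x in square (1 / 5), Ω (0, x) ^ 4 ≤ C * A ^ 6 := by
  -- Each interior estimate shrinks the box: `1/2` to `2/5` for the `L⁴` bounds, then `3/10` for `Ω`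
  -- and `Γ²`, then `1/5` for `Ω²`.
  obtain ⟨c₀, hc₀, L⟩ := exists_box_L4 (a := 2 / 5) (b := 1 / 2) (by norm_num) (by norm_num)
  obtain ⟨c₁, hc₁, E₁⟩ := exists_box_energy 3 (a := 3 / 10) (b := 2 / 5) (by norm_num) (by norm_num)
  obtain ⟨c₂, hc₂, E₂⟩ := exists_box_energy (-1) (a := 3 / 10) (b := 2 / 5) (by norm_num)
    (by norm_num)
  obtain ⟨c₃, hc₃, E₃⟩ := exists_box_energy 3 (a := 1 / 5) (b := 3 / 10) (by norm_num) (by norm_num)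
  obtain ⟨k₁, hk₁⟩ : ∃ k, k = c₁ * (16 * (1 + 2 * c₀) + 256 * c₀) := ⟨_, rfl⟩
  obtain ⟨k₂, hk₂⟩ : ∃ k, k = c₂ * ((1 + 2 * c₀) * c₀) := ⟨_, rfl⟩
  obtain ⟨k₃, hk₃⟩ : ∃ k, k = c₃ * ((1 + 2 * c₀) * k₁ ^ 2 + 2 * k₁ ^ 2 + 4 * 16 ^ 4 * k₂ ^ 2) :=
    ⟨_, rfl⟩
  have p1 : 1 ≤ k₁ := by
    rw [hk₁]; exact one_le_mul_of_one_le_of_one_le hc₁ (by linarith)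
  have p2 : 0 ≤ k₂ := by rw [hk₂]; positivity
  have p3 : 0 ≤ k₃ := by rw [hk₃]; positivity
  refine ⟨k₁ + k₃, by linarith, fun f h Γ Ω F A H => ?_⟩
  have hA := H.one_le
  have hA0 : 0 ≤ A := by linarith
  have cf := H.smooth_f.continuous
  have ch := H.smooth_h.continuous
  have cΓ := H.smooth_Γ.continuous
  have cΩ := H.smooth_Ω.continuous
  have cF := H.smooth_F.continuous
  have cdf := fun e => (contDiff_dirD (e := e) H.smooth_f).continuous
  have cdh := fun e => (contDiff_dirD (e := e) H.smooth_h).continuous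
  have Lf := L f H.smooth_f A H.energy_f H.grad_f
  have Lh := L h H.smooth_h A H.energy_h H.grad_h
  have LΓ := L Γ H.smooth_Γ A H.energy_Γ H.grad_Γ
  have b25 : box (2 / 5) ⊆ box (1 / 2) := box_mono (by norm_num)
  have b31 : box (3 / 10) ⊆ box (1 / 2) := box_mono (by norm_num)
  -- The fourth powers give `4 c₀ A²`, and `1 ≤ c₀` makes this at most `(2 c₀ A)²`: the drift
  -- parameter `β` is of order `A`.
  have hβ : ∫ q in box (2 / 5), (f q ^ 2 + h q ^ 2) ^ 2 ≤ (2 * c₀ * A) ^ 2 := by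
    have h1 : ∫ q in box (2 / 5), (f q ^ 2 + h q ^ 2) ^ 2
        ≤ ∫ q in box (2 / 5), (2 * f q ^ 4 + 2 * h q ^ 4) :=
      setIntegral_box_mono (by fun_prop) (by fun_prop) fun q _ => by
        nlinarith [sq_nonneg (f q ^ 2 - h q ^ 2)]
    rw [integral_add (integrableOn_box (by fun_prop) _) (integrableOn_box (by fun_prop) _),
      integral_const_mul, integral_const_mul] at h1
    have : c₀ ≤ c₀ ^ 2 := by nlinarith
    have h2 := mul_le_mul_of_nonneg_right this (sq_nonneg A)
    nlinarith
  have hβ' : ∫ q in box (3 / 10), (f q ^ 2 + h q ^ 2) ^ 2 ≤ (2 * c₀ * A) ^ 2 :=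
    (setIntegral_box_le (by fun_prop) (fun q => by positivity) (by norm_num)).trans hβ
  have hβ0 : 0 ≤ 2 * c₀ * A := by positivity
  have hβA : 1 + 2 * c₀ * A ≤ (1 + 2 * c₀) * A := by nlinarith
  -- vorticity in `L²`
  have N1 : ∫ q in box (2 / 5), Ω q ^ 2 ≤ 16 * A := by
    have h1 : ∫ q in box (2 / 5), Ω q ^ 2
        ≤ ∫ q in box (2 / 5), (8 * (dR f q ^ 2 + dZ f q ^ 2) + 8 * (dR h q ^ 2 + dZ h q ^ 2)) :=
      setIntegral_box_mono (by fun_prop) (by fun_prop) fun q hq => by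
        nlinarith [H.sq_Ω_le (b25 hq), sq_nonneg (dR f q), sq_nonneg (dZ h q)]
    have h2 := setIntegral_box_le (u := fun q => 8 * (dR f q ^ 2 + dZ f q ^ 2)
      + 8 * (dR h q ^ 2 + dZ h q ^ 2)) (by fun_prop) (fun q => by positivity)
      (show (2 / 5 : ℝ) ≤ 1 / 2 by norm_num)
    rw [integral_add (μ := volume.restrict (box (1 / 2))) (integrableOn_box (by fun_prop) _)
      (integrableOn_box (by fun_prop) _), integral_const_mul, integral_const_mul] at h2
    linarith [H.grad_f, H.grad_h]
  have F1 : ∫ q in box (2 / 5), F q ^ 2 ≤ 256 * c₀ * A ^ 2 := by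
    have h1 : ∫ q in box (2 / 5), F q ^ 2 ≤ ∫ q in box (2 / 5), 256 * Γ q ^ 4 :=
      setIntegral_box_mono (by fun_prop) (by fun_prop) fun q hq => by
        have := pow_le_pow_left₀ (abs_nonneg _) (H.abs_F_le (b25 hq)) 2
        rw [sq_abs] at this
        linarith
    rw [integral_const_mul] at h1
    linarith
  have zero2 : ∀ a : ℝ, ∫ q : Z in box a, ((fun _ => 0 : Z → ℝ) q) ^ 2 = 0 := fun a => by simp
  -- Both `(1 + β) ∫ Ω²` and `∫ F²` are of order `A²`.
  have e1 := E₁ f h F (fun _ => 0) Ω (H.sub_Ω (by norm_num)) (2 * c₀ * A)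
    ((16 * (1 + 2 * c₀) + 256 * c₀) * A ^ 2) hβ0 hβ (by
      have h1 : (1 + 2 * c₀ * A) * (∫ q in box (2 / 5), Ω q ^ 2)
          ≤ ((1 + 2 * c₀) * A) * (16 * A) :=
        mul_le_mul hβA N1 (integral_nonneg fun q => sq_nonneg _) (by positivity)
      rw [zero2]
      linarith)
  rw [← mul_assoc, ← hk₁] at e1
  -- the swirl
  have N2 : ∫ q in box (2 / 5), (Γ q ^ 2) ^ 2 ≤ c₀ * A ^ 2 := by
    simpa only [← pow_mul] using LΓ
  -- Only the space-time conclusion is kept: `∫ Γ⁸` is of order `A⁶`.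
  have e2 := (E₂ f h (fun _ => 0) (fun _ => 0) (fun q => Γ q ^ 2) (H.sub_sq_Γ (by norm_num))
    (2 * c₀ * A) (((1 + 2 * c₀) * c₀) * A ^ 3) hβ0 hβ (by
      have h1 : (1 + 2 * c₀ * A) * (∫ q in box (2 / 5), (Γ q ^ 2) ^ 2)
          ≤ ((1 + 2 * c₀) * A) * (c₀ * A ^ 2) :=
        mul_le_mul hβA N2 (integral_nonneg fun q => sq_nonneg _) (by positivity)
      rw [zero2]
      linarith)).2
  rw [← mul_assoc, ← hk₂] at e2
  -- vorticity in `L⁴`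
  have F4 : ∫ q in box (3 / 10), F q ^ 4 ≤ 16 ^ 4 * (k₂ * A ^ 3) ^ 2 := by
    have h1 : ∫ q in box (3 / 10), F q ^ 4 ≤ ∫ q in box (3 / 10), 16 ^ 4 * (Γ q ^ 2) ^ 4 :=
      setIntegral_box_mono (by fun_prop) (by fun_prop) fun q hq => by
        have := pow_le_pow_left₀ (abs_nonneg _) (H.abs_F_le (b31 hq)) 4
        rw [Even.pow_abs (by decide)] at this
        linarith
    rw [integral_const_mul] at h1
    linarith
  have A46 : A ^ 4 ≤ A ^ 6 := le_of_pow_le hA (by norm_num)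
  have A56 : A ^ 5 ≤ A ^ 6 := le_of_pow_le hA (by norm_num)
  have N3 : ∫ q in box (3 / 10), (Ω q ^ 2) ^ 2 ≤ k₁ ^ 2 * A ^ 4 := by
    have h1 : ∫ q in box (3 / 10), (Ω q ^ 2) ^ 2 ≤ (k₁ * A ^ 2) ^ 2 := by
      simpa only [← pow_mul] using e1.2
    linarith
  -- `(1 + β) ∫ Ω⁴` is of order `A⁵`; the flux `2 Ω F` and the source `F² / 2` are controlled by `∫
  -- Ω⁴ + ∫ F⁴`, of order `A⁶`.
  have e3 := (E₃ f h (fun q => 2 * (Ω q * F q)) (fun q => F q ^ 2 / 2) (fun q => Ω q ^ 2)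
    (H.sub_sq_Ω (by norm_num)) (2 * c₀ * A)
    (((1 + 2 * c₀) * k₁ ^ 2 + 2 * k₁ ^ 2 + 4 * 16 ^ 4 * k₂ ^ 2) * A ^ 6) hβ0 hβ' (by
      have h1 : (1 + 2 * c₀ * A) * (∫ q in box (3 / 10), (Ω q ^ 2) ^ 2)
          ≤ ((1 + 2 * c₀) * A) * (k₁ ^ 2 * A ^ 4) :=
        mul_le_mul hβA N3 (integral_nonneg fun q => sq_nonneg _) (by positivity)
      have h2 : ∫ q in box (3 / 10), (2 * (Ω q * F q)) ^ 2
          ≤ ∫ q in box (3 / 10), (2 * (Ω q ^ 2) ^ 2 + 2 * F q ^ 4) :=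
        setIntegral_box_mono (by fun_prop) (by fun_prop) fun q _ => by
          nlinarith [sq_nonneg (Ω q ^ 2 - F q ^ 2)]
      rw [integral_add (integrableOn_box (by fun_prop) _) (integrableOn_box (by fun_prop) _),
        integral_const_mul, integral_const_mul] at h2
      have h3 : ∫ q in box (3 / 10), (F q ^ 2 / 2) ^ 2 ≤ ∫ q in box (3 / 10), F q ^ 4 :=
        setIntegral_box_mono (by fun_prop) (by fun_prop) fun q _ => by
          nlinarith [sq_nonneg (F q ^ 2)]
      have h4 := mul_le_mul_of_nonneg_left A46 (show 0 ≤ 2 * k₁ ^ 2 by positivity)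
      have h5 := mul_le_mul_of_nonneg_left A56 (show 0 ≤ (1 + 2 * c₀) * k₁ ^ 2 by positivity)
      have h6 : 0 ≤ k₂ ^ 2 * A ^ 6 := by positivity
      linarith)).1
  rw [← mul_assoc, ← hk₃] at e3
  constructor
  · have h1 := setIntegral_mono_set (μ := volume) (f := fun x : ℝ × ℝ => Ω (0, x) ^ 2)
      (s := square (1 / 5)) (t := square (3 / 10))
      ((Continuous.continuousOn (by fun_prop)).integrableOn_compact (isCompact_square _))
      (Eventually.of_forall fun q => sq_nonneg _) (square_mono (by norm_num)).eventuallyLE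
    have h2 := e1.1 0 ⟨by norm_num, le_rfl⟩
    have h3 : 0 ≤ k₃ * A ^ 2 := by positivity
    linarith
  · have h2 := e3 0 ⟨by norm_num, le_rfl⟩
    simp only [← pow_mul] at h2
    have h3 : 0 ≤ k₁ * A ^ 6 := by positivity
    norm_num at h2 ⊢
    linarith

/-! ### Recovering a planar field from its divergence and curl -/

/-- The point at polar coordinates `p = (ρ, θ)` around `x₀`. -/
def polarAt (x₀ : ℝ × ℝ) (p : ℝ × ℝ) : ℝ × ℝ :=
  (x₀.1 + p.1 * Real.cos p.2, x₀.2 + p.1 * Real.sin p.2)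

theorem continuous_polarAt (x₀ : ℝ × ℝ) : Continuous (polarAt x₀) := by
  unfold polarAt; fun_prop

/-- The domain of polar coordinates. -/
def polarDomain : Set (ℝ × ℝ) := Ioi 0 ×ˢ Ioo (-Real.pi) Real.pi

theorem measurableSet_polarDomain : MeasurableSet polarDomain :=
  measurableSet_Ioi.prod measurableSet_Ioo

theorem exists_polar_radius {u : ℝ × ℝ → ℝ} (hc : HasCompactSupport u) (x₀ : ℝ × ℝ) :
    ∃ M : ℝ, 0 < M ∧ ∀ p : ℝ × ℝ, M < |p.1| → u (polarAt x₀ p) = 0 := by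
  obtain ⟨M, hM⟩ := hc.isBounded.subset_closedBall x₀
  -- The ball of the sup metric is a square, which reaches Euclidean distance `√2 |M|`.
  refine ⟨2 * |M| + 1, by positivity, fun p hp => ?_⟩
  by_contra hu
  have h1 := hM (subset_tsupport _ hu)
  rw [Metric.mem_closedBall, Prod.dist_eq, max_le_iff] at h1
  simp only [polarAt, Real.dist_eq, add_sub_cancel_left, abs_mul] at h1
  have h2 : |p.1| ^ 2 ≤ 2 * |M| ^ 2 := by
    have a1 : (|p.1| * |Real.cos p.2|) ^ 2 ≤ |M| ^ 2 :=
      pow_le_pow_left₀ (by positivity) (h1.1.trans (le_abs_self M)) 2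
    have a2 : (|p.1| * |Real.sin p.2|) ^ 2 ≤ |M| ^ 2 :=
      pow_le_pow_left₀ (by positivity) (h1.2.trans (le_abs_self M)) 2
    rw [mul_pow, sq_abs (Real.cos _)] at a1
    rw [mul_pow, sq_abs (Real.sin _)] at a2
    nlinarith [Real.sin_sq_add_cos_sq p.2]
  nlinarith [abs_nonneg M, abs_nonneg p.1]

theorem integrableOn_polarDomain {g : ℝ × ℝ → ℝ} (hg : Continuous g) {M : ℝ}
    (h0 : ∀ p : ℝ × ℝ, M < |p.1| → g p = 0) : IntegrableOn g polarDomain := by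
  have hK : IsCompact (Icc 0 M ×ˢ Icc (-Real.pi) Real.pi : Set (ℝ × ℝ)) :=
    isCompact_Icc.prod isCompact_Icc
  refine (hg.continuousOn.integrableOn_compact hK).of_forall_sdiff_eq_zero
    measurableSet_polarDomain fun p hp => h0 p ?_
  by_contra hM
  have hp1 : (0 : ℝ) < p.1 := hp.1.1
  rw [abs_of_pos hp1] at hM
  exact hp.2 ⟨⟨hp1.le, not_lt.1 hM⟩, hp.1.2.1.le, hp.1.2.2.le⟩

theorem hasDerivAt_polar_radial {u : ℝ × ℝ → ℝ} (hu : Differentiable ℝ u) (x₀ : ℝ × ℝ) (ρ θ : ℝ) :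
    HasDerivAt (fun ρ => u (polarAt x₀ (ρ, θ)))
      (Real.cos θ * dirD (1, 0) u (polarAt x₀ (ρ, θ))
        + Real.sin θ * dirD (0, 1) u (polarAt x₀ (ρ, θ))) ρ := by
  have h1 : HasDerivAt (fun ρ => polarAt x₀ (ρ, θ)) (Real.cos θ, Real.sin θ) ρ := by
    unfold polarAt
    refine HasDerivAt.prodMk ?_ ?_
    · simpa using ((hasDerivAt_id ρ).mul_const (Real.cos θ)).const_add x₀.1
    · simpa using ((hasDerivAt_id ρ).mul_const (Real.sin θ)).const_add x₀.2
  have h2 := (hu (polarAt x₀ (ρ, θ))).hasFDerivAt.comp_hasDerivAt ρ h1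
  refine h2.congr_deriv ?_
  have : ((Real.cos θ, Real.sin θ) : ℝ × ℝ)
      = Real.cos θ • ((1 : ℝ), (0 : ℝ)) + Real.sin θ • ((0 : ℝ), (1 : ℝ)) := by ext <;> simp
  rw [this, map_add, map_smul, map_smul]; rfl

theorem hasDerivAt_polar_angular {u : ℝ × ℝ → ℝ} (hu : Differentiable ℝ u) (x₀ : ℝ × ℝ)
    (ρ θ : ℝ) :
    HasDerivAt (fun θ => u (polarAt x₀ (ρ, θ)))
      (ρ * (-Real.sin θ * dirD (1, 0) u (polarAt x₀ (ρ, θ))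
        + Real.cos θ * dirD (0, 1) u (polarAt x₀ (ρ, θ)))) θ := by
  have h1 : HasDerivAt (fun θ => polarAt x₀ (ρ, θ)) (ρ * (-Real.sin θ), ρ * Real.cos θ) θ := by
    unfold polarAt
    refine HasDerivAt.prodMk ?_ ?_
    · simpa using ((Real.hasDerivAt_cos θ).const_mul ρ).const_add x₀.1
    · simpa using ((Real.hasDerivAt_sin θ).const_mul ρ).const_add x₀.2
  have h2 := (hu (polarAt x₀ (ρ, θ))).hasFDerivAt.comp_hasDerivAt θ h1
  refine h2.congr_deriv ?_
  have : ((ρ * (-Real.sin θ), ρ * Real.cos θ) : ℝ × ℝ)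
      = (ρ * (-Real.sin θ)) • ((1 : ℝ), (0 : ℝ)) + (ρ * Real.cos θ) • ((0 : ℝ), (1 : ℝ)) := by
    ext <;> simp
  rw [this, map_add, map_smul, map_smul]
  simp only [dirD, smul_eq_mul]; ring

/-- A Cauchy–Pompeiu formula. -/
theorem polar_representation {P Q : ℝ × ℝ → ℝ} (hP : ContDiff ℝ ∞ P) (hQ : ContDiff ℝ ∞ Q)
    (kP : HasCompactSupport P) (kQ : HasCompactSupport Q) (x₀ : ℝ × ℝ) :
    ∫ p in polarDomain, ((Real.cos p.2 * dirD (1, 0) P (polarAt x₀ p)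
        + Real.sin p.2 * dirD (0, 1) P (polarAt x₀ p))
      + (-Real.sin p.2 * dirD (1, 0) Q (polarAt x₀ p)
        + Real.cos p.2 * dirD (0, 1) Q (polarAt x₀ p))) = -(2 * Real.pi * P x₀) := by
  have dP := differentiable_of_smooth hP
  have dQ := differentiable_of_smooth hQ
  have cpol := continuous_polarAt x₀
  have cd : ∀ {u : ℝ × ℝ → ℝ} (e : ℝ × ℝ), ContDiff ℝ ∞ u →
      Continuous fun p => dirD e u (polarAt x₀ p) :=
    fun e hu => (contDiff_dirD hu).continuous.comp cpol
  have hineq : ∀ {u : ℝ × ℝ → ℝ} {a b : ℝ → ℝ}, ContDiff ℝ ∞ u → HasCompactSupport u →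
      Continuous a → Continuous b →
      IntegrableOn (fun p => a p.2 * dirD (1, 0) u (polarAt x₀ p)
        + b p.2 * dirD (0, 1) u (polarAt x₀ p)) polarDomain := by
    intro u a b hu ku ha hb
    obtain ⟨M₁, hM₁, h₁⟩ := exists_polar_radius (hasCompactSupport_dirD (e := (1, 0)) ku) x₀
    obtain ⟨M₂, hM₂, h₂⟩ := exists_polar_radius (hasCompactSupport_dirD (e := (0, 1)) ku) x₀
    refine integrableOn_polarDomain (M := M₁ + M₂) ?_ fun p hp => ?_
    · exact ((ha.comp continuous_snd).mul (cd _ hu)).add ((hb.comp continuous_snd).mul (cd _ hu))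
    · rw [h₁ p (by linarith), h₂ p (by linarith)]; simp
  have i1 := hineq hP kP Real.continuous_cos Real.continuous_sin
  have i2 := hineq (a := fun θ => -Real.sin θ) hQ kQ Real.continuous_sin.neg Real.continuous_cos
  rw [integral_add i1 i2]
  -- Along each ray the integrand is the radial derivative of `P`, whose integral is `-P x₀` for
  -- every angle.
  have r1 : ∫ p in polarDomain, (Real.cos p.2 * dirD (1, 0) P (polarAt x₀ p)
        + Real.sin p.2 * dirD (0, 1) P (polarAt x₀ p)) = -(2 * Real.pi * P x₀) := by
    unfold polarDomain at i1 ⊢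
    rw [Measure.volume_eq_prod, ← Measure.prod_restrict, integral_prod_symm _ (by
      rw [Measure.prod_restrict, ← Measure.volume_eq_prod]; exact i1)]
    have : ∀ θ : ℝ, ∫ ρ in Ioi (0 : ℝ), (Real.cos θ * dirD (1, 0) P (polarAt x₀ (ρ, θ))
        + Real.sin θ * dirD (0, 1) P (polarAt x₀ (ρ, θ))) = -P x₀ := by
      intro θ
      have e : ∀ ρ, Real.cos θ * dirD (1, 0) P (polarAt x₀ (ρ, θ))
        + Real.sin θ * dirD (0, 1) P (polarAt x₀ (ρ, θ))
          = deriv (fun ρ => P (polarAt x₀ (ρ, θ))) ρ :=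
        fun ρ => (hasDerivAt_polar_radial dP x₀ ρ θ).deriv.symm
      simp_rw [e]
      rw [HasCompactSupport.integral_Ioi_deriv_eq]
      · simp [polarAt]
      · refine (hP.of_le (by simp)).comp ?_
        unfold polarAt; fun_prop
      · obtain ⟨M, hM, h⟩ := exists_polar_radius kP x₀
        refine HasCompactSupport.intro (isCompact_Icc (a := -M) (b := M)) fun ρ hρ => h _ ?_
        by_contra hle
        exact hρ (abs_le.1 (not_lt.1 hle))
    simp only [this, integral_const]
    simp [Real.pi_pos.le]
    left; ring
  -- For `ρ > 0` the integrand is `ρ⁻¹` times the angular derivative of `Q`, so its integral over a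
  -- full circle vanishes.
  have r2 : ∫ p in polarDomain, (-Real.sin p.2 * dirD (1, 0) Q (polarAt x₀ p)
        + Real.cos p.2 * dirD (0, 1) Q (polarAt x₀ p)) = 0 := by
    unfold polarDomain at i2 ⊢
    rw [Measure.volume_eq_prod] at i2 ⊢
    rw [setIntegral_prod _ i2]
    refine setIntegral_eq_zero_of_forall_eq_zero fun ρ hρ => ?_
    have hρ0 : ρ ≠ 0 := ne_of_gt hρ
    have cI : Continuous fun θ => ρ * (-Real.sin θ * dirD (1, 0) Q (polarAt x₀ (ρ, θ))
        + Real.cos θ * dirD (0, 1) Q (polarAt x₀ (ρ, θ))) := by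
      have c1 := (cd (1, 0) hQ).comp (Continuous.prodMk_right ρ)
      have c2 := (cd (0, 1) hQ).comp (Continuous.prodMk_right ρ)
      exact continuous_const.mul ((Real.continuous_sin.neg.mul c1).add (Real.continuous_cos.mul c2))
    have h1 := intervalIntegral.integral_eq_sub_of_hasDerivAt (a := -Real.pi) (b := Real.pi)
      (fun θ _ => hasDerivAt_polar_angular dQ x₀ ρ θ) (cI.intervalIntegrable _ _)
    rw [intervalIntegral.integral_const_mul, intervalIntegral.integral_of_le
      (by linarith [Real.pi_pos]), integral_Ioc_eq_integral_Ioo] at h1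
    have h2 : Q (polarAt x₀ (ρ, Real.pi)) - Q (polarAt x₀ (ρ, -Real.pi)) = 0 := by
      simp [polarAt]
    rw [h2] at h1
    exact (mul_eq_zero.1 h1).resolve_left hρ0
  rw [r1, r2, add_zero]

theorem integral_polarDomain (g : ℝ × ℝ → ℝ) (x₀ : ℝ × ℝ) :
    ∫ p in polarDomain, p.1 * g (polarAt x₀ p) = ∫ x, g x := by
  have h := integral_comp_polarCoord_symm (fun x => g (x₀ + x))
  rw [integral_add_left_eq_self g x₀] at h
  exact h

/-- `∫ |∇B|² = ∫ (div B)² + (curl B)²` for compactly supported planar fields. -/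
theorem integral_grad_eq_div_curl {P Q : ℝ × ℝ → ℝ} (hP : ContDiff ℝ ∞ P) (hQ : ContDiff ℝ ∞ Q)
    (kP : HasCompactSupport P) (kQ : HasCompactSupport Q) :
    (∫ x, (dirD (1, 0) P x ^ 2 + dirD (0, 1) P x ^ 2))
      + ∫ x, (dirD (1, 0) Q x ^ 2 + dirD (0, 1) Q x ^ 2)
    = ∫ x, ((dirD (1, 0) P x + dirD (0, 1) Q x) ^ 2 + (dirD (1, 0) Q x - dirD (0, 1) P x) ^ 2) := by
  have sd : ∀ {u : ℝ × ℝ → ℝ} (e : ℝ × ℝ), ContDiff ℝ ∞ u → ContDiff ℝ ∞ (dirD e u) :=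
    fun e hu => contDiff_dirD hu
  have isq : ∀ {u : ℝ × ℝ → ℝ}, ContDiff ℝ ∞ u → HasCompactSupport u →
      Integrable fun x => dirD (1, 0) u x ^ 2 + dirD (0, 1) u x ^ 2 := by
    intro u hu ku
    have c : ∀ e : ℝ × ℝ, Integrable fun x => dirD e u x ^ 2 := fun e =>
      ((sd e hu).continuous.pow 2).integrable_of_hasCompactSupport
        (hasCompactSupport_pow (hasCompactSupport_dirD ku) two_ne_zero)
    exact (c _).add (c _)
  -- The two sides differ by twice the Jacobian `∂₁P ∂₂Q - ∂₂P ∂₁Q`, which is the divergence `∂₁(P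
  -- ∂₂Q) - ∂₂(P ∂₁Q)`.
  have su : ContDiff ℝ ∞ fun x => P x * dirD (0, 1) Q x := hP.mul (sd _ hQ)
  have sv : ContDiff ℝ ∞ fun x => P x * dirD (1, 0) Q x := hP.mul (sd _ hQ)
  have z1 := integral_dirD_eq_zero (μ := volume) (su.of_le (by simp)) kP.mul_right (1, 0)
  have z2 := integral_dirD_eq_zero (μ := volume) (sv.of_le (by simp)) kP.mul_right (0, 1)
  have j1 : Integrable (dirD (1, 0) fun x => P x * dirD (0, 1) Q x) :=
    (sd _ su).continuous.integrable_of_hasCompactSupport (hasCompactSupport_dirD kP.mul_right)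
  have j2 : Integrable (dirD (0, 1) fun x => P x * dirD (1, 0) Q x) :=
    (sd _ sv).continuous.integrable_of_hasCompactSupport (hasCompactSupport_dirD kP.mul_right)
  have j12 : Integrable fun x => 2 * (dirD (1, 0) (fun x => P x * dirD (0, 1) Q x) x
      - dirD (0, 1) (fun x => P x * dirD (1, 0) Q x) x) := (j1.sub j2).const_mul 2
  have e0 : ∫ x, 2 * (dirD (1, 0) (fun x => P x * dirD (0, 1) Q x) x
      - dirD (0, 1) (fun x => P x * dirD (1, 0) Q x) x) = 0 := by
    rw [integral_const_mul, integral_sub j1 j2, z1, z2]; simp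
  have isum : Integrable fun x => (dirD (1, 0) P x ^ 2 + dirD (0, 1) P x ^ 2)
      + (dirD (1, 0) Q x ^ 2 + dirD (0, 1) Q x ^ 2) := (isq hP kP).add (isq hQ kQ)
  have e1 := integral_add isum j12
  rw [e0, add_zero] at e1
  rw [← integral_add (isq hP kP) (isq hQ kQ), ← e1]
  congr 1; ext x
  have d1 := differentiable_of_smooth hP
  have d2 := fun e => differentiable_of_smooth (sd e hQ)
  rw [dirD_mul (d1 x) (d2 _ x), dirD_mul (d1 x) (d2 _ x),
    dirD_comm (e := (1, 0)) (e' := (0, 1)) hQ.contDiffAt]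
  ring

/-! ### A logarithmic bound for planar fields -/

/-- Two Young inequalities replace Hölder with exponents 4 and `4/3`; `σ` stands for `√ρ`. The
weight `A⁻⁵` is chosen so that an `L⁴` bound of order `A⁶` contributes order `A`. -/
theorem near_young {A σ H : ℝ} (hA : 0 < A) (hσ : 0 < σ) :
    H ≤ 1 / 4 * (A ^ 5)⁻¹ * (σ ^ 2 * H ^ 4) + (1 / 4 * A + 1 / 2 * A ^ 2 * σ⁻¹) := by
  have h1 : H ≤ 1 / 2 * ((A ^ 2)⁻¹ * H ^ 2 * σ) + 1 / 2 * A ^ 2 * σ⁻¹ := by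
    have : 0 ≤ (A ^ 2)⁻¹ * σ⁻¹ * (H * σ - A ^ 2) ^ 2 := by positivity
    have e : (A ^ 2)⁻¹ * σ⁻¹ * (H * σ - A ^ 2) ^ 2
        = (A ^ 2)⁻¹ * H ^ 2 * σ - 2 * H + A ^ 2 * σ⁻¹ := by field_simp; ring
    linarith
  have h2 : (A ^ 2)⁻¹ * H ^ 2 * σ ≤ 1 / 2 * ((A ^ 5)⁻¹ * (σ ^ 2 * H ^ 4)) + 1 / 2 * A := by
    have : 0 ≤ (A ^ 5)⁻¹ * (H ^ 2 * σ - A ^ 3) ^ 2 := by positivity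
    have e : (A ^ 5)⁻¹ * (H ^ 2 * σ - A ^ 3) ^ 2
        = (A ^ 5)⁻¹ * (σ ^ 2 * H ^ 4) - 2 * ((A ^ 2)⁻¹ * H ^ 2 * σ) + A := by field_simp; ring
    linarith
  linarith

/-- Young's inequality in place of Cauchy–Schwarz, with the weight `m` left free to be optimized. -/
theorem far_young {m ρ H : ℝ} (hm : 0 < m) (hρ : 0 < ρ) :
    H ≤ m * (ρ * H ^ 2) + 1 / (4 * m) * ρ⁻¹ := by
  have : 0 ≤ (m * ρ)⁻¹ * (m * ρ * H - 1 / 2) ^ 2 := by positivity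
  have e : (m * ρ)⁻¹ * (m * ρ * H - 1 / 2) ^ 2 = m * (ρ * H ^ 2) - H + 1 / (4 * m) * ρ⁻¹ := by
    field_simp; ring
  linarith

theorem integral_near_kernel {A ε : ℝ} (hε : 0 < ε) :
    IntegrableOn (fun ρ : ℝ => 1 / 4 * A + 1 / 2 * A ^ 2 * (Real.sqrt ρ)⁻¹) (Ioc 0 ε) ∧
    ∫ ρ in Ioc 0 ε, (1 / 4 * A + 1 / 2 * A ^ 2 * (Real.sqrt ρ)⁻¹)
      = 1 / 4 * A * ε + A ^ 2 * Real.sqrt ε := by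
  have e : ∀ ρ ∈ Ioc 0 ε, (Real.sqrt ρ)⁻¹ = ρ ^ (-(1 / 2) : ℝ) := fun ρ hρ => by
    rw [Real.rpow_neg hρ.1.le, Real.sqrt_eq_rpow]
  have i0 : IntegrableOn (fun ρ : ℝ => ρ ^ (-(1 / 2) : ℝ)) (Ioc 0 ε) :=
    (intervalIntegrable_iff_integrableOn_Ioc_of_le hε.le).1
      (intervalIntegral.intervalIntegrable_rpow' (by norm_num))
  have i1 : IntegrableOn (fun ρ : ℝ => (Real.sqrt ρ)⁻¹) (Ioc 0 ε) :=
    i0.congr_fun (fun ρ hρ => (e ρ hρ).symm) measurableSet_Ioc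
  have i2 : IntegrableOn (fun _ : ℝ => 1 / 4 * A) (Ioc 0 ε) := integrableOn_const (by simp)
  refine ⟨i2.add (i1.const_mul _), ?_⟩
  have v : ∫ ρ in Ioc 0 ε, (Real.sqrt ρ)⁻¹ = 2 * Real.sqrt ε := by
    rw [setIntegral_congr_fun measurableSet_Ioc e, ← intervalIntegral.integral_of_le hε.le,
      integral_rpow (by left; norm_num)]
    norm_num
    rw [← Real.sqrt_eq_rpow]
    ring
  rw [integral_add i2 (i1.const_mul _), integral_const_mul (1 / 2 * A ^ 2), v]
  simp [hε.le]
  ring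

theorem integral_far_kernel {c ε : ℝ} (hε : 0 < ε) (hε1 : ε ≤ 1) :
    IntegrableOn (fun ρ : ℝ => c * ρ⁻¹) (Ioc ε 1) ∧
    ∫ ρ in Ioc ε 1, c * ρ⁻¹ = c * Real.log (1 / ε) := by
  have i0 : IntegrableOn (fun ρ : ℝ => ρ⁻¹) (Ioc ε 1) :=
    (intervalIntegrable_iff_integrableOn_Ioc_of_le hε1).1
      (intervalIntegral.intervalIntegrable_inv (fun x hx => by
        rw [uIcc_of_le hε1] at hx; exact ne_of_gt (lt_of_lt_of_le hε hx.1)) continuousOn_id)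
  refine ⟨i0.const_mul _, ?_⟩
  rw [integral_const_mul, ← intervalIntegral.integral_of_le hε1, integral_inv_of_pos hε one_pos]

/-- Allows plain multiples of `A` to be absorbed into `A √(log A)`. -/
theorem half_le_sqrt_log {A : ℝ} (hA : 2 ≤ A) : 1 / 2 ≤ Real.sqrt (Real.log A) := by
  apply Real.le_sqrt_of_sq_le
  have := Real.log_two_gt_d9
  have h := Real.log_le_log (by norm_num) hA
  linarith

/-- The singular integral `∫ H / |x - x₀|` is bounded by the `L²` norm of `H` up to a logarithm. -/
theorem integral_polar_log_bound {H : ℝ × ℝ → ℝ} (hH : Continuous H) {x₀ : ℝ × ℝ}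
    (h0 : ∀ p : ℝ × ℝ, 1 < |p.1| → H (polarAt x₀ p) = 0) {N A : ℝ} (hN : 0 ≤ N) (hA : 2 ≤ A)
    (h2 : ∫ x, H x ^ 2 ≤ N * A ^ 2) (h4 : ∫ x, H x ^ 4 ≤ N * A ^ 6) :
    ∫ p in polarDomain, H (polarAt x₀ p) ≤ (2 * N + 40) * A * Real.sqrt (Real.log A) := by
  have hA0 : 0 < A := by linarith
  obtain ⟨S, hS⟩ : ∃ S, S = Real.sqrt (Real.log A) := ⟨_, rfl⟩
  have hS2 : 1 / 2 ≤ S := hS ▸ half_le_sqrt_log hA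
  have hSS : S ^ 2 = Real.log A := by
    rw [hS, Real.sq_sqrt (Real.log_nonneg (by linarith))]
  -- This value balances `m ∫ H²`, of order `m A²`, against `log (1 / ε) / (4 m)`: both become
  -- multiples of `A S`.
  obtain ⟨m, hm⟩ : ∃ m, m = S / A := ⟨_, rfl⟩
  have hm0 : 0 < m := by rw [hm]; exact div_pos (by linarith) hA0
  -- Small enough that `A² √ε = 1` in the near part, and still polynomial in `A`, so that `log (1 /
  -- ε) = 4 log A`.
  obtain ⟨ε, hε⟩ : ∃ ε, ε = (A ^ 4)⁻¹ := ⟨_, rfl⟩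
  have hε0 : 0 < ε := by rw [hε]; positivity
  have hε1 : ε ≤ 1 := by rw [hε]; exact inv_le_one_of_one_le₀ (one_le_pow₀ (by linarith))
  obtain ⟨in1, in2⟩ := integral_near_kernel (A := A) hε0
  obtain ⟨if1, if2⟩ := integral_far_kernel (c := 1 / (4 * m)) hε0 hε1
  set k : ℝ → ℝ := fun ρ => (Ioc 0 ε).indicator
      (fun ρ : ℝ => 1 / 4 * A + 1 / 2 * A ^ 2 * (Real.sqrt ρ)⁻¹) ρ
    + (Ioc ε 1).indicator (fun ρ : ℝ => 1 / (4 * m) * ρ⁻¹) ρ with hk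
  have ia := (integrable_indicator_iff measurableSet_Ioc).2 in1
  have ib := (integrable_indicator_iff measurableSet_Ioc).2 if1
  have ik : IntegrableOn k (Ioi 0) := (ia.add ib).integrableOn
  have vk : ∫ ρ in Ioi 0, k ρ ≤ 2 + A * S := by
    have u1 : Ioc 0 ε ⊆ Ioi 0 := fun x hx => hx.1
    have u2 : Ioc ε 1 ⊆ Ioi 0 := fun x hx => lt_trans hε0 hx.1
    have e1 : ∫ ρ in Ioi 0, k ρ = (1 / 4 * A * ε + A ^ 2 * Real.sqrt ε)
        + 1 / (4 * m) * Real.log (1 / ε) := by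
      simp only [hk]
      rw [integral_add ia.integrableOn ib.integrableOn,
        setIntegral_indicator measurableSet_Ioc, setIntegral_indicator measurableSet_Ioc,
        inter_eq_right.2 u1, inter_eq_right.2 u2, in2, if2]
    have e2 : Real.sqrt ε = (A ^ 2)⁻¹ := by
      rw [hε, show A ^ 4 = (A ^ 2) ^ 2 by ring, Real.sqrt_inv, Real.sqrt_sq (by positivity)]
    have e3 : Real.log (1 / ε) = 4 * S ^ 2 := by
      rw [hε, one_div, inv_inv, Real.log_pow, hSS]; norm_num
    have e4 : 1 / (4 * m) * (4 * S ^ 2) = A * S := by rw [hm]; field_simp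
    have e5 : A ^ 2 * (A ^ 2)⁻¹ = 1 := by field_simp
    have e6 : A * ε ≤ 1 := by
      rw [hε]
      have : A * (A ^ 4)⁻¹ = (A ^ 3)⁻¹ := by field_simp
      rw [this]; exact inv_le_one_of_one_le₀ (one_le_pow₀ (by linarith))
    rw [e1, e2, e3, e4, e5]
    linarith
  have pw : ∀ p ∈ polarDomain, H (polarAt x₀ p)
      ≤ (1 / 4 * (A ^ 5)⁻¹ * (p.1 * H (polarAt x₀ p) ^ 4) + m * (p.1 * H (polarAt x₀ p) ^ 2))
        + k p.1 := by
    intro p hp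
    have hρ : (0 : ℝ) < p.1 := hp.1
    have t1 : 0 ≤ 1 / 4 * (A ^ 5)⁻¹ * (p.1 * H (polarAt x₀ p) ^ 4) := by positivity
    have t2 : 0 ≤ m * (p.1 * H (polarAt x₀ p) ^ 2) := by positivity
    simp only [hk]
    by_cases h1 : p.1 ≤ ε
    · rw [indicator_of_mem (show p.1 ∈ Ioc 0 ε from ⟨hρ, h1⟩),
        indicator_of_notMem (fun h : p.1 ∈ Ioc ε 1 => absurd h.1 (not_lt.2 h1))]
      have := near_young (H := H (polarAt x₀ p)) hA0 (Real.sqrt_pos.2 hρ)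
      rw [Real.sq_sqrt hρ.le] at this
      linarith
    · rw [indicator_of_notMem (fun h : p.1 ∈ Ioc 0 ε => h1 h.2)]
      by_cases h3 : p.1 ≤ 1
      · rw [indicator_of_mem (show p.1 ∈ Ioc ε 1 from ⟨not_le.1 h1, h3⟩)]
        have := far_young (H := H (polarAt x₀ p)) hm0 hρ
        linarith
      · rw [indicator_of_notMem (fun h : p.1 ∈ Ioc ε 1 => h3 h.2),
          h0 p (by rw [abs_of_pos hρ]; exact not_le.1 h3)]
        simp
  have cH : Continuous fun p => H (polarAt x₀ p) := hH.comp (continuous_polarAt x₀)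
  have j0 : IntegrableOn (fun p => H (polarAt x₀ p)) polarDomain :=
    integrableOn_polarDomain cH h0
  have j4 : IntegrableOn (fun p : ℝ × ℝ => p.1 * H (polarAt x₀ p) ^ 4) polarDomain :=
    integrableOn_polarDomain (continuous_fst.mul (cH.pow _)) fun p hp => by rw [h0 p hp]; simp
  have j2 : IntegrableOn (fun p : ℝ × ℝ => p.1 * H (polarAt x₀ p) ^ 2) polarDomain :=
    integrableOn_polarDomain (continuous_fst.mul (cH.pow _)) fun p hp => by rw [h0 p hp]; simp
  have jk : IntegrableOn (fun p : ℝ × ℝ => k p.1) polarDomain := by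
    unfold polarDomain
    rw [Measure.volume_eq_prod, IntegrableOn, ← Measure.prod_restrict]
    exact ik.comp_fst _
  have vk2 : ∫ p in polarDomain, k p.1 = 2 * Real.pi * ∫ ρ in Ioi 0, k ρ := by
    unfold polarDomain at jk ⊢
    rw [Measure.volume_eq_prod] at jk ⊢
    rw [setIntegral_prod _ jk]
    rw [← integral_const_mul]
    congr 1; ext ρ
    simp only [integral_const]
    simp [Real.pi_pos.le]
    left; ring
  have j42 : IntegrableOn (fun p : ℝ × ℝ => 1 / 4 * (A ^ 5)⁻¹ * (p.1 * H (polarAt x₀ p) ^ 4)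
      + m * (p.1 * H (polarAt x₀ p) ^ 2)) polarDomain := (j4.const_mul _).add (j2.const_mul _)
  -- The factor `ρ` in the majorant is the polar Jacobian, so its two `H` terms integrate to the
  -- `L⁴` and `L²` norms in the plane.
  have main := setIntegral_mono_on j0 (j42.add jk) measurableSet_polarDomain pw
  simp only [Pi.add_apply] at main
  rw [integral_add j42 jk, integral_add (j4.const_mul _) (j2.const_mul _), integral_const_mul,
    integral_const_mul, integral_polarDomain (fun x => H x ^ 4) x₀,
    integral_polarDomain (fun x => H x ^ 2) x₀, vk2] at main
  have m1 : 1 / 4 * (A ^ 5)⁻¹ * ∫ x, H x ^ 4 ≤ 1 / 4 * N * A := by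
    calc _ ≤ 1 / 4 * (A ^ 5)⁻¹ * (N * A ^ 6) := by gcongr
      _ = _ := by field_simp
  have m2 : m * ∫ x, H x ^ 2 ≤ N * A * S := by
    calc _ ≤ m * (N * A ^ 2) := by gcongr
      _ = _ := by rw [hm]; field_simp
  have m3 : 2 * Real.pi * ∫ ρ in Ioi 0, k ρ ≤ 8 * (2 + A * S) := by
    calc _ ≤ 2 * Real.pi * (2 + A * S) := by gcongr
      _ ≤ _ := by
        have : 0 ≤ 2 + A * S := by positivity
        nlinarith [Real.pi_le_four]
  rw [← hS]
  have hAS : A ≤ 2 * (A * S) := by nlinarith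
  nlinarith [mul_le_mul_of_nonneg_left hAS hN]

/-! ### The velocity bound at unit scale -/

theorem exists_square_cutoff {a b : ℝ} (hab : a < b) :
    ∃ φ : ℝ × ℝ → ℝ, ContDiff ℝ ∞ φ ∧ HasCompactSupport φ ∧ tsupport φ ⊆ square b ∧
      (∀ x ∈ square a, φ x = 1) ∧ ∀ x, φ x ∈ Icc (0 : ℝ) 1 := by
  have hO : IsOpen (Ioo (1 - b) (1 + b) ×ˢ Ioo (-b) b : Set (ℝ × ℝ)) := isOpen_Ioo.prod isOpen_Ioo
  obtain ⟨φ, h1, h2, h3, h4, h5⟩ := exists_cutoff (isCompact_square a) hO (by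
    rintro ⟨r, z⟩ ⟨⟨a3, a4⟩, a5, a6⟩
    simp only at a3 a4 a5 a6
    refine ⟨⟨?_, ?_⟩, ?_, ?_⟩ <;> simp only <;> linarith)
  refine ⟨φ, h1, h2, fun q hq => ?_, fun q hq => h4.self_of_nhdsSet q hq, h5⟩
  obtain ⟨⟨a3, a4⟩, a5, a6⟩ := h3 hq
  exact ⟨⟨a3.le, a4.le⟩, a5.le, a6.le⟩

/-- A planar field `(f, h)` with `div (r (f, h)) = 0` and `curl (f, h) = - r Ω` on a square. -/
structure DivCurl (a : ℝ) (f h Ω : ℝ × ℝ → ℝ) : Prop where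
  smooth_f : ContDiff ℝ ∞ f
  smooth_h : ContDiff ℝ ∞ h
  continuous_Ω : Continuous Ω
  div_free : ∀ x ∈ square a, dirD (1, 0) f x + f x / x.1 + dirD (0, 1) h x = 0
  vorticity : ∀ x ∈ square a, x.1 * Ω x = dirD (0, 1) f x - dirD (1, 0) h x

/-- Size of the divergence and the curl of a field. -/
def divCurl (P Q : ℝ × ℝ → ℝ) (x : ℝ × ℝ) : ℝ :=
  |dirD (1, 0) P x + dirD (0, 1) Q x| + |dirD (1, 0) Q x - dirD (0, 1) P x|

theorem continuous_divCurl {P Q : ℝ × ℝ → ℝ} (hP : ContDiff ℝ ∞ P) (hQ : ContDiff ℝ ∞ Q) :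
    Continuous (divCurl P Q) := by
  have c : ∀ {u : ℝ × ℝ → ℝ} (e : ℝ × ℝ), ContDiff ℝ ∞ u → Continuous (dirD e u) :=
    fun e hu => (contDiff_dirD hu).continuous
  exact ((c _ hP).add (c _ hQ)).abs.add ((c _ hQ).sub (c _ hP)).abs

/-- By the product rule, derivatives falling on the cutoff leave `f` and `h` undifferentiated; what
remains of the divergence is `-φ f / r` and of the curl `-φ r Ω`. -/
theorem exists_divCurl_bound {φ : ℝ × ℝ → ℝ} (hφ : ContDiff ℝ ∞ φ) (hc : HasCompactSupport φ)
    {a : ℝ} (ha : a ≤ 1 / 2) (hs : tsupport φ ⊆ square a) (h01 : ∀ x, φ x ∈ Icc (0 : ℝ) 1) :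
    ∃ C : ℝ, 0 ≤ C ∧ ∀ f h Ω : ℝ × ℝ → ℝ, DivCurl a f h Ω →
      (∀ x ∉ square a, divCurl (fun y => φ y * f y) (fun y => φ y * h y) x = 0) ∧
      (∀ x ∈ square a, divCurl (fun y => φ y * f y) (fun y => φ y * h y) x
        ≤ C * (|f x| + |h x| + |Ω x|)) := by
  obtain ⟨M₁, hM₁⟩ := (hasCompactSupport_dirD (e := ((1, 0) : ℝ × ℝ))
    hc).exists_bound_of_continuous (contDiff_dirD hφ).continuous
  obtain ⟨M₂, hM₂⟩ := (hasCompactSupport_dirD (e := ((0, 1) : ℝ × ℝ))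
    hc).exists_bound_of_continuous (contDiff_dirD hφ).continuous
  have n1 : 0 ≤ M₁ := (norm_nonneg _).trans (hM₁ 0)
  have n2 : 0 ≤ M₂ := (norm_nonneg _).trans (hM₂ 0)
  refine ⟨2 + M₁ + M₂, by positivity, fun f h Ω H => ⟨fun x hx => ?_, fun x hx => ?_⟩⟩
  · have hz : ∀ (e : ℝ × ℝ) (u : ℝ × ℝ → ℝ), dirD e (fun y => φ y * u y) x = 0 := by
      intro e u
      refine image_eq_zero_of_notMem_tsupport fun h => hx (hs ?_)
      exact (tsupport_dirD_subset _).trans (tsupport_mul_subset_left (f := φ) (g := u)) h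
    simp [divCurl, hz]
  · have dφ := differentiable_of_smooth hφ
    have df := differentiable_of_smooth H.smooth_f
    have dh := differentiable_of_smooth H.smooth_h
    have e1 := H.div_free x hx
    have e2 := H.vorticity x hx
    have hr1 : 1 / 2 ≤ x.1 := by linarith [hx.1.1]
    have hr2 : x.1 ≤ 2 := by linarith [hx.1.2]
    obtain ⟨p0, p1⟩ := h01 x
    have m1 : |dirD (1, 0) φ x| ≤ M₁ := hM₁ x
    have m2 : |dirD (0, 1) φ x| ≤ M₂ := hM₂ x
    unfold divCurl
    rw [dirD_mul (dφ x) (df x), dirD_mul (dφ x) (dh x), dirD_mul (dφ x) (df x),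
      dirD_mul (dφ x) (dh x)]
    have g1 : dirD (1, 0) φ x * f x + φ x * dirD (1, 0) f x
        + (dirD (0, 1) φ x * h x + φ x * dirD (0, 1) h x)
        = dirD (1, 0) φ x * f x + dirD (0, 1) φ x * h x + (-(φ x / x.1)) * f x := by
      linear_combination φ x * e1
    have g2 : dirD (1, 0) φ x * h x + φ x * dirD (1, 0) h x
        - (dirD (0, 1) φ x * f x + φ x * dirD (0, 1) f x)
        = dirD (1, 0) φ x * h x + (-dirD (0, 1) φ x) * f x + (-(φ x * x.1)) * Ω x := by
      linear_combination φ x * e2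
    have q1 : |(-(φ x / x.1))| ≤ 2 := by
      rw [abs_neg, abs_of_nonneg (by positivity), div_le_iff₀ (by linarith)]; linarith
    have q2 : |(-(φ x * x.1))| ≤ 2 := by
      rw [abs_neg, abs_of_nonneg (by positivity)]; nlinarith
    rw [g1, g2]
    have t : ∀ a b c : ℝ, |a + b + c| ≤ |a| + |b| + |c| := fun a b c => abs_add_three a b c
    have r1 := t (dirD (1, 0) φ x * f x) (dirD (0, 1) φ x * h x) ((-(φ x / x.1)) * f x)
    have r2 := t (dirD (1, 0) φ x * h x) ((-dirD (0, 1) φ x) * f x) ((-(φ x * x.1)) * Ω x)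
    rw [abs_mul, abs_mul, abs_mul] at r1 r2
    rw [abs_neg (dirD _ _ _)] at r2
    have f0 := abs_nonneg (f x)
    have h0 := abs_nonneg (h x)
    have o0 := abs_nonneg (Ω x)
    have s1 := mul_le_mul_of_nonneg_right m1 f0
    have s2 := mul_le_mul_of_nonneg_right m2 h0
    have s3 := mul_le_mul_of_nonneg_right q1 f0
    have s4 := mul_le_mul_of_nonneg_right m1 h0
    have s5 := mul_le_mul_of_nonneg_right m2 f0
    have s6 := mul_le_mul_of_nonneg_right q2 o0
    have w1 := mul_nonneg n1 o0
    have w2 := mul_nonneg n2 o0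
    linarith

theorem integrableOn_square {u : ℝ × ℝ → ℝ} (hu : Continuous u) (a : ℝ) :
    IntegrableOn u (square a) :=
  hu.continuousOn.integrableOn_compact (isCompact_square a)

theorem integral_pow_le_square {H u : ℝ × ℝ → ℝ} (hH : Continuous H) (hu : Continuous u) {a : ℝ}
    {n : ℕ} (hn : n ≠ 0) (h0 : ∀ x ∉ square a, H x = 0)
    (h1 : ∀ x ∈ square a, H x ^ n ≤ u x) :
    ∫ x, H x ^ n ≤ ∫ x in square a, u x := by
  rw [← setIntegral_eq_integral_of_forall_compl_eq_zero (s := square a) fun x hx => by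
    rw [h0 x hx, zero_pow hn]]
  exact setIntegral_mono_on (integrableOn_square (hH.pow n) a) (integrableOn_square hu a)
    (isCompact_square a).measurableSet h1

theorem sq_sum_three (a b c : ℝ) : (|a| + |b| + |c|) ^ 2 ≤ 3 * (a ^ 2 + b ^ 2 + c ^ 2) := by
  nlinarith [sq_nonneg (|a| - |b|), sq_nonneg (|a| - |c|), sq_nonneg (|b| - |c|), sq_abs a,
    sq_abs b, sq_abs c]

theorem integral_divCurl_pow_le {φ f h Ω : ℝ × ℝ → ℝ} (hφ : ContDiff ℝ ∞ φ) {a C : ℝ}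
    (H : DivCurl a f h Ω)
    (h0 : ∀ x ∉ square a, divCurl (fun y => φ y * f y) (fun y => φ y * h y) x = 0)
    (h1 : ∀ x ∈ square a, divCurl (fun y => φ y * f y) (fun y => φ y * h y) x
        ≤ C * (|f x| + |h x| + |Ω x|)) :
    (∫ x, divCurl (fun y => φ y * f y) (fun y => φ y * h y) x ^ 2
      ≤ 3 * C ^ 2 * ((∫ x in square a, f x ^ 2) + (∫ x in square a, h x ^ 2)
        + ∫ x in square a, Ω x ^ 2)) ∧
    (∫ x, divCurl (fun y => φ y * f y) (fun y => φ y * h y) x ^ 4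
      ≤ 27 * C ^ 4 * ((∫ x in square a, f x ^ 4) + (∫ x in square a, h x ^ 4)
        + ∫ x in square a, Ω x ^ 4)) := by
  have cf := H.smooth_f.continuous
  have ch := H.smooth_h.continuous
  have cΩ := H.continuous_Ω
  have cD := continuous_divCurl (hφ.mul H.smooth_f) (hφ.mul H.smooth_h)
  have nn : ∀ x, 0 ≤ divCurl (fun y => φ y * f y) (fun y => φ y * h y) x := fun x => by
    unfold divCurl; positivity
  have key : ∀ x ∈ square a, divCurl (fun y => φ y * f y) (fun y => φ y * h y) x ^ 2
      ≤ 3 * C ^ 2 * (f x ^ 2 + h x ^ 2 + Ω x ^ 2) := fun x hx => by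
    refine (pow_le_pow_left₀ (nn x) (h1 x hx) 2).trans ?_
    rw [mul_pow]
    nlinarith [mul_le_mul_of_nonneg_left (sq_sum_three (f x) (h x) (Ω x)) (sq_nonneg C)]
  have i : ∀ (n : ℕ) {u : ℝ × ℝ → ℝ}, Continuous u → IntegrableOn (fun x => u x ^ n) (square a) :=
    fun n u hu => integrableOn_square (hu.pow n) a
  have sum : ∀ n : ℕ, ∫ x in square a, (f x ^ n + h x ^ n + Ω x ^ n)
      = (∫ x in square a, f x ^ n) + (∫ x in square a, h x ^ n) + ∫ x in square a, Ω x ^ n := by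
    intro n
    have j : IntegrableOn (fun x => f x ^ n + h x ^ n) (square a) := (i n cf).add (i n ch)
    rw [integral_add j (i n cΩ), integral_add (i n cf) (i n ch)]
  constructor
  · rw [← sum, ← integral_const_mul]
    exact integral_pow_le_square cD (by fun_prop) two_ne_zero h0 key
  · rw [← sum, ← integral_const_mul]
    refine integral_pow_le_square cD (by fun_prop) four_ne_zero h0 fun x hx => ?_
    have := pow_le_pow_left₀ (sq_nonneg _) (key x hx) 2
    have e : (f x ^ 2 + h x ^ 2 + Ω x ^ 2) ^ 2 ≤ 3 * (f x ^ 4 + h x ^ 4 + Ω x ^ 4) := by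
      nlinarith [sq_nonneg (f x ^ 2 - h x ^ 2), sq_nonneg (f x ^ 2 - Ω x ^ 2),
        sq_nonneg (h x ^ 2 - Ω x ^ 2)]
    have e2 := mul_le_mul_of_nonneg_left e (show 0 ≤ 9 * (C ^ 2) ^ 2 by positivity)
    nlinarith

/-- Grouping the representation formula by `cos θ` and `sin θ` exhibits exactly the divergence and
the curl. The factor `1 / (2π)` is estimated by 1. -/
theorem abs_le_integral_divCurl {P Q : ℝ × ℝ → ℝ} (hP : ContDiff ℝ ∞ P) (hQ : ContDiff ℝ ∞ Q)
    (kP : HasCompactSupport P) (kQ : HasCompactSupport Q) (x₀ : ℝ × ℝ) {M : ℝ}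
    (h0 : ∀ p : ℝ × ℝ, M < |p.1| → divCurl P Q (polarAt x₀ p) = 0) :
    |P x₀| ≤ ∫ p in polarDomain, divCurl P Q (polarAt x₀ p) := by
  have rep := polar_representation hP hQ kP kQ x₀
  have cD : Continuous fun p => divCurl P Q (polarAt x₀ p) :=
    (continuous_divCurl hP hQ).comp (continuous_polarAt x₀)
  have h1 : |-(2 * Real.pi * P x₀)| ≤ ∫ p in polarDomain, divCurl P Q (polarAt x₀ p) := by
    rw [← rep, ← Real.norm_eq_abs]
    refine norm_integral_le_of_norm_le (integrableOn_polarDomain cD h0)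
      (Eventually.of_forall fun p => ?_)
    have e : Real.cos p.2 * dirD (1, 0) P (polarAt x₀ p)
        + Real.sin p.2 * dirD (0, 1) P (polarAt x₀ p)
        + (-Real.sin p.2 * dirD (1, 0) Q (polarAt x₀ p)
          + Real.cos p.2 * dirD (0, 1) Q (polarAt x₀ p))
        = Real.cos p.2 * (dirD (1, 0) P (polarAt x₀ p) + dirD (0, 1) Q (polarAt x₀ p))
          + (-Real.sin p.2) * (dirD (1, 0) Q (polarAt x₀ p) - dirD (0, 1) P (polarAt x₀ p)) := by
      ring
    rw [e, Real.norm_eq_abs]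
    refine (abs_add_le _ _).trans ?_
    rw [abs_mul, abs_mul, abs_neg]
    exact add_le_add (mul_le_of_le_one_left (abs_nonneg _) (Real.abs_cos_le_one _))
      (mul_le_of_le_one_left (abs_nonneg _) (Real.abs_sin_le_one _))
  rw [abs_neg, abs_mul, abs_of_pos (by positivity : (0 : ℝ) < 2 * Real.pi)] at h1
  refine le_trans ?_ h1
  exact le_mul_of_one_le_left (abs_nonneg _) (by linarith [Real.pi_gt_three])

/-- A quarter turn of the field exchanges divergence and curl up to sign, so a bound on the first
component also serves for the second. -/
theorem divCurl_swap (P Q : ℝ × ℝ → ℝ) : divCurl Q (fun x => -P x) = divCurl P Q := by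
  ext x
  have : ∀ e : ℝ × ℝ, dirD e (fun x => -P x) x = -dirD e P x := fun e => by simp [dirD]
  simp only [divCurl, this]
  rw [add_comm, ← sub_eq_add_neg]
  congr 1
  rw [← abs_neg]; congr 1; ring

theorem polarAt_notMem_square {p : ℝ × ℝ} (hp : 1 < |p.1|) {a : ℝ} (ha : a ≤ 1 / 2) :
    polarAt (1, 0) p ∉ square a := by
  rintro ⟨⟨h1, h2⟩, h3, h4⟩
  simp only [polarAt] at h1 h2 h3 h4
  have e := Real.sin_sq_add_cos_sq p.2
  have hp2 : 1 < p.1 ^ 2 := by rw [← sq_abs]; nlinarith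
  have a1 : (p.1 * Real.cos p.2) ^ 2 ≤ (1 / 2) ^ 2 := sq_le_sq' (by linarith) (by linarith)
  have a2 : (p.1 * Real.sin p.2) ^ 2 ≤ (1 / 2) ^ 2 := sq_le_sq' (by linarith) (by linarith)
  nlinarith

/-- Interior `L⁴` bound for a planar field with `L²` velocity and vorticity. -/
theorem exists_divCurl_L4 (c : ℝ) (hc : 1 ≤ c) : ∃ C : ℝ, 0 ≤ C ∧ ∀ (f h Ω : ℝ × ℝ → ℝ) (A : ℝ),
    DivCurl (1 / 5) f h Ω → 1 ≤ A → ∫ x in square (1 / 5), f x ^ 2 ≤ A →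
    ∫ x in square (1 / 5), h x ^ 2 ≤ A → ∫ x in square (1 / 5), Ω x ^ 2 ≤ c * A ^ 2 →
    ∫ x in square (1 / 10), f x ^ 4 ≤ C * A ^ 6 ∧ ∫ x in square (1 / 10), h x ^ 4 ≤ C * A ^ 6 := by
  obtain ⟨φ, hφ, kφ, hs, h1, h01⟩ := exists_square_cutoff (a := 1 / 10) (b := 1 / 5) (by norm_num)
  obtain ⟨k, hk, hb⟩ := exists_divCurl_bound hφ kφ (by norm_num) hs h01
  obtain ⟨L, hL, lad⟩ := exists_ladyzhenskaya
  refine ⟨L * (3 * k ^ 2 * (2 + c)), by positivity, fun f h Ω A H hA hf hh hΩ => ?_⟩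
  obtain ⟨b0, b1⟩ := hb f h Ω H
  have hI := (integral_divCurl_pow_le hφ H b0 b1).1
  have sP := hφ.mul H.smooth_f
  have sQ := hφ.mul H.smooth_h
  have kP : HasCompactSupport fun x => φ x * f x := kφ.mul_right
  have kQ : HasCompactSupport fun x => φ x * h x := kφ.mul_right
  have hAA : A ≤ A ^ 2 := by nlinarith
  -- The full gradient of the localized field is controlled by its divergence and curl, as
  -- Ladyzhenskaya's inequality on the slice requires.
  have hG := integral_grad_eq_div_curl sP sQ kP kQ
  have c1 : ∀ {u : ℝ × ℝ → ℝ} (e : ℝ × ℝ), ContDiff ℝ ∞ u → Continuous (dirD e u) :=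
    fun e hu => (contDiff_dirD hu).continuous
  have hD : ∫ x, ((dirD (1, 0) (fun x => φ x * f x) x + dirD (0, 1) (fun x => φ x * h x) x) ^ 2
      + (dirD (1, 0) (fun x => φ x * h x) x - dirD (0, 1) (fun x => φ x * f x) x) ^ 2)
      ≤ 3 * k ^ 2 * (2 + c) * A ^ 2 := by
    have hcs : HasCompactSupport (divCurl (fun x => φ x * f x) (fun x => φ x * h x)) :=
      HasCompactSupport.intro (isCompact_square _) b0
    refine le_trans (integral_mono ?_ ?_ fun x => ?_) (hI.trans ?_)
    · refine Continuous.integrable_of_hasCompactSupport ((((c1 _ sP).add (c1 _ sQ)).pow 2).add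
        (((c1 _ sQ).sub (c1 _ sP)).pow 2)) ?_
      have d := fun (u : ℝ × ℝ → ℝ) (hu : HasCompactSupport u) (e : ℝ × ℝ) =>
        hasCompactSupport_dirD (e := e) hu
      exact (hasCompactSupport_pow ((d _ kP _).add (d _ kQ _)) two_ne_zero).add
        (hasCompactSupport_pow ((d _ kQ _).sub (d _ kP _)) two_ne_zero)
    · exact ((continuous_divCurl sP sQ).pow 2).integrable_of_hasCompactSupport
        (hasCompactSupport_pow hcs two_ne_zero)
    · simp only [divCurl]
      rw [← sq_abs (_ + _), ← sq_abs (_ - _)]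
      nlinarith [mul_nonneg (abs_nonneg (dirD (1, 0) (fun x => φ x * f x) x
        + dirD (0, 1) (fun x => φ x * h x) x)) (abs_nonneg (dirD (1, 0) (fun x => φ x * h x) x
        - dirD (0, 1) (fun x => φ x * f x) x))]
    · rw [mul_assoc (3 * k ^ 2)]
      exact mul_le_mul_of_nonneg_left (by linarith) (by positivity)
  have g1 : 0 ≤ ∫ x, (dirD (1, 0) (fun x => φ x * f x) x ^ 2
      + dirD (0, 1) (fun x => φ x * f x) x ^ 2) := integral_nonneg fun x => by positivity
  have g2 : 0 ≤ ∫ x, (dirD (1, 0) (fun x => φ x * h x) x ^ 2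
      + dirD (0, 1) (fun x => φ x * h x) x ^ 2) := integral_nonneg fun x => by positivity
  have main : ∀ u : ℝ × ℝ → ℝ, ContDiff ℝ ∞ u → ∫ x in square (1 / 5), u x ^ 2 ≤ A →
      ∫ x, (dirD (1, 0) (fun x => φ x * u x) x ^ 2 + dirD (0, 1) (fun x => φ x * u x) x ^ 2)
        ≤ 3 * k ^ 2 * (2 + c) * A ^ 2 →
      ∫ x in square (1 / 10), u x ^ 4 ≤ L * (3 * k ^ 2 * (2 + c)) * A ^ 6 := by
    intro u hu hu2 hug
    have cu := hu.continuous
    have cφ := hφ.continuous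
    have ku : HasCompactSupport fun x => φ x * u x := kφ.mul_right
    have hl := lad (fun x => φ x * u x) ((hφ.mul hu).of_le (by simp)) ku
    have z : ∀ x ∉ square (1 / 5), φ x * u x = 0 := fun x hx => by
      rw [image_eq_zero_of_notMem_tsupport fun h => hx (hs h), zero_mul]
    have e2 : ∫ x, (φ x * u x) ^ 2 ≤ ∫ x in square (1 / 5), u x ^ 2 :=
      integral_pow_le_square (H := fun x => φ x * u x) (by fun_prop) (by fun_prop) two_ne_zero z
        fun x _ => by
          rw [mul_pow]
          exact mul_le_of_le_one_left (sq_nonneg _) (pow_le_one₀ (h01 x).1 (h01 x).2)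
    have e4 : ∫ x in square (1 / 10), u x ^ 4 ≤ ∫ x, (φ x * u x) ^ 4 := by
      have : ∫ x in square (1 / 10), u x ^ 4 = ∫ x in square (1 / 10), (φ x * u x) ^ 4 :=
        setIntegral_congr_fun (isCompact_square _).measurableSet fun x hx => by
          simp only [h1 x hx, one_mul]
      rw [this]
      exact setIntegral_le_integral (Continuous.integrable_of_hasCompactSupport (by fun_prop)
        (hasCompactSupport_pow ku four_ne_zero)) (Eventually.of_forall fun x => by positivity)
    have gu : 0 ≤ ∫ x, (dirD (1, 0) (fun x => φ x * u x) x ^ 2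
      + dirD (0, 1) (fun x => φ x * u x) x ^ 2) := integral_nonneg fun x => by positivity
    -- The argument yields `A³`; the weaker `A⁶` matches the bound for `Ω`.
    have hA3 : A ^ 3 ≤ A ^ 6 := le_of_pow_le hA (by norm_num)
    calc _ ≤ _ := e4
      _ ≤ _ := hl
      _ ≤ L * A * (3 * k ^ 2 * (2 + c) * A ^ 2) := by
          refine mul_le_mul (mul_le_mul_of_nonneg_left (e2.trans hu2) (by linarith)) hug gu ?_
          positivity
      _ = L * (3 * k ^ 2 * (2 + c)) * A ^ 3 := by ring
      _ ≤ _ := mul_le_mul_of_nonneg_left hA3 (by positivity)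
  exact ⟨main f H.smooth_f hf (by linarith), main h H.smooth_h hh (by linarith)⟩

/-- The velocity bound at unit distance from the axis. -/
theorem exists_unit_velocity_bound : ∃ C : ℝ, 0 ≤ C ∧ ∀ (f h Γ Ω F : Z → ℝ) (A : ℝ),
    UnitFlow f h Γ Ω F A → 2 ≤ A →
    |f (0, 1, 0)| + |h (0, 1, 0)| ≤ C * A * Real.sqrt (Real.log A) := by
  obtain ⟨c, hc, vort⟩ := exists_vorticity_bounds
  obtain ⟨c₄, hc₄, L4⟩ := exists_divCurl_L4 c hc
  obtain ⟨φ, hφ, kφ, hs, h1, h01⟩ := exists_square_cutoff (a := 1 / 20) (b := 1 / 10) (by norm_num)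
  obtain ⟨k, hk, hb⟩ := exists_divCurl_bound hφ kφ (by norm_num) hs h01
  obtain ⟨N, hN⟩ : ∃ N, N = 3 * k ^ 2 * (2 + c) + 27 * k ^ 4 * (2 * c₄ + c) := ⟨_, rfl⟩
  have hN0 : 0 ≤ N := by rw [hN]; positivity
  refine ⟨2 * (2 * N + 40), by positivity, fun f h Γ Ω F A H hA => ?_⟩
  obtain ⟨v2, v4⟩ := vort f h Γ Ω F A H
  have hA1 := H.one_le
  have sub5 : square (1 / 5) ⊆ square (1 / 2) := square_mono (by norm_num)
  have sub10 : square (1 / 10) ⊆ square (1 / 5) := square_mono (by norm_num)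
  have D5 : DivCurl (1 / 5) (fun x => f (0, x)) (fun x => h (0, x)) (fun x => Ω (0, x)) := by
    refine ⟨H.smooth_f.comp (contDiff_prodMk_right 0), H.smooth_h.comp (contDiff_prodMk_right 0),
      H.smooth_Ω.continuous.comp (Continuous.prodMk_right 0), fun x hx => ?_, fun x hx => ?_⟩
    · have := H.div_free (0, x) ⟨⟨by norm_num, le_rfl⟩, sub5 hx⟩
      rw [dirD_slice (differentiable_of_smooth H.smooth_f),
        dirD_slice (differentiable_of_smooth H.smooth_h)]
      exact this
    · have := H.vorticity (0, x) ⟨⟨by norm_num, le_rfl⟩, sub5 hx⟩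
      rw [dirD_slice (differentiable_of_smooth H.smooth_f),
        dirD_slice (differentiable_of_smooth H.smooth_h)]
      exact this
  have D10 : DivCurl (1 / 10) (fun x => f (0, x)) (fun x => h (0, x)) (fun x => Ω (0, x)) :=
    ⟨D5.smooth_f, D5.smooth_h, D5.continuous_Ω, fun x hx => D5.div_free x (sub10 hx),
      fun x hx => D5.vorticity x (sub10 hx)⟩
  have t0 : (0 : ℝ) ∈ Icc (-(1 / 2) : ℝ) 0 := ⟨by norm_num, le_rfl⟩
  have mono : ∀ {u : ℝ × ℝ → ℝ} {a b : ℝ}, a ≤ b → Continuous u → (∀ x, 0 ≤ u x) →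
      ∫ x in square a, u x ≤ ∫ x in square b, u x := fun hab hu h0 =>
    setIntegral_mono_set (integrableOn_square hu _) (Eventually.of_forall h0)
      (square_mono hab).eventuallyLE
  have cf := D5.smooth_f.continuous
  have ch := D5.smooth_h.continuous
  have cΩ := D5.continuous_Ω
  have f5 : ∫ x in square (1 / 5), f (0, x) ^ 2 ≤ A :=
    (mono (by norm_num) (cf.pow 2) fun x => sq_nonneg _).trans (H.energy_f 0 t0)
  have h5 : ∫ x in square (1 / 5), h (0, x) ^ 2 ≤ A :=
    (mono (by norm_num) (ch.pow 2) fun x => sq_nonneg _).trans (H.energy_h 0 t0)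
  obtain ⟨f4, h4⟩ := L4 _ _ _ A D5 hA1 f5 h5 v2
  have f10 : ∫ x in square (1 / 10), f (0, x) ^ 2 ≤ A :=
    (mono (by norm_num) (cf.pow 2) fun x => sq_nonneg _).trans f5
  have h10 : ∫ x in square (1 / 10), h (0, x) ^ 2 ≤ A :=
    (mono (by norm_num) (ch.pow 2) fun x => sq_nonneg _).trans h5
  have o2 : ∫ x in square (1 / 10), Ω (0, x) ^ 2 ≤ c * A ^ 2 :=
    (mono (by norm_num) (cΩ.pow 2) fun x => sq_nonneg _).trans v2
  have o4 : ∫ x in square (1 / 10), Ω (0, x) ^ 4 ≤ c * A ^ 6 :=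
    (mono (by norm_num) (cΩ.pow 4) fun x => Even.pow_nonneg (by decide) _).trans v4
  obtain ⟨b0, b1⟩ := hb _ _ _ D10
  obtain ⟨I2, I4⟩ := integral_divCurl_pow_le hφ D10 b0 b1
  have sP := hφ.mul D5.smooth_f
  have sQ := hφ.mul D5.smooth_h
  have kP : HasCompactSupport fun x => φ x * f (0, x) := kφ.mul_right
  have kQ : HasCompactSupport fun x => φ x * h (0, x) := kφ.mul_right
  have z : ∀ p : ℝ × ℝ, 1 < |p.1| → divCurl (fun x => φ x * f (0, x)) (fun x => φ x * h (0, x))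
      (polarAt (1, 0) p) = 0 := fun p hp => b0 _ (polarAt_notMem_square hp (by norm_num))
  have hAA : A ≤ A ^ 2 := by nlinarith
  have bound := integral_polar_log_bound (continuous_divCurl sP sQ) z hN0 hA (by
      refine I2.trans ?_
      have : 3 * k ^ 2 * (2 + c) ≤ N := by
        have : 0 ≤ 27 * k ^ 4 * (2 * c₄ + c) := by positivity
        linarith
      calc _ ≤ 3 * k ^ 2 * ((2 + c) * A ^ 2) :=
            mul_le_mul_of_nonneg_left (by linarith) (by positivity)
        _ = 3 * k ^ 2 * (2 + c) * A ^ 2 := by ring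
        _ ≤ _ := mul_le_mul_of_nonneg_right this (sq_nonneg A)) (by
      refine I4.trans ?_
      have : 27 * k ^ 4 * (2 * c₄ + c) ≤ N := by
        have : 0 ≤ 3 * k ^ 2 * (2 + c) := by positivity
        linarith
      calc _ ≤ 27 * k ^ 4 * ((2 * c₄ + c) * A ^ 6) :=
            mul_le_mul_of_nonneg_left (by linarith) (by positivity)
        _ = 27 * k ^ 4 * (2 * c₄ + c) * A ^ 6 := by ring
        _ ≤ _ := mul_le_mul_of_nonneg_right this (by positivity))
  have B1 := abs_le_integral_divCurl sP sQ kP kQ (1, 0) z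
  have kP' : HasCompactSupport fun x => -(φ x * f (0, x)) := kP.neg
  -- The second component is read off from the field turned by a right angle.
  have B2 := abs_le_integral_divCurl sQ sP.neg kQ kP' (1, 0) (M := 1) (by
    rw [divCurl_swap]; exact z)
  rw [divCurl_swap] at B2
  have p1 : φ (1, 0) = 1 := h1 _ ⟨⟨by norm_num, by norm_num⟩, by norm_num, by norm_num⟩
  rw [p1, one_mul] at B1 B2
  linarith

/-! ### The axially symmetric system in the variables `(s, r, z)` -/

/-- The axially symmetric Navier–Stokes system on an open set away from the axis: `f, g, h` are the
radial, angular and vertical velocities and `P` is the pressure. -/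
structure AxiSystem (O : Set Z) (f g h P : Z → ℝ) : Prop where
  isOpen : IsOpen O
  radius_pos : ∀ q ∈ O, 0 < q.2.1
  smooth_f : ContDiffOn ℝ ∞ f O
  smooth_g : ContDiffOn ℝ ∞ g O
  smooth_h : ContDiffOn ℝ ∞ h O
  smooth_P : ContDiffOn ℝ ∞ P O
  div_free : ∀ q ∈ O, dR f q + f q * (q.2.1)⁻¹ + dZ h q = 0
  eq_f : ∀ q ∈ O, dS f q + f q * dR f q + h q * dZ f q - g q ^ 2 * (q.2.1)⁻¹ + dR P q
    - dR (dR f) q - dZ (dZ f) q - dR f q * (q.2.1)⁻¹ + f q * ((q.2.1)⁻¹) ^ 2 = 0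
  eq_g : ∀ q ∈ O, dS g q + f q * dR g q + h q * dZ g q + f q * g q * (q.2.1)⁻¹
    - dR (dR g) q - dZ (dZ g) q - dR g q * (q.2.1)⁻¹ + g q * ((q.2.1)⁻¹) ^ 2 = 0
  eq_h : ∀ q ∈ O, dS h q + f q * dR h q + h q * dZ h q + dZ P q
    - dR (dR h) q - dZ (dZ h) q - dR h q * (q.2.1)⁻¹ = 0

theorem dirD_eqOn {E : Type*} [NormedAddCommGroup E] [NormedSpace ℝ E] {O : Set E} (hO : IsOpen O)
    {u v : E → ℝ} (h : EqOn u v O) (e : E) : EqOn (dirD e u) (dirD e v) O := fun _ hq =>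
  dirD_congr (eventuallyEq_of_mem (hO.mem_nhds hq) h)

theorem differentiableAt_of_smoothOn {E : Type*} [NormedAddCommGroup E] [NormedSpace ℝ E]
    {O : Set E} (hO : IsOpen O) {u : E → ℝ} (hu : ContDiffOn ℝ ∞ u O) {q : E} (hq : q ∈ O) :
    DifferentiableAt ℝ u q :=
  (hu.contDiffAt (hO.mem_nhds hq)).differentiableAt (by simp)

theorem dirD_inv_radius (e : Z) {q : Z} (hq : q.2.1 ≠ 0) :
    DifferentiableAt ℝ (fun x : Z => (x.2.1)⁻¹) q ∧
    dirD e (fun x : Z => (x.2.1)⁻¹) q = - e.2.1 * ((q.2.1)⁻¹) ^ 2 := by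
  have d : DifferentiableAt ℝ (fun x : Z => x.2.1) q := differentiable_of_smooth contDiff_radius q
  refine ⟨d.inv hq, ?_⟩
  have d' : DifferentiableAt ℝ (fun x : Z => (x.2.1)⁻¹) q := d.inv hq
  have h1 : (fun x : Z => x.2.1 * (x.2.1)⁻¹) =ᶠ[𝓝 q] fun _ => 1 := by
    have : ∀ᶠ x : Z in 𝓝 q, x.2.1 ≠ 0 := by
      have : IsOpen {x : Z | x.2.1 ≠ 0} :=
        isOpen_ne_fun (continuous_fst.comp continuous_snd) continuous_const
      exact this.mem_nhds hq
    filter_upwards [this] with x hx using mul_inv_cancel₀ hx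
  have h2 := dirD_congr (e := e) h1
  rw [dirD_mul d d', dirD_radius] at h2
  have h3 : dirD e (fun _ : Z => (1 : ℝ)) q = 0 := by simp [dirD]
  rw [h3] at h2
  field_simp at h2 ⊢
  linarith

namespace AxiSystem

variable {O : Set Z} {f g h P : Z → ℝ}

theorem third_comm {u : Z → ℝ} (hO : IsOpen O) (hu : ContDiffOn ℝ ∞ u O) (a b c : Z) {q : Z}
    (hq : q ∈ O) : dirD a (dirD b (dirD c u)) q = dirD b (dirD c (dirD a u)) q := by
  have h1 : dirD a (dirD b (dirD c u)) q = dirD b (dirD a (dirD c u)) q :=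
    dirD_comm ((contDiffOn_dirD hO hu).contDiffAt (hO.mem_nhds hq))
  rw [h1]
  exact dirD_eqOn hO (fun x hx => dirD_comm (hu.contDiffAt (hO.mem_nhds hx))) b hq

/-- The equation for the angular vorticity. -/
theorem vorticity_eq (H : AxiSystem O f g h P) {q : Z} (hq : q ∈ O) :
    (dS (dZ f) q - dS (dR h) q) + f q * (dR (dZ f) q - dR (dR h) q)
      + h q * (dZ (dZ f) q - dZ (dR h) q) - f q * (q.2.1)⁻¹ * (dZ f q - dR h q)
      - 2 * g q * dZ g q * (q.2.1)⁻¹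
      - (dR (dR (dZ f)) q - dR (dR (dR h)) q) - (dZ (dZ (dZ f)) q - dZ (dZ (dR h)) q)
      - (dR (dZ f) q - dR (dR h) q) * (q.2.1)⁻¹ + (dZ f q - dR h q) * ((q.2.1)⁻¹) ^ 2 = 0 := by
  have hO := H.isOpen
  have r0 : q.2.1 ≠ 0 := (H.radius_pos q hq).ne'
  have D := fun {u : Z → ℝ} (hu : ContDiffOn ℝ ∞ u O) => differentiableAt_of_smoothOn hO hu hq
  have df := D H.smooth_f
  have dg := D H.smooth_g
  have dh := D H.smooth_h
  have df1 := fun e => D (contDiffOn_dirD (e := e) hO H.smooth_f)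
  have dh1 := fun e => D (contDiffOn_dirD (e := e) hO H.smooth_h)
  have dP1 := fun e => D (contDiffOn_dirD (e := e) hO H.smooth_P)
  have df2 := fun e e' => D (contDiffOn_dirD (e := e) hO (contDiffOn_dirD (e := e') hO H.smooth_f))
  have dh2 := fun e e' => D (contDiffOn_dirD (e := e) hO (contDiffOn_dirD (e := e') hO H.smooth_h))
  have dρ := (dirD_inv_radius 0 r0).1
  -- Subtracting the `r`-derivative of the vertical equation from the `z`-derivative of the radial
  -- one eliminates the pressure.
  have E1 := dirD_eqOn hO (v := fun _ => 0) (fun x hx => H.eq_f x hx) (0, 0, 1) hq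
  have E2 := dirD_eqOn hO (v := fun _ => 0) (fun x hx => H.eq_h x hx) (0, 1, 0) hq
  have z : ∀ e : Z, dirD e (fun _ : Z => (0 : ℝ)) q = 0 := fun e => by simp [dirD]
  rw [z] at E1 E2
  simp (disch := fun_prop) only [dS, dR, dZ, dirD_add, dirD_sub, dirD_mul, dirD_sq,
    (dirD_inv_radius _ r0).2] at E1 E2
  have cf := fun e e' => dirD_comm (e := e) (e' := e') (H.smooth_f.contDiffAt (hO.mem_nhds hq))
  have ch := fun e e' => dirD_comm (e := e) (e' := e') (H.smooth_h.contDiffAt (hO.mem_nhds hq))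
  have cP := dirD_comm (e := (0, 0, 1)) (e' := (0, 1, 0))
    (H.smooth_P.contDiffAt (hO.mem_nhds hq))
  have k1 := third_comm hO H.smooth_f (0, 0, 1) (0, 1, 0) (0, 1, 0) hq
  have k2 := third_comm hO H.smooth_h (0, 1, 0) (0, 0, 1) (0, 0, 1) hq
  have k3 := cf (0, 0, 1) (1, 0, 0)
  have k4 := cf (0, 0, 1) (0, 1, 0)
  have k5 := ch (0, 1, 0) (1, 0, 0)
  have k6 := ch (0, 1, 0) (0, 0, 1)
  have dv := H.div_free q hq
  simp only [dS, dR, dZ] at dv ⊢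
  rw [k1, k3, k4, cP] at E1
  rw [k2, k5, k6] at E2
  -- The curl of the transport terms leaves `(∂_z f - ∂_r h)(∂_r f + ∂_z h)`; incompressibility
  -- turns this into the stretching term `-(f / r)(∂_z f - ∂_r h)`.
  linear_combination E1 - E2 - (dirD (0, 0, 1) f q - dirD (0, 1, 0) h q) * dv

end AxiSystem

theorem contDiffOn_inv_radius {O : Set Z} (hO : ∀ q ∈ O, 0 < q.2.1) :
    ContDiffOn ℝ ∞ (fun q : Z => (q.2.1)⁻¹) O :=
  contDiff_radius.contDiffOn.inv fun q hq => (hO q hq).ne'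

namespace AxiSystem

variable {O : Set Z} {f g h P : Z → ℝ}

/-- The equation for the swirl `Γ = r g`. -/
theorem swirl_eq (H : AxiSystem O f g h P) {Γ : Z → ℝ} (hΓ : ∀ q, Γ q = q.2.1 * g q) {q : Z}
    (hq : q ∈ O) :
    dS Γ q + f q * dR Γ q + h q * dZ Γ q - dR (dR Γ) q - dZ (dZ Γ) q + dR Γ q / q.2.1 = 0 := by
  have hO := H.isOpen
  have r0 : q.2.1 ≠ 0 := (H.radius_pos q hq).ne'
  obtain rfl : Γ = fun q => q.2.1 * g q := funext hΓ
  have dr : ∀ x : Z, DifferentiableAt ℝ (fun x : Z => x.2.1) x := fun x =>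
    differentiable_of_smooth contDiff_radius x
  have D := fun {u : Z → ℝ} (hu : ContDiffOn ℝ ∞ u O) => differentiableAt_of_smoothOn hO hu hq
  have dg := D H.smooth_g
  have dg1 := fun e => D (contDiffOn_dirD (e := e) hO H.smooth_g)
  have h1 : ∀ e, EqOn (dirD e fun x : Z => x.2.1 * g x)
      (fun x => e.2.1 * g x + x.2.1 * dirD e g x) O := fun e x hx => by
    rw [dirD_mul (dr x) (differentiableAt_of_smoothOn hO H.smooth_g hx), dirD_radius]
  have dc : ∀ c : ℝ, DifferentiableAt ℝ (fun _ : Z => c) q := fun c => by fun_prop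
  have zc : ∀ (e : Z) (c : ℝ), dirD e (fun _ : Z => c) q = 0 := fun e c => by simp [dirD]
  have h2 : ∀ e, dirD e (dirD e fun x : Z => x.2.1 * g x) q
      = 2 * e.2.1 * dirD e g q + q.2.1 * dirD e (dirD e g) q := fun e => by
    rw [dirD_eqOn hO (h1 e) e hq, dirD_add (by fun_prop) (by fun_prop),
      dirD_mul (dc _) dg, dirD_mul (dr q) (dg1 e), dirD_radius, zc]
    ring
  simp only [dS, dR, dZ, h2, h1 _ hq]
  have := H.eq_g q hq
  simp only [dS, dR, dZ] at this
  field_simp at this ⊢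
  linear_combination this

/-- The equation for the relative vorticity `Ω = (∂_z f - ∂_r h) / r`. -/
theorem relative_vorticity_eq (H : AxiSystem O f g h P) {Γ Ω F : Z → ℝ}
    (hΓ : ∀ q, Γ q = q.2.1 * g q) (hΩ : ∀ q, Ω q = (q.2.1)⁻¹ * (dZ f q - dR h q))
    (hF : ∀ q, F q = Γ q ^ 2 * ((q.2.1)⁻¹) ^ 4) {q : Z} (hq : q ∈ O) :
    dS Ω q + f q * dR Ω q + h q * dZ Ω q - dR (dR Ω) q - dZ (dZ Ω) q - 3 * dR Ω q / q.2.1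
      - dZ F q = 0 := by
  have hO := H.isOpen
  have r0 : q.2.1 ≠ 0 := (H.radius_pos q hq).ne'
  have dr : ∀ x : Z, DifferentiableAt ℝ (fun x : Z => x.2.1) x := fun x =>
    differentiable_of_smooth contDiff_radius x
  have sΩ : ContDiffOn ℝ ∞ Ω O := by
    obtain rfl : Ω = fun q => (q.2.1)⁻¹ * (dZ f q - dR h q) := funext hΩ
    exact (contDiffOn_inv_radius H.radius_pos).mul
      ((contDiffOn_dirD hO H.smooth_f).sub (contDiffOn_dirD hO H.smooth_h))
  have D := fun {u : Z → ℝ} (hu : ContDiffOn ℝ ∞ u O) => differentiableAt_of_smoothOn hO hu hq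
  have dΩ := D sΩ
  have dΩ1 := fun e => D (contDiffOn_dirD (e := e) hO sΩ)
  -- Writing the vorticity as `r Ω` means that only multiplication by `r` is differentiated, never
  -- the quotient.
  have h0 : EqOn (fun x => dZ f x - dR h x) (fun x => x.2.1 * Ω x) O := fun x hx => by
    have := (H.radius_pos x hx).ne'
    simp only [hΩ]
    field_simp
  have h1 : ∀ e, EqOn (fun x => dirD e (dZ f) x - dirD e (dR h) x)
      (fun x => e.2.1 * Ω x + x.2.1 * dirD e Ω x) O := fun e x hx => by
    have := dirD_eqOn hO h0 e hx
    rw [dirD_mul (dr x) (differentiableAt_of_smoothOn hO sΩ hx), dirD_radius, dirD_sub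
      (differentiableAt_of_smoothOn hO (contDiffOn_dirD hO H.smooth_f) hx)
      (differentiableAt_of_smoothOn hO (contDiffOn_dirD hO H.smooth_h) hx)] at this
    exact this
  have dc : ∀ c : ℝ, DifferentiableAt ℝ (fun _ : Z => c) q := fun c => by fun_prop
  have zc : ∀ (e : Z) (c : ℝ), dirD e (fun _ : Z => c) q = 0 := fun e c => by simp [dirD]
  have h2 : ∀ e, dirD e (dirD e (dZ f)) q - dirD e (dirD e (dR h)) q
      = 2 * e.2.1 * dirD e Ω q + q.2.1 * dirD e (dirD e Ω) q := fun e => by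
    have := dirD_eqOn hO (h1 e) e hq
    rw [dirD_add (u := fun x => e.2.1 * Ω x) (by fun_prop) (by fun_prop),
      dirD_mul (dc _) dΩ, dirD_mul (dr q) (dΩ1 e), dirD_radius, zc, dirD_sub
      (D (contDiffOn_dirD hO (contDiffOn_dirD hO H.smooth_f)))
      (D (contDiffOn_dirD hO (contDiffOn_dirD hO H.smooth_h)))] at this
    rw [this]
    ring
  have dF : dZ F q = 2 * g q * dZ g q * ((q.2.1)⁻¹) ^ 2 := by
    have e1 : EqOn F (fun x => g x ^ 2 * ((x.2.1)⁻¹) ^ 2) O := fun x hx => by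
      have := (H.radius_pos x hx).ne'
      simp only [hF, hΓ]
      field_simp
    have dg := D H.smooth_g
    have di := (dirD_inv_radius 0 r0).1
    rw [dZ, dirD_eqOn hO e1 _ hq, dirD_mul (by fun_prop) (by fun_prop), dirD_sq dg, dirD_sq di,
      (dirD_inv_radius _ r0).2]
    simp
  have V := H.vorticity_eq hq
  have a0 := h0 hq
  have aS := h1 (1, 0, 0) hq
  have aR := h1 (0, 1, 0) hq
  have aZ := h1 (0, 0, 1) hq
  have aRR := h2 (0, 1, 0)
  have aZZ := h2 (0, 0, 1)
  rw [dF]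
  simp only [dS, dR, dZ] at *
  rw [a0, aS, aR, aZ, aRR, aZZ] at V
  field_simp at V ⊢
  linear_combination V

end AxiSystem

/-! ### From energy bounds for the components to a flow at unit scale -/

/-- Passes from lower Lebesgue integrals, in which the energy inequality is stated, to Bochner
integrals; nothing is asked of the majorant `w` but the bound on its integral. -/
theorem setIntegral_le_of_setLIntegral_le {α : Type*} [MeasurableSpace α] {μ : Measure α}
    {s : Set α} (hs : MeasurableSet s) {u w : α → ℝ} {A c : ℝ} (hc : 0 ≤ c) (hA : 0 ≤ A)
    (hu : AEStronglyMeasurable u (μ.restrict s)) (h0 : ∀ q, 0 ≤ u q)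
    (huw : ∀ q ∈ s, u q ≤ c * w q)
    (hw : ∫⁻ q in s, ENNReal.ofReal (w q) ∂μ ≤ ENNReal.ofReal A) : ∫ q in s, u q ∂μ ≤ c * A := by
  rw [integral_eq_lintegral_of_nonneg_ae (.of_forall h0) hu]
  refine ENNReal.toReal_le_of_le_ofReal (by positivity) ?_
  calc ∫⁻ q in s, ENNReal.ofReal (u q) ∂μ
      ≤ ∫⁻ q in s, ENNReal.ofReal c * ENNReal.ofReal (w q) ∂μ := by
        refine setLIntegral_mono' hs fun q hq => ?_
        rw [← ENNReal.ofReal_mul hc]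
        exact ENNReal.ofReal_le_ofReal (huw q hq)
    _ = ENNReal.ofReal c * ∫⁻ q in s, ENNReal.ofReal (w q) ∂μ :=
        lintegral_const_mul' _ _ ENNReal.ofReal_ne_top
    _ ≤ ENNReal.ofReal c * ENNReal.ofReal A := by gcongr
    _ = _ := (ENNReal.ofReal_mul hc).symm

theorem integral_box_le_of_slices {u : Z → ℝ} (hu : Continuous u) {a B : ℝ} (ha : 0 ≤ a)
    (h : ∀ t ∈ Icc (-a) 0, ∫ x in square a, u (t, x) ≤ B) : ∫ q in box a, u q ≤ a * B := by
  have hi : IntegrableOn u (box a) := integrableOn_box hu a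
  have e : ∫ q in box a, u q = ∫ t in Icc (-a) 0, ∫ x in square a, u (t, x) := by
    rw [box, Measure.volume_eq_prod] at *
    exact setIntegral_prod _ hi
  rw [e]
  have hi' : IntegrableOn (fun t => ∫ x in square a, u (t, x)) (Icc (-a) 0) := by
    have : Integrable u ((volume.restrict (Icc (-a) 0)).prod (volume.restrict (square a))) := by
      rw [Measure.prod_restrict]
      exact hi
    exact this.integral_prod_left
  refine (setIntegral_mono_on hi' (integrableOn_const (by simp)) measurableSet_Icc h).trans ?_
  simp [ha]

/-- Energy bounds for an axially symmetric system on the box produce a `UnitFlow`. -/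
theorem AxiSystem.exists_unitFlow {O : Set Z} {f g h P : Z → ℝ} (H : AxiSystem O f g h P)
    (hbox : box (1 / 2) ⊆ O) {A : ℝ} (hA : 1 ≤ A)
    (hE : ∀ t ∈ Icc (-(1 / 2) : ℝ) 0, ∫⁻ x in square (1 / 2),
      ENNReal.ofReal (f (t, x) ^ 2 + g (t, x) ^ 2 + h (t, x) ^ 2) ≤ ENNReal.ofReal A)
    (hG : ∫⁻ q in box (1 / 2), ENNReal.ofReal (dR f q ^ 2 + dZ f q ^ 2 + dR g q ^ 2 + dZ g q ^ 2
      + dR h q ^ 2 + dZ h q ^ 2) ≤ ENNReal.ofReal A) :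
    ∃ f' h' Γ Ω F : Z → ℝ, UnitFlow f' h' Γ Ω F (6 * A) ∧ f' (0, 1, 0) = f (0, 1, 0) ∧
      h' (0, 1, 0) = h (0, 1, 0) := by
  have hO := H.isOpen
  -- A `UnitFlow` consists of globally smooth functions. The extensions agree with the originals on
  -- a neighbourhood of the box, so derivatives agree on the closed box too.
  have ext := fun {u : Z → ℝ} (hu : ContDiffOn ℝ ∞ u O) =>
    exists_smooth_extension (isCompact_box (1 / 2)) hO hbox hu
  have sΓ : ContDiffOn ℝ ∞ (fun q : Z => q.2.1 * g q) O := contDiff_radius.contDiffOn.mul H.smooth_g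
  have si := contDiffOn_inv_radius H.radius_pos
  have sΩ : ContDiffOn ℝ ∞ (fun q : Z => (q.2.1)⁻¹ * (dZ f q - dR h q)) O := si.mul
    ((contDiffOn_dirD hO H.smooth_f).sub (contDiffOn_dirD hO H.smooth_h))
  obtain ⟨f', sf', ef⟩ := ext H.smooth_f
  obtain ⟨g', sg', eg⟩ := ext H.smooth_g
  obtain ⟨h', sh', eh⟩ := ext H.smooth_h
  obtain ⟨Γ, sΓ', eΓ⟩ := ext sΓ
  obtain ⟨Ω, sΩ', eΩ⟩ := ext sΩ
  obtain ⟨F, sF', eF⟩ := ext ((sΓ.pow 2).mul (si.pow 4))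
  have loc := fun {u w : Z → ℝ} (e : ∀ᶠ x in 𝓝ˢ (box (1 / 2)), w x = u x) (q : Z)
    (hq : q ∈ box (1 / 2)) => show w =ᶠ[𝓝 q] u from e.filter_mono (nhds_le_nhdsSet hq)
  have rpos : ∀ q ∈ box (1 / 2), 0 < q.2.1 := fun q hq => H.radius_pos q (hbox hq)
  have D1 := fun {u w : Z → ℝ} (e : ∀ᶠ x in 𝓝ˢ (box (1 / 2)), w x = u x) (a q : Z)
    (hq : q ∈ box (1 / 2)) => dirD_congr (e := a) (loc e q hq)
  have D2 := fun {u w : Z → ℝ} (e : ∀ᶠ x in 𝓝ˢ (box (1 / 2)), w x = u x) (a b q : Z)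
    (hq : q ∈ box (1 / 2)) => dirD_congr (e := a) (dirD_eventuallyEq (e := b) (loc e q hq))
  have V := fun {u w : Z → ℝ} (e : ∀ᶠ x in 𝓝ˢ (box (1 / 2)), w x = u x) (q : Z)
    (hq : q ∈ box (1 / 2)) => (loc e q hq).eq_of_nhds
  have msq : MeasurableSet (square (1 / 2)) := (isCompact_square _).measurableSet
  have mbx : MeasurableSet (box (1 / 2)) := (isCompact_box _).measurableSet
  have slice : ∀ {u : Z → ℝ}, ContDiff ℝ ∞ u → ∀ t : ℝ,
      AEStronglyMeasurable (fun x => u (t, x) ^ 2) (volume.restrict (square (1 / 2))) :=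
    fun hu t => by
      have := hu.continuous
      exact (Continuous.aestronglyMeasurable (by fun_prop))
  have grad : ∀ {u : Z → ℝ}, ContDiff ℝ ∞ u →
      Continuous (fun q => dR u q ^ 2 + dZ u q ^ 2) := fun hu => by
    have h1 := (contDiff_dirD (e := ((0, 1, 0) : Z)) hu).continuous
    have h2 := (contDiff_dirD (e := ((0, 0, 1) : Z)) hu).continuous
    fun_prop
  have gradm := fun {u : Z → ℝ} (hu : ContDiff ℝ ∞ u) =>
    (grad hu).aestronglyMeasurable (μ := (volume : Measure Z).restrict (box (1 / 2)))
  have A0 : 0 ≤ A := by linarith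
  have hp : ((0, 1, 0) : Z) ∈ box (1 / 2) := by
    simp [box, square]
  refine ⟨f', h', Γ, Ω, F, ?_, V ef _ hp, V eh _ hp⟩
  refine ⟨sf', sh', sΓ', sΩ', sF', ?_, ?_, ?_, ?_, ?_, by linarith, ?_, ?_, ?_, ?_, ?_, ?_⟩
  · intro q hq
    simp only [dR, dZ, D1 ef _ q hq, D1 eh _ q hq, V ef q hq]
    exact H.div_free q (hbox hq)
  · intro q hq
    have := (rpos q hq).ne'
    simp only [dR, dZ, D1 ef _ q hq, D1 eh _ q hq, V eΩ q hq]
    field_simp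
  · intro q hq
    have := (rpos q hq).ne'
    simp only [V eF q hq, V eΓ q hq]
    field_simp
  · intro q hq
    simp only [dS, dR, dZ, D1 eΓ _ q hq, D2 eΓ _ _ q hq, V ef q hq, V eh q hq]
    exact H.swirl_eq (fun _ => rfl) (hbox hq)
  · intro q hq
    simp only [dS, dR, dZ, D1 eΩ _ q hq, D2 eΩ _ _ q hq, V ef q hq, V eh q hq, D1 eF _ q hq]
    exact H.relative_vorticity_eq (fun _ => rfl) (fun _ => rfl) (fun _ => rfl) (hbox hq)
  · intro t ht
    refine setIntegral_le_of_setLIntegral_le msq (by norm_num) A0 (slice sf' t)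
      (fun q => sq_nonneg _) (fun x hx => ?_) (hE t ht)
    rw [V ef (t, x) ⟨ht, hx⟩]
    nlinarith [sq_nonneg (f (t, x)), sq_nonneg (g (t, x)), sq_nonneg (h (t, x))]
  · intro t ht
    refine setIntegral_le_of_setLIntegral_le msq (by norm_num) A0 (slice sh' t)
      (fun q => sq_nonneg _) (fun x hx => ?_) (hE t ht)
    rw [V eh (t, x) ⟨ht, hx⟩]
    nlinarith [sq_nonneg (f (t, x)), sq_nonneg (g (t, x)), sq_nonneg (h (t, x))]
  · intro t ht
    refine setIntegral_le_of_setLIntegral_le msq (by norm_num) A0 (slice sΓ' t)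
      (fun q => sq_nonneg _) (fun x hx => ?_) (hE t ht)
    have hr := radius_mem_of_box le_rfl (⟨ht, hx⟩ : (t, x) ∈ box (1 / 2))
    have h2 : x.1 ^ 2 ≤ 6 := by
      have h1 := hr.1; have h2 := hr.2
      simp only at h1 h2
      nlinarith
    rw [V eΓ (t, x) ⟨ht, hx⟩, mul_pow]
    nlinarith [sq_nonneg (f (t, x)), sq_nonneg (g (t, x)), sq_nonneg (h (t, x)),
      mul_le_mul_of_nonneg_right h2 (sq_nonneg (g (t, x)))]
  · refine setIntegral_le_of_setLIntegral_le mbx (by norm_num) A0 (gradm sf')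
      (fun q => by positivity) (fun q hq => ?_) hG
    simp only [dR, dZ, D1 ef _ q hq]
    nlinarith [sq_nonneg (dR f q), sq_nonneg (dZ f q), sq_nonneg (dR g q), sq_nonneg (dZ g q),
      sq_nonneg (dR h q), sq_nonneg (dZ h q)]
  · refine setIntegral_le_of_setLIntegral_le mbx (by norm_num) A0 (gradm sh')
      (fun q => by positivity) (fun q hq => ?_) hG
    simp only [dR, dZ, D1 eh _ q hq]
    nlinarith [sq_nonneg (dR f q), sq_nonneg (dZ f q), sq_nonneg (dR g q), sq_nonneg (dZ g q),
      sq_nonneg (dR h q), sq_nonneg (dZ h q)]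
  -- Since `∂_r (r g) = g + r ∂_r g`, the gradient of the swirl also needs `∫ g²`. The total is `2 ·
  -- A / 2 + (9 / 2) A`, within the allowed `6 A`.
  · have b1 : ∫ q in box (1 / 2), g' q ^ 2 ≤ 1 / 2 * (1 * A) := by
      refine integral_box_le_of_slices (u := fun q => g' q ^ 2)
        (sg'.continuous.pow 2) (by norm_num) fun t ht => ?_
      refine setIntegral_le_of_setLIntegral_le msq (by norm_num) A0 (slice sg' t)
        (fun q => sq_nonneg _) (fun x hx => ?_) (hE t ht)
      rw [V eg (t, x) ⟨ht, hx⟩]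
      nlinarith [sq_nonneg (f (t, x)), sq_nonneg (g (t, x)), sq_nonneg (h (t, x))]
    have b2 : ∫ q in box (1 / 2), (dR g' q ^ 2 + dZ g' q ^ 2) ≤ 1 * A := by
      refine setIntegral_le_of_setLIntegral_le mbx (by norm_num) A0 (gradm sg')
        (fun q => by positivity) (fun q hq => ?_) hG
      simp only [dR, dZ, D1 eg _ q hq]
      nlinarith [sq_nonneg (dR f q), sq_nonneg (dZ f q), sq_nonneg (dR g q), sq_nonneg (dZ g q),
        sq_nonneg (dR h q), sq_nonneg (dZ h q)]
    have cg : Continuous fun q => g' q ^ 2 := sg'.continuous.pow 2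
    have b3 : ∫ q in box (1 / 2), (dR Γ q ^ 2 + dZ Γ q ^ 2)
        ≤ ∫ q in box (1 / 2), (2 * g' q ^ 2 + 9 / 2 * (dR g' q ^ 2 + dZ g' q ^ 2)) := by
      refine setIntegral_mono_on (integrableOn_box (grad sΓ') _)
        (integrableOn_box ((cg.const_mul 2).add ((grad sg').const_mul _)) _) mbx fun q hq => ?_
      have d := differentiableAt_of_smoothOn hO H.smooth_g (hbox hq)
      have dr : DifferentiableAt ℝ (fun x : Z => x.2.1) q :=
        differentiable_of_smooth contDiff_radius q
      have hr : q.2.1 ∈ Icc (1 - 1 / 2 : ℝ) (1 + 1 / 2) := hq.2.1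
      have h2 : q.2.1 ^ 2 ≤ 9 / 4 := by
        have h1 := hr.1; have h2 := hr.2
        nlinarith
      simp only [dR, dZ, D1 eΓ _ q hq, D1 eg _ q hq, V eg q hq, dirD_mul dr d, dirD_radius]
      have e1 := mul_le_mul_of_nonneg_right h2 (sq_nonneg (dirD (0, 1, 0) g q))
      have e2 := mul_le_mul_of_nonneg_right h2 (sq_nonneg (dirD (0, 0, 1) g q))
      nlinarith [sq_nonneg (g q - q.2.1 * dirD (0, 1, 0) g q), sq_nonneg (dirD (0, 0, 1) g q)]
    rw [integral_add (integrableOn_box (cg.const_mul 2) _)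
      (integrableOn_box ((grad sg').const_mul _) _), integral_const_mul, integral_const_mul] at b3
    linarith

/-! ### The Navier–Stokes equations in components -/

/-- Space-time. -/
abbrev W : Type := ℝ × E3

/-- The time direction. -/
abbrev timeDir : W := (1, 0)

/-- The `j`-th spatial direction. -/
abbrev axis (j : Fin 3) : W := (0, EuclideanSpace.single j 1)

/-- The components of the velocity as functions on space-time. -/
def vel (v : ℝ → E3 → E3) (i : Fin 3) : W → ℝ := fun q => v q.1 q.2 i

/-- The pressure as a function on space-time. -/
def press (p : ℝ → E3 → ℝ) : W → ℝ := fun q => p q.1 q.2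

/-- The space-time domain `(-T, 0) × ℝ³`. -/
def slab (T : ℝ) : Set W := Ioo (-T) 0 ×ˢ univ

theorem isOpen_slab (T : ℝ) : IsOpen (slab T) := isOpen_Ioo.prod isOpen_univ

theorem fderiv_space_slice {F : Type*} [NormedAddCommGroup F] [NormedSpace ℝ F] {u : W → F} {t : ℝ}
    {x : E3} (hu : DifferentiableAt ℝ u (t, x)) (e : E3) :
    fderiv ℝ (fun y => u (t, y)) x e = fderiv ℝ u (t, x) (0, e) := by
  have h1 : HasFDerivAt (fun y : E3 => (t, y)) (ContinuousLinearMap.inr ℝ ℝ E3) x :=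
    hasFDerivAt_prodMk_right t x
  have := (hu.hasFDerivAt.comp x h1).fderiv
  change fderiv ℝ (u ∘ fun y => (t, y)) x e = _
  rw [this]
  simp

theorem deriv_time_slice {F : Type*} [NormedAddCommGroup F] [NormedSpace ℝ F] {u : W → F} {t : ℝ}
    {x : E3} (hu : DifferentiableAt ℝ u (t, x)) :
    deriv (fun s => u (s, x)) t = fderiv ℝ u (t, x) timeDir := by
  have h1 : HasFDerivAt (fun s : ℝ => (s, x)) (ContinuousLinearMap.inl ℝ ℝ E3) t :=
    hasFDerivAt_prodMk_left t x
  have := (hu.hasFDerivAt.comp t h1).hasDerivAt.deriv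
  change deriv (u ∘ fun s => (s, x)) t = _
  rw [this]
  simp

theorem fderiv_apply_coord {E : Type*} [NormedAddCommGroup E] [NormedSpace ℝ E] {u : E → E3}
    {q : E} (hu : DifferentiableAt ℝ u q) (e : E) (i : Fin 3) :
    (fderiv ℝ u q e) i = fderiv ℝ (fun y => u y i) q e := by
  have h := ((EuclideanSpace.proj i : E3 →L[ℝ] ℝ).hasFDerivAt.comp q hu.hasFDerivAt).fderiv
  change _ = fderiv ℝ ((EuclideanSpace.proj i : E3 →L[ℝ] ℝ) ∘ u) q e
  rw [h]
  simp

theorem eq_sum_single (x : E3) :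
    x = x 0 • EuclideanSpace.single 0 1 + x 1 • EuclideanSpace.single 1 1
      + x 2 • EuclideanSpace.single 2 1 := by
  ext i
  fin_cases i <;> simp

theorem fderiv_space_eq {u : W → ℝ} {q : W} (y : E3) :
    fderiv ℝ u q (0, y) = y 0 * dirD (axis 0) u q + y 1 * dirD (axis 1) u q
      + y 2 * dirD (axis 2) u q := by
  have : ((0, y) : W) = y 0 • axis 0 + y 1 • axis 1 + y 2 • axis 2 := by
    apply Prod.ext
    · simp
    · simpa using eq_sum_single y
  rw [this, map_add, map_add, map_smul, map_smul, map_smul]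
  rfl

namespace IsSmoothSolution

variable {T : ℝ} {v : ℝ → E3 → E3} {p : ℝ → E3 → ℝ}

theorem smooth_vel (H : IsSmoothSolution T v p) (i : Fin 3) :
    ContDiffOn ℝ ∞ (vel v i) (slab T) :=
  (EuclideanSpace.proj i : E3 →L[ℝ] ℝ).contDiff.comp_contDiffOn H.smooth_v

theorem smooth_press (H : IsSmoothSolution T v p) : ContDiffOn ℝ ∞ (press p) (slab T) := H.smooth_p

theorem differentiableAt_v (H : IsSmoothSolution T v p) {q : W} (hq : q ∈ slab T) :
    DifferentiableAt ℝ (fun q : W => v q.1 q.2) q :=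
  (H.smooth_v.contDiffAt ((isOpen_slab T).mem_nhds hq)).differentiableAt (by simp)

theorem contDiffAt_slice (H : IsSmoothSolution T v p) {q : W} (hq : q ∈ slab T) :
    ContDiffAt ℝ ∞ (v q.1) q.2 :=
  (H.smooth_v.contDiffAt ((isOpen_slab T).mem_nhds hq)).comp (g := fun q : W => v q.1 q.2)
    (f := fun y => (q.1, y)) q.2 (contDiffAt_const.prodMk contDiffAt_id)

theorem partialD_apply (H : IsSmoothSolution T v p) {q : W} (hq : q ∈ slab T) (i j : Fin 3) :
    partialD j (v q.1) q.2 i = dirD (axis j) (vel v i) q := by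
  rw [partialD, fderiv_apply_coord ((H.contDiffAt_slice hq).differentiableAt (by simp))]
  exact fderiv_space_slice (u := vel v i)
    (differentiableAt_of_smoothOn (isOpen_slab T) (H.smooth_vel i) hq) _

theorem div_eq (H : IsSmoothSolution T v p) {q : W} (hq : q ∈ slab T) :
    dirD (axis 0) (vel v 0) q + dirD (axis 1) (vel v 1) q + dirD (axis 2) (vel v 2) q = 0 := by
  have h := H.incompressible q.1 hq.1 q.2
  simpa only [divergence, Fin.sum_univ_three, H.partialD_apply hq] using h

theorem laplacian_apply (H : IsSmoothSolution T v p) {q : W} (hq : q ∈ slab T) (i : Fin 3) :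
    (Laplacian.laplacian (v q.1) : E3 → E3) q.2 i
      = dirD (axis 0) (dirD (axis 0) (vel v i)) q + dirD (axis 1) (dirD (axis 1) (vel v i)) q
        + dirD (axis 2) (dirD (axis 2) (vel v i)) q := by
  have hO := isOpen_slab T
  have hc := H.contDiffAt_slice hq
  have h1 : (Laplacian.laplacian (v q.1) : E3 → E3) q.2 i
      = Laplacian.laplacian (fun y => v q.1 y i) q.2 :=
    ((hc.of_le (by norm_cast)).laplacian_CLM_comp_left
      (l := (EuclideanSpace.proj i : E3 →L[ℝ] ℝ))).symm
  have hs : ContDiffAt ℝ ∞ (fun y => v q.1 y i) q.2 :=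
    (EuclideanSpace.proj i : E3 →L[ℝ] ℝ).contDiff.contDiffAt.comp q.2 hc
  have hd : DifferentiableAt ℝ (fderiv ℝ (fun y => v q.1 y i)) q.2 :=
    (hs.fderiv_right (m := 1) (by norm_cast)).differentiableAt (by simp)
  have h2 : ∀ j : Fin 3, iteratedFDeriv ℝ 2 (fun y => v q.1 y i) q.2
      ![EuclideanSpace.basisFun (Fin 3) ℝ j, EuclideanSpace.basisFun (Fin 3) ℝ j]
      = dirD (axis j) (dirD (axis j) (vel v i)) q := fun j => by
    rw [iteratedFDeriv_two_apply]
    simp only [EuclideanSpace.basisFun_apply, Matrix.cons_val_zero, Matrix.cons_val_one]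
    have e1 : (fun y => fderiv ℝ (fun y => v q.1 y i) y (EuclideanSpace.single j 1))
        = fun y => dirD (axis j) (vel v i) (q.1, y) := by
      funext y
      exact fderiv_space_slice (u := vel v i)
        (differentiableAt_of_smoothOn hO (H.smooth_vel i) (⟨hq.1, trivial⟩ : (q.1, y) ∈ slab T)) _
    have e2 := fderiv_space_slice (u := dirD (axis j) (vel v i)) (t := q.1) (x := q.2)
      (differentiableAt_of_smoothOn hO (contDiffOn_dirD hO (H.smooth_vel i)) hq)
      (EuclideanSpace.single j 1)
    rw [← e1, fderiv_clm_apply hd (by fun_prop)] at e2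
    simpa [dirD] using e2
  rw [h1, InnerProductSpace.laplacian_eq_iteratedFDeriv_orthonormalBasis _
    (EuclideanSpace.basisFun (Fin 3) ℝ)]
  simp only [h2, Fin.sum_univ_three]

theorem momentum_apply (H : IsSmoothSolution T v p) {q : W} (hq : q ∈ slab T) (i : Fin 3) :
    dirD (axis 0) (dirD (axis 0) (vel v i)) q + dirD (axis 1) (dirD (axis 1) (vel v i)) q
      + dirD (axis 2) (dirD (axis 2) (vel v i)) q
      - (vel v 0 q * dirD (axis 0) (vel v i) q + vel v 1 q * dirD (axis 1) (vel v i) q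
        + vel v 2 q * dirD (axis 2) (vel v i) q)
      - dirD (axis i) (press p) q - dirD timeDir (vel v i) q = 0 := by
  have hO := isOpen_slab T
  have h := congrArg (fun y : E3 => y i) (H.momentum q.1 hq.1 q.2)
  have dv := differentiableAt_of_smoothOn hO (H.smooth_vel i) hq
  simp only [PiLp.sub_apply, PiLp.zero_apply, H.laplacian_apply hq] at h
  have e1 : (fderiv ℝ (v q.1) q.2 (v q.1 q.2)) i
      = vel v 0 q * dirD (axis 0) (vel v i) q + vel v 1 q * dirD (axis 1) (vel v i) q
        + vel v 2 q * dirD (axis 2) (vel v i) q := by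
    rw [fderiv_apply_coord ((H.contDiffAt_slice hq).differentiableAt (by simp))]
    exact (fderiv_space_slice (u := vel v i) dv _).trans (fderiv_space_eq _)
  have e2 : gradient (p q.1) q.2 i = dirD (axis i) (press p) q := by
    have g1 : gradient (p q.1) q.2 i
        = inner ℝ (gradient (p q.1) q.2) (EuclideanSpace.single i (1 : ℝ)) := by
      rw [EuclideanSpace.inner_single_right]
      simp
    rw [g1, ← InnerProductSpace.toDual_apply_apply, toDual_gradient]
    exact fderiv_space_slice (u := press p)
      (differentiableAt_of_smoothOn hO H.smooth_press hq) _
  have e3 : deriv (fun s => v s q.2) q.1 i = dirD timeDir (vel v i) q := by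
    have g1 := deriv_time_slice (t := q.1) (x := q.2) (H.differentiableAt_v hq)
    simp only at g1
    rw [g1, fderiv_apply_coord (H.differentiableAt_v hq)]
    rfl
  rw [e1, e2, e3] at h
  exact h

end IsSmoothSolution

/-! ### The angular derivative -/

/-- The derivative `x₁ ∂₂ - x₂ ∂₁` along the rotations about the axis. -/
def ang (u : W → ℝ) : W → ℝ := fun q =>
  q.2 0 * dirD (axis 1) u q - q.2 1 * dirD (axis 0) u q

theorem ang_eq_dirD (u : W → ℝ) (q : W) : ang u q = dirD (0, !₂[-(q.2 1), q.2 0, 0]) u q := by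
  rw [dirD, fderiv_space_eq]
  simp [ang]
  ring

theorem ang_congr {O : Set W} (hO : IsOpen O) {u w : W → ℝ} (h : EqOn u w O) :
    EqOn (ang u) (ang w) O := fun q hq => by
  rw [ang_eq_dirD, ang_eq_dirD]
  exact dirD_eqOn hO h _ hq

theorem contDiff_coord (i : Fin 3) : ContDiff ℝ ∞ fun q : W => q.2 i :=
  (EuclideanSpace.proj i : E3 →L[ℝ] ℝ).contDiff.comp contDiff_snd

theorem dirD_coord (e q : W) (i : Fin 3) : dirD e (fun q : W => q.2 i) q = e.2 i := by
  have : (fun q : W => q.2 i) = ((EuclideanSpace.proj i : E3 →L[ℝ] ℝ).comp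
    (ContinuousLinearMap.snd ℝ ℝ E3)) := rfl
  rw [dirD, this, ContinuousLinearMap.fderiv]
  simp

theorem contDiffOn_ang {O : Set W} (hO : IsOpen O) {u : W → ℝ} (hu : ContDiffOn ℝ ∞ u O) :
    ContDiffOn ℝ ∞ (ang u) O :=
  ((contDiff_coord 0).contDiffOn.mul (contDiffOn_dirD hO hu)).sub
    ((contDiff_coord 1).contDiffOn.mul (contDiffOn_dirD hO hu))

/-- The commutator of the rotation generator with a translation is a translation in the rotated
direction. -/
theorem ang_dirD {O : Set W} (hO : IsOpen O) {u : W → ℝ} (hu : ContDiffOn ℝ ∞ u O) {q : W}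
    (hq : q ∈ O) (e : W) :
    ang (dirD e u) q
      = dirD e (ang u) q - (e.2 0 * dirD (axis 1) u q - e.2 1 * dirD (axis 0) u q) := by
  have d : ∀ i, DifferentiableAt ℝ (fun q : W => q.2 i) q := fun i =>
    differentiable_of_smooth (contDiff_coord i) q
  have du := fun e => differentiableAt_of_smoothOn hO (contDiffOn_dirD (e := e) hO hu) hq
  have c := fun e' => dirD_comm (e := e) (e' := e') (hu.contDiffAt (hO.mem_nhds hq))
  have h : dirD e (ang u) q = e.2 0 * dirD (axis 1) u q + q.2 0 * dirD e (dirD (axis 1) u) q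
      - (e.2 1 * dirD (axis 0) u q + q.2 1 * dirD e (dirD (axis 0) u) q) := by
    have h0 := d 0
    have h1 := d 1
    have h2 := du (axis 0)
    have h3 := du (axis 1)
    unfold ang
    rw [dirD_sub (by fun_prop) (by fun_prop), dirD_mul h0 h3, dirD_mul h1 h2, dirD_coord,
      dirD_coord]
  rw [h, c, c]
  simp only [ang]
  ring

/-- The spatial Laplacian. -/
def lap (u : W → ℝ) : W → ℝ := fun q =>
  dirD (axis 0) (dirD (axis 0) u) q + dirD (axis 1) (dirD (axis 1) u) q
    + dirD (axis 2) (dirD (axis 2) u) q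

/-- The convective derivative along `(a, b, c)`. -/
def conv (a b c u : W → ℝ) : W → ℝ := fun q =>
  a q * dirD (axis 0) u q + b q * dirD (axis 1) u q + c q * dirD (axis 2) u q

/-- The hypothesis `ang u = k w` covers the three Cartesian components of a symmetric field at once,
with `k = -1, 1, 0`. -/
theorem ang_dirD_of_eqOn {O : Set W} (hO : IsOpen O) {u w : W → ℝ} {k : ℝ} (hu : ContDiffOn ℝ ∞ u O)
    (hw : ContDiffOn ℝ ∞ w O) (h : EqOn (ang u) (fun q => k * w q) O)
    (e : W) :
    EqOn (ang (dirD e u)) (fun q => k * dirD e w q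
      - (e.2 0 * dirD (axis 1) u q - e.2 1 * dirD (axis 0) u q)) O := fun q hq => by
  rw [ang_dirD hO hu hq, dirD_eqOn hO h e hq,
    dirD_const_mul k (differentiableAt_of_smoothOn hO hw hq)]

theorem ang_dirD_dirD_of_eqOn {O : Set W} (hO : IsOpen O) {u w : W → ℝ} {k : ℝ} (hu : ContDiffOn ℝ ∞ u O)
    (hw : ContDiffOn ℝ ∞ w O) (h : EqOn (ang u) (fun q => k * w q) O)
    (e : W) {q : W} (hq : q ∈ O) :
    ang (dirD e (dirD e u)) q = k * dirD e (dirD e w) q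
      - 2 * (e.2 0 * dirD e (dirD (axis 1) u) q - e.2 1 * dirD e (dirD (axis 0) u) q) := by
  have du := fun e => differentiableAt_of_smoothOn hO (contDiffOn_dirD (e := e) hO hu) hq
  have dw := fun e => differentiableAt_of_smoothOn hO (contDiffOn_dirD (e := e) hO hw) hq
  have h0 := du (axis 0)
  have h1 := du (axis 1)
  have h2 := dw e
  have c := fun e' => dirD_comm (e := e) (e' := e') (hu.contDiffAt (hO.mem_nhds hq))
  rw [ang_dirD hO (contDiffOn_dirD hO hu) hq,
    dirD_eqOn hO (ang_dirD_of_eqOn hO hu hw h e) e hq, dirD_sub (by fun_prop) (by fun_prop),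
    dirD_sub (by fun_prop) (by fun_prop), dirD_const_mul _ h2, dirD_const_mul _ h1,
    dirD_const_mul _ h0, ← c, ← c]
  ring

/-- The Laplacian is rotation invariant: the mixed derivatives produced by the two horizontal
directions cancel. -/
theorem ang_lap {O : Set W} (hO : IsOpen O) {u w : W → ℝ} {k : ℝ} (hu : ContDiffOn ℝ ∞ u O)
    (hw : ContDiffOn ℝ ∞ w O) (h : EqOn (ang u) (fun q => k * w q) O)
    {q : W} (hq : q ∈ O) : ang (lap u) q = k * lap w q := by
  have d2 := fun e => differentiableAt_of_smoothOn hO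
    (contDiffOn_dirD (e := e) hO (contDiffOn_dirD (e := e) hO hu)) hq
  have h0 := d2 (axis 0)
  have h1 := d2 (axis 1)
  have h2 := d2 (axis 2)
  have e := fun j : Fin 3 => ang_dirD_dirD_of_eqOn hO hu hw h (axis j) hq
  have e0 := e 0
  have e1 := e 1
  have e2 := e 2
  have c := dirD_comm (e := axis 0) (e' := axis 1) (hu.contDiffAt (hO.mem_nhds hq))
  unfold lap
  rw [ang_eq_dirD] at e0 e1 e2 ⊢
  rw [dirD_add (by fun_prop) (by fun_prop), dirD_add (by fun_prop) (by fun_prop), e0, e1, e2, c]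
  simp
  ring

/-- The transport operator is rotation invariant when its coefficients turn with the rotation, as
`aa`, `ab` and `ac` express. -/
theorem ang_conv {O : Set W} (hO : IsOpen O) {u w : W → ℝ} {k : ℝ} (hu : ContDiffOn ℝ ∞ u O)
    (hw : ContDiffOn ℝ ∞ w O) (h : EqOn (ang u) (fun q => k * w q) O)
    {a b c : W → ℝ} (ha : ContDiffOn ℝ ∞ a O) (hb : ContDiffOn ℝ ∞ b O)
    (hc : ContDiffOn ℝ ∞ c O) {q : W} (hq : q ∈ O) (aa : ang a q = - b q) (ab : ang b q = a q)
    (ac : ang c q = 0) : ang (conv a b c u) q = k * conv a b c w q := by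
  have da := differentiableAt_of_smoothOn hO ha hq
  have db := differentiableAt_of_smoothOn hO hb hq
  have dc := differentiableAt_of_smoothOn hO hc hq
  have d1 := fun e => differentiableAt_of_smoothOn hO (contDiffOn_dirD (e := e) hO hu) hq
  have h0 := d1 (axis 0)
  have h1 := d1 (axis 1)
  have h2 := d1 (axis 2)
  have e := fun j : Fin 3 => ang_dirD_of_eqOn hO hu hw h (axis j) hq
  have e0 := e 0
  have e1 := e 1
  have e2 := e 2
  unfold conv
  rw [ang_eq_dirD] at aa ab ac e0 e1 e2 ⊢
  rw [dirD_add (by fun_prop) (by fun_prop), dirD_add (by fun_prop) (by fun_prop),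
    dirD_mul da h0, dirD_mul db h1, dirD_mul dc h2, aa, ab, ac, e0, e1, e2]
  simp
  ring

/-! ### Cylindrical coordinates and the angular variable -/

/-- The space-time point with cylindrical coordinates `(r, θ, z)` at time `t`. -/
def cyl (t r z θ : ℝ) : W := (t, !₂[r * Real.cos θ, r * Real.sin θ, z])

theorem rad_cyl {r : ℝ} (hr : 0 < r) (t z θ : ℝ) : rad (cyl t r z θ).2 = r := by
  have : (r * Real.cos θ) ^ 2 + (r * Real.sin θ) ^ 2 = r ^ 2 := by
    linear_combination r ^ 2 * Real.sin_sq_add_cos_sq θ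
  simp [rad, cyl, this, hr.le]

theorem exists_cyl (q : W) : ∃ θ, q = cyl q.1 (rad q.2) (q.2 2) θ := by
  have hn : ‖(⟨q.2 0, q.2 1⟩ : ℂ)‖ = rad q.2 := by
    rw [rad, Complex.norm_eq_sqrt_sq_add_sq]
  refine ⟨Complex.arg ⟨q.2 0, q.2 1⟩, ?_⟩
  rw [cyl, ← hn, Complex.norm_mul_cos_arg, Complex.norm_mul_sin_arg]
  refine Prod.ext rfl ?_
  ext i
  fin_cases i <;> rfl

theorem hasDerivAt_cyl (t r z θ : ℝ) : HasDerivAt (cyl t r z)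
    (0, !₂[-(r * Real.sin θ), r * Real.cos θ, 0]) θ := by
  refine (hasDerivAt_const θ t).prodMk ?_
  have h : HasDerivAt (fun x => ![r * Real.cos x, r * Real.sin x, z])
      ![-(r * Real.sin θ), r * Real.cos θ, 0] θ := hasDerivAt_pi.2 fun i => ?_
  · exact (PiLp.continuousLinearEquiv 2 ℝ fun _ : Fin 3 => ℝ).symm.hasFDerivAt.comp_hasDerivAt θ h
  fin_cases i
  · simpa using (Real.hasDerivAt_cos θ).const_mul r
  · simpa using (Real.hasDerivAt_sin θ).const_mul r
  · simpa using hasDerivAt_const θ z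

theorem hasDerivAt_comp_cyl {u : W → ℝ} {t r z θ : ℝ} (hu : DifferentiableAt ℝ u (cyl t r z θ)) :
    HasDerivAt (fun θ => u (cyl t r z θ)) (ang u (cyl t r z θ)) θ := by
  have := hu.hasFDerivAt.comp_hasDerivAt θ (hasDerivAt_cyl t r z θ)
  rw [ang_eq_dirD]
  exact this

/-- The part of space-time away from the axis. -/
def offAxis (T : ℝ) : Set W := {q ∈ slab T | 0 < rad q.2}

theorem continuous_rad : Continuous rad := by
  unfold rad
  fun_prop

theorem isOpen_offAxis (T : ℝ) : IsOpen (offAxis T) :=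
  (isOpen_slab T).inter (isOpen_lt continuous_const (continuous_rad.comp continuous_snd))

theorem cyl_mem_offAxis {T t r : ℝ} (ht : t ∈ Ioo (-T) 0) (hr : 0 < r) (z θ : ℝ) :
    cyl t r z θ ∈ offAxis T := ⟨⟨ht, trivial⟩, (rad_cyl hr t z θ).symm ▸ hr⟩

/-- Along a circle about the axis, `ang` is the derivative in the angle. -/
theorem eq_of_ang_eq_zero {T : ℝ} {u : W → ℝ} (hu : ContDiffOn ℝ ∞ u (offAxis T))
    (h : ∀ q ∈ offAxis T, ang u q = 0) {t r : ℝ} (ht : t ∈ Ioo (-T) 0) (hr : 0 < r)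
    (z θ θ' : ℝ) : u (cyl t r z θ) = u (cyl t r z θ') := by
  have d : ∀ θ, HasDerivAt (fun θ => u (cyl t r z θ)) 0 θ := fun θ => by
    have hm := cyl_mem_offAxis ht hr z θ
    have := hasDerivAt_comp_cyl (differentiableAt_of_smoothOn (isOpen_offAxis T) hu hm)
    rwa [h _ hm] at this
  exact is_const_of_deriv_eq_zero (fun θ => (d θ).differentiableAt) (fun θ => (d θ).deriv) θ θ'

/-- A function whose second angular derivative vanishes has vanishing angular derivative. -/
theorem ang_eq_zero_of_ang_ang {T : ℝ} {u : W → ℝ} (hu : ContDiffOn ℝ ∞ u (offAxis T))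
    (h : ∀ q ∈ offAxis T, ang (ang u) q = 0) : ∀ q ∈ offAxis T, ang u q = 0 := by
  intro q hq
  obtain ⟨θ₀, h₀⟩ := exists_cyl q
  have hr := hq.2
  have ht := hq.1.1
  generalize q.1 = t at *
  generalize rad q.2 = r at *
  generalize q.2 2 = z at *
  rw [h₀]
  set m := ang u (cyl t r z θ₀)
  have hc : ∀ θ, ang u (cyl t r z θ) = m := fun θ =>
    eq_of_ang_eq_zero (contDiffOn_ang (isOpen_offAxis T) hu) h ht hr z θ θ₀
  -- The angular derivative is a constant `m` on the circle, so `u` is affine in the angle; equality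
  -- at `0` and `2π` forces `m = 0`.
  have d : ∀ θ, HasDerivAt (fun θ => u (cyl t r z θ) - θ * m) 0 θ := fun θ => by
    have hm := cyl_mem_offAxis ht hr z θ
    have h1 := hasDerivAt_comp_cyl (differentiableAt_of_smoothOn (isOpen_offAxis T) hu hm)
    rw [hc] at h1
    have h2 := h1.sub ((hasDerivAt_id θ).mul_const m)
    rw [one_mul, sub_self] at h2
    exact h2
  have e := is_const_of_deriv_eq_zero (fun θ => (d θ).differentiableAt) (fun θ => (d θ).deriv)
    (2 * Real.pi) 0
  have e2 : cyl t r z (2 * Real.pi) = cyl t r z 0 := by simp [cyl]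
  simp only [e2] at e
  have := Real.pi_pos
  nlinarith

/-! ### Reduction of axially symmetric solutions -/

/-- The components of an axially symmetric field along a circle about the axis. -/
theorem IsAxiallySymmetric.exists_components {v : ℝ → E3 → E3} {t : ℝ}
    (S : IsAxiallySymmetric (v t)) {r : ℝ} (hr : 0 < r) (z : ℝ) :
    ∃ a b c : ℝ, ∀ θ, vel v 0 (cyl t r z θ) = a * Real.cos θ - b * Real.sin θ ∧
      vel v 1 (cyl t r z θ) = a * Real.sin θ + b * Real.cos θ ∧ vel v 2 (cyl t r z θ) = c := by
  obtain ⟨f, g, h, H⟩ := S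
  refine ⟨f r z, g r z, h r z, fun θ => ?_⟩
  have e := H (cyl t r z θ).2 ((rad_cyl hr t z θ).symm ▸ hr)
  have hr' := hr.ne'
  have c0 : (cyl t r z θ).2 0 = r * Real.cos θ := rfl
  have c1 : (cyl t r z θ).2 1 = r * Real.sin θ := rfl
  have c2 : (cyl t r z θ).2 2 = z := rfl
  have i0 := congrArg (fun y : E3 => y 0) e
  have i1 := congrArg (fun y : E3 => y 1) e
  have i2 := congrArg (fun y : E3 => y 2) e
  simp only [eR, eTheta, eZ, rad_cyl hr, c0, c1, c2, PiLp.add_apply, PiLp.smul_apply,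
    smul_eq_mul] at i0 i1 i2
  refine ⟨?_, ?_, ?_⟩
  · refine i0.trans ?_
    simp
    field_simp
    ring
  · refine i1.trans ?_
    simp
    field_simp
  · refine i2.trans ?_
    simp

section

variable {T : ℝ} {v : ℝ → E3 → E3} {p : ℝ → E3 → ℝ}

theorem IsSmoothSolution.smooth_vel_offAxis (H : IsSmoothSolution T v p) (i : Fin 3) :
    ContDiffOn ℝ ∞ (vel v i) (offAxis T) :=
  (H.smooth_vel i).mono fun _ hq => hq.1

theorem IsSmoothSolution.smooth_press_offAxis (H : IsSmoothSolution T v p) :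
    ContDiffOn ℝ ∞ (press p) (offAxis T) :=
  H.smooth_press.mono fun _ hq => hq.1

/-- The angular derivatives of the Cartesian velocity components. -/
theorem IsSmoothSolution.ang_vel (H : IsSmoothSolution T v p)
    (S : ∀ t ∈ Ioo (-T) 0, IsAxiallySymmetric (v t)) {q : W} (hq : q ∈ offAxis T) :
    ang (vel v 0) q = (-1) * vel v 1 q ∧ ang (vel v 1) q = 1 * vel v 0 q ∧
      ang (vel v 2) q = 0 * vel v 2 q := by
  obtain ⟨θ, hθ⟩ := exists_cyl q
  obtain ⟨a, b, c, hc⟩ := (S q.1 hq.1.1).exists_components hq.2 (q.2 2)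
  have d := fun i => hasDerivAt_comp_cyl (t := q.1) (r := rad q.2) (z := q.2 2) (θ := θ)
    (differentiableAt_of_smoothOn (isOpen_offAxis T) (H.smooth_vel_offAxis i) (hθ ▸ hq))
  have d0 := d 0
  have d1 := d 1
  have d2 := d 2
  simp only [(hc _).1, (hc _).2.1, (hc _).2.2] at d0 d1 d2
  have e0 := d0.unique (((Real.hasDerivAt_cos θ).const_mul a).sub
    ((Real.hasDerivAt_sin θ).const_mul b))
  have e1 := d1.unique (((Real.hasDerivAt_sin θ).const_mul a).add
    ((Real.hasDerivAt_cos θ).const_mul b))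
  have e2 := d2.unique (hasDerivAt_const θ c)
  rw [← hθ] at e0 e1 e2
  refine ⟨?_, ?_, ?_⟩
  · rw [e0, hθ, (hc θ).2.1]
    ring
  · rw [e1, hθ, (hc θ).1]
    ring
  · rw [e2]
    ring

/-- The pressure of an axially symmetric flow is axially symmetric. -/
theorem IsSmoothSolution.ang_press (H : IsSmoothSolution T v p)
    (S : ∀ t ∈ Ioo (-T) 0, IsAxiallySymmetric (v t)) :
    ∀ q ∈ offAxis T, ang (press p) q = 0 := by
  have hO := isOpen_offAxis T
  have sv := H.smooth_vel_offAxis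
  have sp := H.smooth_press_offAxis
  have A0 : EqOn (ang (vel v 0)) (fun q => (-1) * vel v 1 q) (offAxis T) := fun q hq =>
    (H.ang_vel S hq).1
  have A1 : EqOn (ang (vel v 1)) (fun q => 1 * vel v 0 q) (offAxis T) := fun q hq =>
    (H.ang_vel S hq).2.1
  -- The momentum equation writes `∇p` through terms that all transform like the velocity under
  -- rotation, so `∇p` does as well.
  have key : ∀ (i j : Fin 3) (k : ℝ),
      EqOn (ang (vel v i)) (fun q => k * vel v j q) (offAxis T) →
      ∀ q ∈ offAxis T, ang (dirD (axis i) (press p)) q = k * dirD (axis j) (press p) q := by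
    intro i j k hA q hq
    have hp : ∀ i, EqOn (dirD (axis i) (press p)) (fun q => lap (vel v i) q
        - conv (vel v 0) (vel v 1) (vel v 2) (vel v i) q - dirD timeDir (vel v i) q)
        (offAxis T) := fun i q hq => by
      have := H.momentum_apply hq.1 i
      simp only [lap, conv]
      linear_combination -this
    have a := H.ang_vel S hq
    have D := fun {u : W → ℝ} (hu : ContDiffOn ℝ ∞ u (offAxis T)) =>
      differentiableAt_of_smoothOn hO hu hq
    have d1 := fun e => contDiffOn_dirD (e := e) hO (sv i)
    have d2 := fun e => contDiffOn_dirD (e := e) hO (d1 e)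
    have dl : DifferentiableAt ℝ (lap (vel v i)) q := D (((d2 _).add (d2 _)).add (d2 _))
    have dc : DifferentiableAt ℝ (conv (vel v 0) (vel v 1) (vel v 2) (vel v i)) q :=
      D ((((sv 0).mul (d1 _)).add ((sv 1).mul (d1 _))).add ((sv 2).mul (d1 _)))
    have dt := D (d1 timeDir)
    have el := ang_lap hO (sv i) (sv j) hA hq
    have ec := ang_conv hO (sv i) (sv j) hA (sv 0) (sv 1) (sv 2) hq
      (by rw [a.1]; ring) (by rw [a.2.1]; ring) (by rw [a.2.2]; ring)
    have et := ang_dirD_of_eqOn hO (sv i) (sv j) hA timeDir hq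
    rw [ang_congr hO (hp i) hq, hp j hq]
    rw [ang_eq_dirD] at el ec et ⊢
    rw [dirD_sub (by fun_prop) dt, dirD_sub dl dc, el, ec, et]
    simp
    ring
  -- Covariance of `∇p` makes the angular derivative of `x₁ ∂₂p - x₂ ∂₁p` vanish identically; this
  -- controls only the second angular derivative of `p`, and periodicity supplies the first.
  refine ang_eq_zero_of_ang_ang sp fun q hq => ?_
  have k0 := key 0 1 (-1) A0 q hq
  have k1 := key 1 0 1 A1 q hq
  have d0 := differentiableAt_of_smoothOn hO (contDiffOn_dirD (e := axis 0) hO sp) hq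
  have d1 := differentiableAt_of_smoothOn hO (contDiffOn_dirD (e := axis 1) hO sp) hq
  have c0 : DifferentiableAt ℝ (fun q : W => q.2 0) q :=
    differentiable_of_smooth (contDiff_coord 0) q
  have c1 : DifferentiableAt ℝ (fun q : W => q.2 1) q :=
    differentiable_of_smooth (contDiff_coord 1) q
  rw [ang_eq_dirD] at k0 k1 ⊢
  unfold ang
  rw [dirD_sub (by fun_prop) (by fun_prop), dirD_mul c0 d1, dirD_mul c1 d0, k0, k1, dirD_coord,
    dirD_coord]
  simp
  ring

/-- The squared norm of the velocity gradient, as a function on space-time. -/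
def gradNormSq (v : ℝ → E3 → E3) : W → ℝ := fun q => ∑ j, ∑ i, dirD (axis j) (vel v i) q ^ 2

/-- Rotation acts on both indices of the velocity gradient, and the Frobenius norm is invariant: the
nine terms of the angular derivative cancel. -/
theorem IsSmoothSolution.gradNormSq_cyl (H : IsSmoothSolution T v p)
    (S : ∀ t ∈ Ioo (-T) 0, IsAxiallySymmetric (v t)) {t r : ℝ} (ht : t ∈ Ioo (-T) 0) (hr : 0 < r)
    (z θ : ℝ) : gradNormSq v (cyl t r z θ) = gradNormSq v (cyl t r z 0) := by
  have hO := isOpen_offAxis T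
  have sv := H.smooth_vel_offAxis
  have sd := fun i j => contDiffOn_dirD (e := axis j) hO (sv i)
  have A0 : EqOn (ang (vel v 0)) (fun q => (-1) * vel v 1 q) (offAxis T) := fun q hq =>
    (H.ang_vel S hq).1
  have A1 : EqOn (ang (vel v 1)) (fun q => 1 * vel v 0 q) (offAxis T) := fun q hq =>
    (H.ang_vel S hq).2.1
  have A2 : EqOn (ang (vel v 2)) (fun q => 0 * vel v 2 q) (offAxis T) := fun q hq =>
    (H.ang_vel S hq).2.2
  refine eq_of_ang_eq_zero ?_ (fun q hq => ?_) ht hr z θ 0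
  · exact ContDiffOn.sum fun j _ => ContDiffOn.sum fun i _ => (sd i j).pow 2
  · have d := fun i j => differentiableAt_of_smoothOn hO (sd i j) hq
    have B0 := fun j : Fin 3 => ang_dirD_of_eqOn hO (sv 0) (sv 1) A0 (axis j) hq
    have B1 := fun j : Fin 3 => ang_dirD_of_eqOn hO (sv 1) (sv 0) A1 (axis j) hq
    have B2 := fun j : Fin 3 => ang_dirD_of_eqOn hO (sv 2) (sv 2) A2 (axis j) hq
    simp only [ang_eq_dirD] at B0 B1 B2 ⊢
    have e : gradNormSq v = fun q => dirD (axis 0) (vel v 0) q ^ 2 + dirD (axis 0) (vel v 1) q ^ 2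
        + dirD (axis 0) (vel v 2) q ^ 2 + dirD (axis 1) (vel v 0) q ^ 2
        + dirD (axis 1) (vel v 1) q ^ 2 + dirD (axis 1) (vel v 2) q ^ 2
        + dirD (axis 2) (vel v 0) q ^ 2 + dirD (axis 2) (vel v 1) q ^ 2
        + dirD (axis 2) (vel v 2) q ^ 2 := by
      funext q
      simp only [gradNormSq, Fin.sum_univ_three]
      ring
    have d00 := d 0 0
    have d01 := d 0 1
    have d02 := d 0 2
    have d10 := d 1 0
    have d11 := d 1 1
    have d12 := d 1 2
    have d20 := d 2 0
    have d21 := d 2 1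
    have d22 := d 2 2
    rw [e]
    simp (disch := fun_prop) only [dirD_add, dirD_sq, B0, B1, B2]
    simp
    ring

/-! ### Parabolic rescaling onto the half-plane -/

/-- The linear part of the parabolic rescaling. -/
def scaleMap (l : ℝ) : Z →L[ℝ] W :=
  (l ^ 2 • ContinuousLinearMap.fst ℝ ℝ (ℝ × ℝ)).smulRight timeDir
    + (l • (ContinuousLinearMap.fst ℝ ℝ ℝ).comp
      (ContinuousLinearMap.snd ℝ ℝ (ℝ × ℝ))).smulRight (axis 0)
    + (l • (ContinuousLinearMap.snd ℝ ℝ ℝ).comp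
      (ContinuousLinearMap.snd ℝ ℝ (ℝ × ℝ))).smulRight (axis 2)

/-- The parabolic rescaling of the half-plane `x₁ > 0, x₂ = 0`. -/
def rescale (l t z : ℝ) (q : Z) : W := (t, z • EuclideanSpace.single 2 1) + scaleMap l q

theorem rescale_eq_cyl (l t z : ℝ) (q : Z) :
    rescale l t z q = cyl (t + l ^ 2 * q.1) (l * q.2.1) (z + l * q.2.2) 0 := by
  refine Prod.ext ?_ ?_
  · simp [rescale, scaleMap, cyl]
  · ext i
    fin_cases i <;> simp [rescale, scaleMap, cyl]

theorem contDiff_rescale (l t z : ℝ) : ContDiff ℝ ∞ (rescale l t z) :=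
  contDiff_const.add (scaleMap l).contDiff

theorem dirD_comp_rescale {u : W → ℝ} {k l t z : ℝ} {q : Z}
    (hu : DifferentiableAt ℝ u (rescale l t z q)) (e : Z) :
    dirD e (fun q => k * u (rescale l t z q)) q
      = k * dirD (scaleMap l e) u (rescale l t z q) := by
  have h1 : HasFDerivAt (rescale l t z) (scaleMap l) q := (scaleMap l).hasFDerivAt.const_add _
  have h2 := (hu.hasFDerivAt.comp q h1).const_mul k
  rw [dirD]
  erw [h2.fderiv]
  rfl

/-- The set on which the rescaled components are defined. -/
def rescaleDomain (T l t : ℝ) : Set Z := {q | t + l ^ 2 * q.1 ∈ Ioo (-T) 0 ∧ 0 < q.2.1}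

theorem isOpen_rescaleDomain (T l t : ℝ) : IsOpen (rescaleDomain T l t) :=
  (isOpen_Ioo.preimage (by fun_prop : Continuous fun q : Z => t + l ^ 2 * q.1)).inter
    (isOpen_lt continuous_const (by fun_prop : Continuous fun q : Z => q.2.1))

theorem rescale_mem_offAxis {l : ℝ} (hl : 0 < l) {t : ℝ} (z : ℝ) {q : Z}
    (hq : q ∈ rescaleDomain T l t) : rescale l t z q ∈ offAxis T := by
  rw [rescale_eq_cyl]
  exact cyl_mem_offAxis hq.1 (mul_pos hl hq.2) _ _

theorem contDiffOn_comp_rescale {u : W → ℝ} (hu : ContDiffOn ℝ ∞ u (offAxis T)) {l : ℝ}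
    (hl : 0 < l) (k t z : ℝ) :
    ContDiffOn ℝ ∞ (fun q => k * u (rescale l t z q)) (rescaleDomain T l t) :=
  contDiffOn_const.mul (hu.comp (contDiff_rescale l t z).contDiffOn fun _ hq =>
    rescale_mem_offAxis hl z hq)

theorem dirD_comp_rescale_eqOn {u : W → ℝ} (hu : ContDiffOn ℝ ∞ u (offAxis T)) {l : ℝ}
    (hl : 0 < l) (k t z : ℝ) :
    EqOn (dS fun q => k * u (rescale l t z q))
      (fun q => (k * l ^ 2) * dirD timeDir u (rescale l t z q)) (rescaleDomain T l t) ∧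
    EqOn (dR fun q => k * u (rescale l t z q))
      (fun q => (k * l) * dirD (axis 0) u (rescale l t z q)) (rescaleDomain T l t) ∧
    EqOn (dZ fun q => k * u (rescale l t z q))
      (fun q => (k * l) * dirD (axis 2) u (rescale l t z q)) (rescaleDomain T l t) := by
  have d := fun q (hq : q ∈ rescaleDomain T l t) =>
    differentiableAt_of_smoothOn (isOpen_offAxis T) hu (rescale_mem_offAxis hl z hq)
  refine ⟨fun q hq => ?_, fun q hq => ?_, fun q hq => ?_⟩ <;>
  · simp only [dS, dR, dZ]
    rw [dirD_comp_rescale (d q hq)]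
    simp only [scaleMap, dirD, _root_.add_apply, ContinuousLinearMap.smulRight_apply,
      map_add, map_smul]
    simp
    ring

/-- The rescaled components of an axially symmetric solution form an `AxiSystem`. -/
theorem IsSmoothSolution.axiSystem (H : IsSmoothSolution T v p)
    (S : ∀ t ∈ Ioo (-T) 0, IsAxiallySymmetric (v t)) {l : ℝ} (hl : 0 < l) (t z : ℝ) :
    AxiSystem (rescaleDomain T l t) (fun q => l * vel v 0 (rescale l t z q))
      (fun q => l * vel v 1 (rescale l t z q)) (fun q => l * vel v 2 (rescale l t z q))
      (fun q => l ^ 2 * press p (rescale l t z q)) := by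
  have hO := isOpen_offAxis T
  have hO' := isOpen_rescaleDomain T l t
  have sv := H.smooth_vel_offAxis
  have sp := H.smooth_press_offAxis
  have sd := fun i j => contDiffOn_dirD (e := axis j) hO (sv i)
  have D1 := fun i => dirD_comp_rescale_eqOn (sv i) hl l t z
  have DP := dirD_comp_rescale_eqOn sp hl (l ^ 2) t z
  have DRR : ∀ i, ∀ q ∈ rescaleDomain T l t, dR (dR fun q => l * vel v i (rescale l t z q)) q
      = l * l * l * dirD (axis 0) (dirD (axis 0) (vel v i)) (rescale l t z q) := fun i q hq =>
    (dirD_eqOn hO' (D1 i).2.1 _ hq).trans ((dirD_comp_rescale_eqOn (sd i 0) hl (l * l) t z).2.1 hq)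
  have DZZ : ∀ i, ∀ q ∈ rescaleDomain T l t, dZ (dZ fun q => l * vel v i (rescale l t z q)) q
      = l * l * l * dirD (axis 2) (dirD (axis 2) (vel v i)) (rescale l t z q) := fun i q hq =>
    (dirD_eqOn hO' (D1 i).2.2 _ hq).trans ((dirD_comp_rescale_eqOn (sd i 2) hl (l * l) t z).2.2 hq)
  have A0 : EqOn (ang (vel v 0)) (fun q => (-1) * vel v 1 q) (offAxis T) := fun q hq =>
    (H.ang_vel S hq).1
  have A1 : EqOn (ang (vel v 1)) (fun q => 1 * vel v 0 q) (offAxis T) := fun q hq =>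
    (H.ang_vel S hq).2.1
  have A2 : EqOn (ang (vel v 2)) (fun q => 0 * vel v 2 q) (offAxis T) := fun q hq =>
    (H.ang_vel S hq).2.2
  have c0 : ∀ q, (rescale l t z q).2 0 = l * q.2.1 := fun q => by simp [rescale_eq_cyl, cyl]
  have c1 : ∀ q, (rescale l t z q).2 1 = 0 := fun q => by simp [rescale_eq_cyl, cyl]
  -- On the half-plane `x₂ = 0` the angular derivative is `r ∂₂`. The symmetry relations therefore
  -- express first and second `x₂`-derivatives through the other quantities, and this is where the
  -- `1/r` terms of the cylindrical equations come from.
  have angR : ∀ u q, ang u (rescale l t z q) = l * q.2.1 * dirD (axis 1) u (rescale l t z q) :=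
    fun u q => by simp [ang, c0, c1]
  -- The `B` relations, for `∂₂` of the components, fix the second `x₂`-derivatives; the `C`
  -- relations, for the components themselves, fix the first.
  have B0 := fun q (hq : q ∈ rescaleDomain T l t) =>
    ang_dirD_of_eqOn hO (sv 0) (sv 1) A0 (axis 1) (rescale_mem_offAxis hl z hq)
  have B1 := fun q (hq : q ∈ rescaleDomain T l t) =>
    ang_dirD_of_eqOn hO (sv 1) (sv 0) A1 (axis 1) (rescale_mem_offAxis hl z hq)
  have B2 := fun q (hq : q ∈ rescaleDomain T l t) =>
    ang_dirD_of_eqOn hO (sv 2) (sv 2) A2 (axis 1) (rescale_mem_offAxis hl z hq)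
  have C0 := fun q (hq : q ∈ rescaleDomain T l t) => A0 (rescale_mem_offAxis hl z hq)
  have C1 := fun q (hq : q ∈ rescaleDomain T l t) => A1 (rescale_mem_offAxis hl z hq)
  have C2 := fun q (hq : q ∈ rescaleDomain T l t) => A2 (rescale_mem_offAxis hl z hq)
  have CP := fun q (hq : q ∈ rescaleDomain T l t) =>
    H.ang_press S _ (rescale_mem_offAxis hl z hq)
  simp only [angR] at B0 B1 B2 C0 C1 C2 CP
  have a1 : (EuclideanSpace.single 1 1 : E3) 0 = 0 := by simp
  have a2 : (EuclideanSpace.single 1 1 : E3) 1 = 1 := by simp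
  simp only [a1, a2] at B0 B1 B2
  have V := fun i q (hq : q ∈ rescaleDomain T l t) =>
    H.momentum_apply (rescale_mem_offAxis hl z hq).1 i
  have hl' := hl.ne'
  refine ⟨hO', fun q hq => hq.2, contDiffOn_comp_rescale (sv 0) hl _ _ _,
    contDiffOn_comp_rescale (sv 1) hl _ _ _, contDiffOn_comp_rescale (sv 2) hl _ _ _,
    contDiffOn_comp_rescale sp hl _ _ _, fun q hq => ?_, fun q hq => ?_, fun q hq => ?_,
    fun q hq => ?_⟩
  · have hr := hq.2.ne'
    rw [(D1 0).2.1 hq, (D1 2).2.2 hq]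
    have h1 := H.div_eq (rescale_mem_offAxis hl z hq).1
    have h2 := C1 q hq
    field_simp
    linear_combination l ^ 2 * q.2.1 * h1 - l * h2
  · have hr := hq.2.ne'
    simp only [DRR 0 q hq, DZZ 0 q hq]
    rw [(D1 0).1 hq, (D1 0).2.1 hq, (D1 0).2.2 hq, DP.2.1 hq]
    have h0 := V 0 q hq
    have h1 := C0 q hq
    have h2 := B0 q hq
    have h3 := C1 q hq
    beta_reduce
    generalize rescale l t z q = Q at *
    generalize dirD (axis 1) (dirD (axis 1) (vel v 0)) Q = x11 at *
    generalize dirD (axis 1) (vel v 0) Q = x1 at *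
    generalize dirD (axis 1) (vel v 1) Q = y1 at *
    field_simp
    linear_combination -(l ^ 3 * q.2.1 ^ 2) * h0 + l ^ 2 * q.2.1 * h2 - l * h3
      - l ^ 2 * q.2.1 * vel v 1 Q * h1
  · have hr := hq.2.ne'
    simp only [DRR 1 q hq, DZZ 1 q hq]
    rw [(D1 1).1 hq, (D1 1).2.1 hq, (D1 1).2.2 hq]
    have h0 := V 1 q hq
    have h1 := C1 q hq
    have h2 := B1 q hq
    have h3 := C0 q hq
    have h4 := CP q hq
    beta_reduce
    generalize rescale l t z q = Q at *
    generalize dirD (axis 1) (dirD (axis 1) (vel v 1)) Q = x11 at *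
    generalize dirD (axis 1) (vel v 1) Q = x1 at *
    generalize dirD (axis 1) (vel v 0) Q = y1 at *
    field_simp
    linear_combination -(l ^ 3 * q.2.1 ^ 2) * h0 + l ^ 2 * q.2.1 * h2 + l * h3
      - l ^ 2 * q.2.1 * vel v 1 Q * h1 - l ^ 2 * q.2.1 * h4
  · have hr := hq.2.ne'
    simp only [DRR 2 q hq, DZZ 2 q hq]
    rw [(D1 2).1 hq, (D1 2).2.1 hq, (D1 2).2.2 hq, DP.2.2 hq]
    have h0 := V 2 q hq
    have h1 := C2 q hq
    have h2 := B2 q hq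
    beta_reduce
    generalize rescale l t z q = Q at *
    generalize dirD (axis 1) (dirD (axis 1) (vel v 2)) Q = x11 at *
    generalize dirD (axis 1) (vel v 2) Q = x1 at *
    field_simp
    linear_combination -(l ^ 3 * q.2.1) * h0 + l ^ 2 * h2 - l ^ 2 * vel v 1 Q * h1

end

/-! ### Integrals in cylindrical coordinates -/

theorem measurePreserving_cartesian :
    MeasurePreserving fun p : ℝ × ℝ × ℝ => (!₂[p.2.1, p.2.2, p.1] : E3) := by
  have h1 := (volume_preserving_finTwoArrow ℝ).symm
  have h2 := (MeasurePreserving.id (volume : Measure ℝ)).prod h1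
  have h3 := (volume_preserving_piFinSuccAbove (fun _ : Fin 3 => ℝ) 2).symm
  have h4 := (EuclideanSpace.volume_preserving_symm_measurableEquiv_toLp (Fin 3)).symm
  have e : (fun p : ℝ × ℝ × ℝ => (!₂[p.2.1, p.2.2, p.1] : E3))
      = (MeasurableEquiv.toLp 2 (Fin 3 → ℝ)).symm.symm
        ∘ (MeasurableEquiv.piFinSuccAbove (fun _ : Fin 3 => ℝ) 2).symm
        ∘ Prod.map id (MeasurableEquiv.finTwoArrow (α := ℝ)).symm := by
    funext p
    ext i
    fin_cases i <;> rfl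
  rw [e]
  exact h4.comp (h3.comp h2)

theorem lintegral_comp_affine (c : ℝ) {a : ℝ} (ha : 0 < a) (φ : ℝ → ℝ≥0∞) :
    ∫⁻ s, φ (c + a * s) = ENNReal.ofReal a⁻¹ * ∫⁻ t, φ t := by
  have e1 : MeasurableEmbedding fun s : ℝ => a * s :=
    (Homeomorph.mulLeft₀ a ha.ne').measurableEmbedding
  have h1 := e1.lintegral_map (μ := volume) fun s => φ (c + s)
  rw [← h1, Real.map_volume_mul_left ha.ne', lintegral_smul_measure, abs_of_pos (inv_pos.2 ha),
    lintegral_add_left_eq_self φ c, smul_eq_mul]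

/-- Cylindrical coordinates for the integral of an axially symmetric function. -/
theorem two_mul_lintegral_cylindrical_le {G : E3 → ℝ≥0∞} (hG : Measurable G)
    (hs : ∀ r z θ : ℝ, 0 < r → G !₂[r * Real.cos θ, r * Real.sin θ, z] = G !₂[r, 0, z]) :
    2 * ∫⁻ z, ∫⁻ r in Ioi (0 : ℝ), ENNReal.ofReal r * G !₂[r, 0, z] ≤ ∫⁻ x, G x := by
  have hm : Measurable fun p : ℝ × ℝ × ℝ => G !₂[p.2.1, p.2.2, p.1] :=
    hG.comp (by fun_prop)
  have e1 : ∫⁻ x, G x = ∫⁻ z, ∫⁻ y : ℝ × ℝ, G !₂[y.1, y.2, z] := by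
    rw [← measurePreserving_cartesian.lintegral_comp hG, Measure.volume_eq_prod,
      lintegral_prod _ hm.aemeasurable]
  have e2 : ∀ z, 2 * ∫⁻ r in Ioi (0 : ℝ), ENNReal.ofReal r * G !₂[r, 0, z]
      ≤ ∫⁻ y : ℝ × ℝ, G !₂[y.1, y.2, z] := fun z => by
    have hr : Measurable fun r : ℝ => ENNReal.ofReal r * G !₂[r, 0, z] :=
      ENNReal.measurable_ofReal.mul (hG.comp (by fun_prop))
    rw [← lintegral_comp_polarCoord_symm]
    have e3 : ∫⁻ y in polarCoord.target, ENNReal.ofReal y.1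
          • G !₂[(polarCoord.symm y).1, (polarCoord.symm y).2, z]
        = ∫⁻ y in polarCoord.target, ENNReal.ofReal y.1 * G !₂[y.1, 0, z] := by
      refine setLIntegral_congr_fun polarCoord.open_target.measurableSet fun y hy => ?_
      simp only [polarCoord_symm_apply, smul_eq_mul]
      rw [hs _ _ _ hy.1]
    have hr2 : Measurable fun y : ℝ × ℝ => ENNReal.ofReal y.1 * G !₂[y.1, 0, z] :=
      hr.comp measurable_fst
    rw [e3, polarCoord_target, Measure.volume_eq_prod, ← Measure.prod_restrict,
      lintegral_prod _ hr2.aemeasurable]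
    simp only [lintegral_const, Measure.restrict_apply_univ, Real.volume_Ioo]
    rw [lintegral_mul_const _ hr, mul_comm]
    -- The angular length `2π` is replaced by the lower bound 2.
    gcongr
    rw [show (2 : ℝ≥0∞) = ENNReal.ofReal 2 by simp]
    exact ENNReal.ofReal_le_ofReal (by linarith [Real.pi_gt_three])
  rw [e1, ← lintegral_const_mul' _ _ (by simp)]
  exact lintegral_mono e2

/-- The integral of an axially symmetric function controls its integral over a rescaled square in
the half-plane. -/
theorem lintegral_square_rescale_le {G : E3 → ℝ≥0∞} (hG : Measurable G)
    (hs : ∀ r z θ : ℝ, 0 < r → G !₂[r * Real.cos θ, r * Real.sin θ, z] = G !₂[r, 0, z]) {l : ℝ}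
    (hl : 0 < l) (z : ℝ) :
    ∫⁻ x in square (1 / 2), G !₂[l * x.1, 0, z + l * x.2]
      ≤ ENNReal.ofReal (l⁻¹ ^ 3) * ∫⁻ x, G x := by
  -- The weighted integrand is extended by zero to `r ≤ 0`, so that affine substitutions can be made
  -- on the whole line.
  set k : ℝ → ℝ → ℝ≥0∞ := fun r y =>
    (Ioi (0 : ℝ)).indicator (fun r => ENNReal.ofReal r * G !₂[r, 0, y]) r with hk
  have hk' : ∀ y, ∫⁻ r, k r y = ∫⁻ r in Ioi (0 : ℝ), ENNReal.ofReal r * G !₂[r, 0, y] := fun y =>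
    lintegral_indicator measurableSet_Ioi _
  have b1 : ∫⁻ x in square (1 / 2), G !₂[l * x.1, 0, z + l * x.2]
      ≤ ∫⁻ x in square (1 / 2), ENNReal.ofReal (2 * l⁻¹) * k (0 + l * x.1) (z + l * x.2) := by
    refine setLIntegral_mono' (isCompact_square _).measurableSet fun x hx => ?_
    have h1 : (1 - 1 / 2 : ℝ) ≤ x.1 := hx.1.1
    have h2 : 0 < l * x.1 := mul_pos hl (by linarith)
    simp only [hk, zero_add, indicator_of_mem (show l * x.1 ∈ Ioi (0 : ℝ) from h2)]
    rw [← mul_assoc, ← ENNReal.ofReal_mul (by positivity)]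
    refine le_mul_of_one_le_left' ?_
    rw [ENNReal.one_le_ofReal]
    field_simp
    linarith
  have b2 : ∫⁻ x : ℝ × ℝ, k (0 + l * x.1) (z + l * x.2)
      = ENNReal.ofReal l⁻¹ * (ENNReal.ofReal l⁻¹ * ∫⁻ y, ∫⁻ r, k r y) := by
    have hm : Measurable fun x : ℝ × ℝ => k (0 + l * x.1) (z + l * x.2) := by
      have h0 : Measurable fun x : ℝ × ℝ => k x.1 x.2 := by
        have : (fun x : ℝ × ℝ => k x.1 x.2) = (Prod.fst ⁻¹' Ioi (0 : ℝ)).indicator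
            fun x => ENNReal.ofReal x.1 * G !₂[x.1, 0, x.2] := by
          funext x
          simp [hk, indicator]
        rw [this]
        refine Measurable.indicator ?_ (measurable_fst measurableSet_Ioi)
        exact (ENNReal.measurable_ofReal.comp measurable_fst).mul (hG.comp (by fun_prop))
      exact h0.comp (f := fun x : ℝ × ℝ => (0 + l * x.1, z + l * x.2)) (by fun_prop)
    rw [Measure.volume_eq_prod, lintegral_prod_symm _ hm.aemeasurable]
    have h1 : ∀ y, ∫⁻ r, k (0 + l * r) (z + l * y) = ENNReal.ofReal l⁻¹ * ∫⁻ r, k r (z + l * y) :=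
      fun y => lintegral_comp_affine 0 hl fun r => k r (z + l * y)
    simp only [h1]
    rw [lintegral_const_mul' _ _ ENNReal.ofReal_ne_top, lintegral_comp_affine z hl fun y => ∫⁻ r, k r y]
  have b3 := two_mul_lintegral_cylindrical_le hG hs
  simp only [← hk'] at b3
  calc _ ≤ _ := b1
    _ ≤ ∫⁻ x : ℝ × ℝ, ENNReal.ofReal (2 * l⁻¹) * k (0 + l * x.1) (z + l * x.2) :=
        setLIntegral_le_lintegral _ _
    _ = ENNReal.ofReal (l⁻¹ ^ 3) * (2 * ∫⁻ y, ∫⁻ r, k r y) := by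
        rw [lintegral_const_mul' _ _ ENNReal.ofReal_ne_top, b2, ENNReal.ofReal_mul (by norm_num),
          ENNReal.ofReal_pow (by positivity)]
        simp
        ring
    _ ≤ _ := by gcongr

/-! ### The energy bounds for the rescaled components -/

/-- The squared speed, as a function on space-time. -/
def speedSq (v : ℝ → E3 → E3) : W → ℝ := fun q => vel v 0 q ^ 2 + vel v 1 q ^ 2 + vel v 2 q ^ 2

theorem enorm_sq_eq (y : E3) : ‖y‖ₑ ^ 2 = ENNReal.ofReal (y 0 ^ 2 + y 1 ^ 2 + y 2 ^ 2) := by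
  rw [← ofReal_norm, ← ENNReal.ofReal_pow (norm_nonneg _), EuclideanSpace.real_norm_sq_eq,
    Fin.sum_univ_three]

theorem eLpNorm_two_sq (u : E3 → E3) : eLpNorm u 2 volume ^ 2 = ∫⁻ x, ‖u x‖ₑ ^ 2 := by
  have := eLpNorm_nnreal_pow_eq_lintegral (f := u) (μ := volume) (p := 2) (by norm_num)
  simpa using this

variable {T : ℝ} {v : ℝ → E3 → E3} {p : ℝ → E3 → ℝ}

theorem IsAxiallySymmetric.speedSq_cyl {t : ℝ} (S : IsAxiallySymmetric (v t)) {r : ℝ} (hr : 0 < r)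
    (z θ : ℝ) : speedSq v (cyl t r z θ) = speedSq v (cyl t r z 0) := by
  obtain ⟨a, b, c, hc⟩ := S.exists_components hr z
  simp only [speedSq, (hc _).1, (hc _).2.1, (hc _).2.2, Real.cos_zero, Real.sin_zero]
  linear_combination (a ^ 2 + b ^ 2) * Real.sin_sq_add_cos_sq θ

theorem IsSmoothSolution.gradSq_eq (H : IsSmoothSolution T v p) {q : W} (hq : q ∈ slab T) :
    gradSq (v q.1) q.2 = ENNReal.ofReal (gradNormSq v q) := by
  simp only [gradSq, enorm_sq_eq, H.partialD_apply hq, gradNormSq]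
  rw [ENNReal.ofReal_sum_of_nonneg fun j _ => by positivity]
  simp only [Fin.sum_univ_three]

theorem cyl_zero (t r z : ℝ) : cyl t r z 0 = (t, !₂[r, 0, z]) := by simp [cyl]

/-- A rotation invariant function on space-time has controlled integrals over rescaled squares. -/
theorem lintegral_square_comp_rescale_le {w : W → ℝ} {τ : ℝ}
    (hc : Continuous fun x => w (τ, x))
    (hs : ∀ r z θ : ℝ, 0 < r → w (cyl τ r z θ) = w (cyl τ r z 0)) {l : ℝ} (hl : 0 < l)
    {t s : ℝ} (hτ : t + l ^ 2 * s = τ) (z : ℝ) :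
    ∫⁻ x in square (1 / 2), ENNReal.ofReal (w (rescale l t z (s, x)))
      ≤ ENNReal.ofReal (l⁻¹ ^ 3) * ∫⁻ x, ENNReal.ofReal (w (τ, x)) := by
  have h := lintegral_square_rescale_le (G := fun x => ENNReal.ofReal (w (τ, x)))
    (ENNReal.measurable_ofReal.comp hc.measurable) (fun r z θ hr => by
      have := hs r z θ hr
      rw [cyl_zero] at this
      exact congrArg ENNReal.ofReal this) hl z
  simpa only [rescale_eq_cyl, hτ, cyl_zero] using h

theorem IsSmoothSolution.continuous_slice {u : W → ℝ} (hu : ContDiffOn ℝ ∞ u (slab T)) {τ : ℝ}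
    (hτ : τ ∈ Ioo (-T) 0) : Continuous fun x => u (τ, x) :=
  hu.continuousOn.comp_continuous (by fun_prop) fun _ => ⟨hτ, trivial⟩

theorem IsSmoothSolution.smooth_gradNormSq (H : IsSmoothSolution T v p) :
    ContDiffOn ℝ ∞ (gradNormSq v) (slab T) :=
  ContDiffOn.sum fun _ _ => ContDiffOn.sum fun i _ =>
    (contDiffOn_dirD (isOpen_slab T) (H.smooth_vel i)).pow 2

theorem IsSmoothSolution.smooth_speedSq (H : IsSmoothSolution T v p) :
    ContDiffOn ℝ ∞ (speedSq v) (slab T) :=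
  (((H.smooth_vel 0).pow 2).add ((H.smooth_vel 1).pow 2)).add ((H.smooth_vel 2).pow 2)

theorem IsLerayHopf.lintegral_speedSq_le {v₀ : E3 → E3} (L : IsLerayHopf T v₀ v) {E : ℝ}
    (hE : eLpNorm v₀ 2 volume ^ 2 ≤ ENNReal.ofReal E) {τ : ℝ} (hτ : τ ∈ Ioo (-T) 0) :
    ∫⁻ x, ENNReal.ofReal (speedSq v (τ, x)) ≤ ENNReal.ofReal E := by
  refine le_trans (le_trans ?_ (L.energy τ hτ)) hE
  rw [eLpNorm_two_sq]
  simp only [enorm_sq_eq]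
  exact le_self_add

theorem IsLerayHopf.lintegral_gradNormSq_le {v₀ : E3 → E3} (L : IsLerayHopf T v₀ v)
    (H : IsSmoothSolution T v p) {E : ℝ} (hE : eLpNorm v₀ 2 volume ^ 2 ≤ ENNReal.ofReal E) {τ : ℝ}
    (hτ : τ ∈ Ioo (-T) 0) :
    ∫⁻ s in Ioo (-T) τ, ∫⁻ x, ENNReal.ofReal (gradNormSq v (s, x)) ≤ ENNReal.ofReal E := by
  have e : ∫⁻ s in Ioo (-T) τ, ∫⁻ x, ENNReal.ofReal (gradNormSq v (s, x))
      = ∫⁻ s in Ioo (-T) τ, ∫⁻ x, gradSq (v s) x :=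
    setLIntegral_congr_fun measurableSet_Ioo fun s hs => lintegral_congr fun x =>
      (H.gradSq_eq (q := (s, x)) ⟨⟨hs.1, hs.2.trans hτ.2⟩, trivial⟩).symm
  rw [e]
  refine le_trans (le_trans ?_ (L.energy τ hτ)) hE
  refine le_trans ?_ le_add_self
  exact le_mul_of_one_le_left' (by norm_num)

/-- The pointwise bound in the half-plane, in terms of the initial energy. -/
theorem exists_halfplane_bound : ∃ C : ℝ, 0 ≤ C ∧ ∀ (E T : ℝ) (v₀ : E3 → E3) (v : ℝ → E3 → E3)
    (p : ℝ → E3 → ℝ), 1 ≤ E → eLpNorm v₀ 2 volume ^ 2 ≤ ENNReal.ofReal E →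
    IsSmoothSolution T v p → (∀ t ∈ Ioo (-T) 0, IsAxiallySymmetric (v t)) → IsLerayHopf T v₀ v →
    ∀ l t z : ℝ, 0 < l → l ≤ 1 / 2 → -T < t - l ^ 2 / 2 → t < 0 →
      |vel v 0 (cyl t l z 0)| + |vel v 2 (cyl t l z 0)|
        ≤ C * E * Real.sqrt (Real.log (6 * (E / l))) / l ^ 2 := by
  obtain ⟨C, C0, hC⟩ := exists_unit_velocity_bound
  -- The factor 6 is the one by which the unit flow enlarges the energy bound.
  refine ⟨6 * C, by positivity, fun E T v₀ v p hE1 hE H S L l t z hl hl2 hT ht => ?_⟩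
  have hsys := H.axiSystem S hl t z
  have hbox : box (1 / 2) ⊆ rescaleDomain T l t := fun q hq => by
    have h1 : -(1 / 2) ≤ q.1 := hq.1.1
    have h2 : q.1 ≤ 0 := hq.1.2
    have h3 : (1 - 1 / 2 : ℝ) ≤ q.2.1 := hq.2.1.1
    have h4 : 0 < l ^ 2 := by positivity
    exact ⟨⟨by nlinarith, by nlinarith⟩, by linarith⟩
  have time : ∀ s ∈ Icc (-(1 / 2) : ℝ) 0, t + l ^ 2 * s ∈ Ioo (-T) 0 := fun s hs => by
    have h1 := hs.1
    have h2 := hs.2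
    have h4 : 0 < l ^ 2 := by positivity
    exact ⟨by nlinarith, by nlinarith⟩
  have hA : 1 ≤ E / l := by
    rw [le_div_iff₀ hl]
    linarith
  -- Scaling count: `l²` from the squared velocity and `l⁻³` from the change of variables.
  have b1 : ∀ s ∈ Icc (-(1 / 2) : ℝ) 0, ∫⁻ x in square (1 / 2),
      ENNReal.ofReal ((l * vel v 0 (rescale l t z (s, x))) ^ 2
        + (l * vel v 1 (rescale l t z (s, x))) ^ 2 + (l * vel v 2 (rescale l t z (s, x))) ^ 2)
      ≤ ENNReal.ofReal (E / l) := fun s hs => by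
    have hτ := time s hs
    have k1 := lintegral_square_comp_rescale_le (w := speedSq v)
      (IsSmoothSolution.continuous_slice H.smooth_speedSq hτ)
      (fun r z θ hr => (S _ hτ).speedSq_cyl hr z θ) hl rfl z
    have k2 := L.lintegral_speedSq_le hE hτ
    calc _ = ∫⁻ x in square (1 / 2), ENNReal.ofReal (l ^ 2)
            * ENNReal.ofReal (speedSq v (rescale l t z (s, x))) := by
          refine lintegral_congr fun x => ?_
          rw [← ENNReal.ofReal_mul (by positivity), speedSq]
          ring_nf
      _ = ENNReal.ofReal (l ^ 2) * ∫⁻ x in square (1 / 2),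
            ENNReal.ofReal (speedSq v (rescale l t z (s, x))) :=
          lintegral_const_mul' _ _ ENNReal.ofReal_ne_top
      _ ≤ ENNReal.ofReal (l ^ 2) * (ENNReal.ofReal (l⁻¹ ^ 3) * ENNReal.ofReal E) := by
          gcongr
          exact k1.trans (by gcongr)
      _ = _ := by
          rw [← ENNReal.ofReal_mul (by positivity), ← ENNReal.ofReal_mul (by positivity)]
          congr 1
          field_simp
  -- Scaling count: `l⁴` from the squared gradient, `l⁻³` from space and `l⁻²` from time.
  have b2 : ∫⁻ q in box (1 / 2), ENNReal.ofReal (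
      dR (fun q => l * vel v 0 (rescale l t z q)) q ^ 2
      + dZ (fun q => l * vel v 0 (rescale l t z q)) q ^ 2
      + dR (fun q => l * vel v 1 (rescale l t z q)) q ^ 2
      + dZ (fun q => l * vel v 1 (rescale l t z q)) q ^ 2
      + dR (fun q => l * vel v 2 (rescale l t z q)) q ^ 2
      + dZ (fun q => l * vel v 2 (rescale l t z q)) q ^ 2) ≤ ENNReal.ofReal (E / l) := by
    have mbx : MeasurableSet (box (1 / 2)) := (isCompact_box _).measurableSet
    have D := fun i => dirD_comp_rescale_eqOn (H.smooth_vel_offAxis i) hl l t z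
    have cg : ContinuousOn (fun q => ENNReal.ofReal (gradNormSq v (rescale l t z q)))
        (box (1 / 2)) :=
      ENNReal.continuous_ofReal.comp_continuousOn (H.smooth_gradNormSq.continuousOn.comp
        (contDiff_rescale l t z).continuous.continuousOn fun q hq =>
          (rescale_mem_offAxis hl z (hbox hq)).1)
    -- The endpoint `t / 2` lies strictly between `t` and 0: the open interval then contains the
    -- final time `t`, and the energy inequality is available at its right end.
    set Φ : ℝ → ℝ≥0∞ := (Ioo (-T) (t / 2)).indicator fun s =>
      ∫⁻ x, ENNReal.ofReal (gradNormSq v (s, x)) with hΦ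
    calc _ ≤ ∫⁻ q in box (1 / 2), ENNReal.ofReal (l ^ 4)
            * ENNReal.ofReal (gradNormSq v (rescale l t z q)) := by
          refine setLIntegral_mono' mbx fun q hq => ?_
          rw [← ENNReal.ofReal_mul (by positivity)]
          refine ENNReal.ofReal_le_ofReal ?_
          simp only [(D 0).2.1 (hbox hq), (D 0).2.2 (hbox hq), (D 1).2.1 (hbox hq),
            (D 1).2.2 (hbox hq), (D 2).2.1 (hbox hq), (D 2).2.2 (hbox hq), gradNormSq,
            Fin.sum_univ_three]
          have : 0 ≤ l ^ 4 * (dirD (axis 1) (vel v 0) (rescale l t z q) ^ 2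
            + dirD (axis 1) (vel v 1) (rescale l t z q) ^ 2
            + dirD (axis 1) (vel v 2) (rescale l t z q) ^ 2) := by positivity
          linarith
      _ = ENNReal.ofReal (l ^ 4) * ∫⁻ q in box (1 / 2),
            ENNReal.ofReal (gradNormSq v (rescale l t z q)) :=
          lintegral_const_mul' _ _ ENNReal.ofReal_ne_top
      _ = ENNReal.ofReal (l ^ 4) * ∫⁻ s in Icc (-(1 / 2)) 0, ∫⁻ x in square (1 / 2),
            ENNReal.ofReal (gradNormSq v (rescale l t z (s, x))) := by
          have := cg.aemeasurable mbx (μ := volume)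
          rw [box, Measure.volume_eq_prod, ← Measure.prod_restrict] at *
          rw [lintegral_prod _ this]
      _ ≤ ENNReal.ofReal (l ^ 4) * ∫⁻ s in Icc (-(1 / 2)) 0,
            ENNReal.ofReal (l⁻¹ ^ 3) * Φ (t + l ^ 2 * s) := by
          gcongr ENNReal.ofReal (l ^ 4) * ?_
          refine setLIntegral_mono' measurableSet_Icc fun s hs => ?_
          have hτ := time s hs
          have hm : t + l ^ 2 * s ∈ Ioo (-T) (t / 2) := ⟨hτ.1, by nlinarith [hs.2, sq_nonneg l]⟩
          rw [hΦ, indicator_of_mem hm]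
          exact lintegral_square_comp_rescale_le (w := gradNormSq v)
            (IsSmoothSolution.continuous_slice H.smooth_gradNormSq hτ)
            (fun r z θ hr => H.gradNormSq_cyl S hτ hr z θ) hl rfl z
      _ ≤ ENNReal.ofReal (l ^ 4) * ∫⁻ s, ENNReal.ofReal (l⁻¹ ^ 3) * Φ (t + l ^ 2 * s) := by
          gcongr
          exact Measure.restrict_le_self
      _ = ENNReal.ofReal (l ^ 4) * (ENNReal.ofReal (l⁻¹ ^ 3)
            * (ENNReal.ofReal (l ^ 2)⁻¹ * ∫⁻ s, Φ s)) := by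
          rw [lintegral_const_mul' _ _ ENNReal.ofReal_ne_top,
            lintegral_comp_affine t (by positivity) Φ]
      _ ≤ ENNReal.ofReal (l ^ 4) * (ENNReal.ofReal (l⁻¹ ^ 3)
            * (ENNReal.ofReal (l ^ 2)⁻¹ * ENNReal.ofReal E)) := by
          gcongr
          rw [hΦ, lintegral_indicator measurableSet_Ioo]
          exact L.lintegral_gradNormSq_le H hE ⟨by nlinarith [sq_nonneg l], by linarith⟩
      _ = _ := by
          rw [← ENNReal.ofReal_mul (by positivity), ← ENNReal.ofReal_mul (by positivity),
            ← ENNReal.ofReal_mul (by positivity)]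
          congr 1
          field_simp
  obtain ⟨f', h', Γ, Ω, F, U, ef, eh⟩ := hsys.exists_unitFlow hbox hA b1 b2
  have key := hC _ _ _ _ _ _ U (by linarith)
  have ep : rescale l t z (0, 1, 0) = cyl t l z 0 := by simp [rescale_eq_cyl]
  rw [ef, eh, ep, abs_mul, abs_mul, abs_of_pos hl] at key
  rw [le_div_iff₀ (by positivity)]
  calc _ = (l * |vel v 0 (cyl t l z 0)| + l * |vel v 2 (cyl t l z 0)|) * l := by ring
    _ ≤ C * (6 * (E / l)) * Real.sqrt (Real.log (6 * (E / l))) * l := by gcongr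
    _ = _ := by field_simp

/-! ### Return to the cylindrical components -/

theorem IsAxiallySymmetric.components_eq {t : ℝ} (S : IsAxiallySymmetric (v t)) {x : E3}
    (hx : 0 < rad x) : compR (v t) x = vel v 0 (cyl t (rad x) (x 2) 0) ∧
      compZ (v t) x = vel v 2 (cyl t (rad x) (x 2) 0) := by
  obtain ⟨θ, hθ⟩ := exists_cyl (t, x)
  obtain ⟨a, b, c, hc⟩ := S.exists_components hx (x 2)
  have h0 : v t x 0 = a * Real.cos θ - b * Real.sin θ := by
    rw [← (hc θ).1, ← hθ]
    rfl
  have h1 : v t x 1 = a * Real.sin θ + b * Real.cos θ := by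
    rw [← (hc θ).2.1, ← hθ]
    rfl
  have h2 : v t x 2 = c := by
    rw [← (hc θ).2.2, ← hθ]
    rfl
  have x0 : x 0 = rad x * Real.cos θ := congrArg (fun q : W => q.2 0) hθ
  have x1 : x 1 = rad x * Real.sin θ := congrArg (fun q : W => q.2 1) hθ
  have hx' := hx.ne'
  constructor
  · rw [(hc 0).1]
    simp only [compR, eR, PiLp.inner_apply, Fin.sum_univ_three, h0, h1, h2]
    simp only [x0, x1, mul_div_cancel_left₀ _ hx']
    simp
    linear_combination a * Real.sin_sq_add_cos_sq θ
  · rw [(hc 0).2.2]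
    simp [compZ, eZ, PiLp.inner_apply, Fin.sum_univ_three, h2]

/-- For `l ≤ 1/2` one has `|log l| ≥ log 2`, so the constant `log (6 E)` is absorbed into a multiple
of `|log l|`. -/
theorem log_six_mul_div_le {E l : ℝ} (hE : 1 ≤ E) (hl : 0 < l) (hl2 : l ≤ 1 / 2) :
    Real.log (6 * (E / l)) ≤ (1 + Real.log (6 * E) / Real.log 2) * |Real.log l| := by
  have h1 : Real.log l ≤ - Real.log 2 := by
    rw [← Real.log_inv]
    exact Real.log_le_log hl (by linarith)
  have h2 : 0 < Real.log 2 := Real.log_pos (by norm_num)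
  have h3 : 0 ≤ Real.log (6 * E) := Real.log_nonneg (by linarith)
  rw [abs_of_neg (by linarith), ← mul_div_assoc, Real.log_div (by positivity) hl.ne']
  have h4 : Real.log (6 * E) ≤ Real.log (6 * E) / Real.log 2 * -Real.log l := by
    rw [div_mul_eq_mul_div, le_div_iff₀ h2]
    exact mul_le_mul_of_nonneg_left (by linarith) h3
  linarith

end AxiNS

end

theorem theorem1p1 (v₀ : AxiNS.E3 → AxiNS.E3)
    (hv₀ : MemLp v₀ 2 volume)
    (hΓ₀ : MemLp (fun x => AxiNS.rad x * AxiNS.compTheta v₀ x) (⊤ : ℝ≥0∞) volume) :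
    ∃ C : ℝ, ∀ (T : ℝ) (_ : 0 < T) (v : ℝ → AxiNS.E3 → AxiNS.E3) (p : ℝ → AxiNS.E3 → ℝ),
      AxiNS.IsSmoothSolution T v p →
      (∀ t ∈ Ioo (-T) 0, AxiNS.IsAxiallySymmetric (v t)) →
      AxiNS.IsLerayHopf T v₀ v →
      ∀ R : ℝ, R = min 1 (Real.sqrt (T / 2)) →
        ∀ t ∈ Ioo (-(R ^ 2)) 0, ∀ x : AxiNS.E3,
          0 < AxiNS.rad x → AxiNS.rad x ≤ min (1 / 2) R →
            |AxiNS.compR (v t) x| + |AxiNS.compZ (v t) x|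
              ≤ C * Real.sqrt |Real.log (AxiNS.rad x)| / AxiNS.rad x ^ 2 := by
  obtain ⟨C, C0, hC⟩ := AxiNS.exists_halfplane_bound
  -- The lower bound 1 guarantees `E / l ≥ 1` and `log (6 E) ≥ 0`.
  set E : ℝ := max 1 (eLpNorm v₀ 2 volume ^ 2).toReal with hE
  have hE1 : 1 ≤ E := le_max_left _ _
  have hE2 : eLpNorm v₀ 2 volume ^ 2 ≤ ENNReal.ofReal E := by
    rw [← ENNReal.ofReal_toReal (ENNReal.pow_ne_top hv₀.eLpNorm_ne_top)]
    exact ENNReal.ofReal_le_ofReal (le_max_right _ _)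
  set B := 1 + Real.log (6 * E) / Real.log 2
  refine ⟨C * E * Real.sqrt B, fun T hT v p H S L R hR t ht x hx hxR => ?_⟩
  have hl2 : AxiNS.rad x ≤ 1 / 2 := hxR.trans (min_le_left _ _)
  have hlR : AxiNS.rad x ≤ R := hxR.trans (min_le_right _ _)
  -- This leaves room for the rescaled box in time: `t - r² / 2 > -R² - R² / 2 ≥ -3 T / 4`.
  have hRT : R ^ 2 ≤ T / 2 := by
    rw [← Real.sq_sqrt (show 0 ≤ T / 2 by linarith)]
    exact pow_le_pow_left₀ (hx.le.trans hlR) (hR ▸ min_le_right _ _) 2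
  have hsq : AxiNS.rad x ^ 2 ≤ R ^ 2 := pow_le_pow_left₀ hx.le hlR 2
  have ht' : t ∈ Ioo (-T) 0 := ⟨by linarith [ht.1], ht.2⟩
  obtain ⟨eR, eZ⟩ := (S t ht').components_eq hx
  rw [eR, eZ]
  refine (hC E T v₀ v p hE1 hE2 H S L _ t (x 2) hx hl2 (by linarith [ht.1]) ht.2).trans ?_
  have hlog : Real.sqrt (Real.log (6 * (E / AxiNS.rad x)))
      ≤ Real.sqrt B * Real.sqrt |Real.log (AxiNS.rad x)| := by
    rw [← Real.sqrt_mul' _ (abs_nonneg _)]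
    exact Real.sqrt_le_sqrt (AxiNS.log_six_mul_div_le hE1 hx hl2)
  calc _ ≤ C * E * (Real.sqrt B * Real.sqrt |Real.log (AxiNS.rad x)|) / AxiNS.rad x ^ 2 := by
        gcongr
    _ = _ := by ring
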